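/- Let $p\in(2,3]$ and let $(Y_i)_{i\in\mathbb Z}$ be a strictly stationary sequence of centered real random variables in $\mathbb L^p$. Write $\mathcal G_0=\sigma(Y_i,\ i\le 0)$, $\gamma_k=\mathrm{Cov}(Y_0,Y_k)$, $f_Y(\theta)=\frac1{2\pi}\sum_{k\in\mathbb Z}\gamma_k e^{ik\theta}$, $$\lambda_k=\max\Big(\|Y_0\,\mathbb E(Y_k|\mathcal G_0)\|_{p/2},\ \sup_{j\ge i\ge k}\|\mathbb E(Y_iY_j|\mathcal G_0)-\mathbb E(Y_iY_j)\|_{p/2}\Big),\qquad \Lambda_n=\sum_{i=1}^n i\lambda_i,\qquad \eta_n=\sum_{i=0}^n\|\mathbb E(Y_i|\mathcal G_0)\|_p .$$ Let $(\alpha_{i,n})_{i\ge 0,\,n\ge1}$ be an array of real numbers (the boundary values $\alpha_{0,n}$ and $\alpha_{n+1,n}$ are arbitrary; one may take them to be $0$) and put $$m_n=\max_{1\le\ell\le n}|\alpha_{\ell,n}|,\qquad S_n=\sum_{i=1}^n\alpha_{i,n}Y_i,\qquad V_n=\mathrm{Var}(S_n),$$ $$B(n,p)=\begin{cases} m_n^{p-2}\,\eta_n^{p-2}\,(\Lambda_n+\eta_n^2)\big(\sum_{\ell=1}^n\alpha_{\ell,n}^2\big)^{(3-p)/2}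 & \text{if } p\in(2,3),\\[4pt] m_n\,\eta_n\,(\Lambda_n+\eta_n^2)\,\log\Big(m_n^{-1}\big(\sum_{\ell=1}^n\alpha_{\ell,n}^2\big)^{1/2}\Big) & \text{if } p=3,\end{cases}$$ where for $p=3$ the quantity $B(n,p)$ is understood to be $0$ if $m_n=0$. Denote by $P_{S_n}$ the law of $S_n$, by $G_v$ the normal law $\mathcal N(0,v)$ (the Dirac mass at $0$ if $v=0$), and by $W_1(\mu,\nu)=\inf\int|x-y|\,P(dx,dy)$ the Wasserstein distance of order $1$, the infimum being over all probability laws $P$ on $\mathbb R^2$ with marginals $\mu$ and $\nu$. Assume that $\sum_{k\ge1}k^2|\gamma_k|<\infty$ and $f_Y(0)>0$. Then there is a positive constant $C$, not depending on $n$, such that for every $n\ge1$ $$W_1(P_{S_n},G_{V_n})\le C\left(m_n\sum_{k=0}^n\|\mathbb E(Y_k|\mathcal G_0)\|_2+B(n,p)+\Big(\sum_{k=1}^{n+1}(\alpha_{k,n}-\alpha_{k-1,n})^2\Big)^{1/2}\right).$$ -/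

import Mathlib

open MeasureTheory ProbabilityTheory
open scoped ENNReal NNReal

noncomputable section

namespace LinStat

/-! ### Minimal (Wasserstein) distances on the real line -/

/-- `P` is a probability law on `ℝ²` with marginals `μ` and `ν`. -/
def IsCoupling (μ ν : Measure ℝ) (P : Measure (ℝ × ℝ)) : Prop :=
  IsProbabilityMeasure P ∧ P.map Prod.fst = μ ∧ P.map Prod.snd = ν

/-- The minimal distance of order `r > 0`: the infimum over all couplings `P` of `μ` and `ν` of
`(∫ |x - y|^r dP)^(1 / max(1, r))`, as an extended nonnegative real. -/
def wasserstein (r : ℝ) (μ ν : Measure ℝ) : ℝ≥0∞ :=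
  ⨅ (P : Measure (ℝ × ℝ)) (_ : IsCoupling μ ν P),
    (∫⁻ z, ENNReal.ofReal (|z.1 - z.2| ^ r) ∂P) ^ (1 / max 1 r)

variable {Ω : Type*} [MeasurableSpace Ω]

/-! ### The stationary sequence -/

/-- Strict stationarity: the law of the whole sequence is invariant under every shift. -/
def StrictlyStationary (Y : ℤ → Ω → ℝ) (μ : Measure Ω) : Prop :=
  ∀ h : ℤ, μ.map (fun ω (i : ℤ) => Y (i + h) ω) = μ.map (fun ω (i : ℤ) => Y i ω)

/-- The `σ`-algebra `σ(Y_i, i ≤ k)`. -/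
abbrev past (Y : ℤ → Ω → ℝ) (k : ℤ) : MeasurableSpace Ω :=
  ⨆ (i : ℤ) (_ : i ≤ k), MeasurableSpace.comap (Y i) inferInstance

/-- The norm `‖f‖_q = (E |f|^q)^(1/q)`. -/
def normL (q : ℝ) (f : Ω → ℝ) (μ : Measure Ω) : ℝ :=
  (eLpNorm f (ENNReal.ofReal q) μ).toReal

/-- The autocovariance `γ_k = Cov(Y_0, Y_k)`. -/
def autocov (Y : ℤ → Ω → ℝ) (μ : Measure Ω) (k : ℤ) : ℝ :=
  covariance (Y 0) (Y k) μ

/-- The spectral density `f_Y(θ) = (2π)⁻¹ ∑_{k ∈ ℤ} γ_k exp(i k θ)`. The sum of the series is real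
for a stationary sequence, since then `γ_{-k} = γ_k`. -/
def spectralDensity (Y : ℤ → Ω → ℝ) (μ : Measure Ω) (θ : ℝ) : ℝ :=
  1 / (2 * Real.pi) *
    (∑' k : ℤ, (autocov Y μ k : ℂ) * Complex.exp (Complex.I * (k : ℂ) * (θ : ℂ))).re

/-- The coefficient `λ_k`: the maximum of `‖Y_0 E(Y_k | G_0)‖_{p/2}` and of the supremum over
`j ≥ i ≥ k` of `‖E(Y_i Y_j | G_0) - E(Y_i Y_j)‖_{p/2}`. The supremum is taken in `[0, ∞]`; it is
finite as soon as the sequence is stationary and in `L^p` with `p ≥ 2`. -/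
def lam (p : ℝ) (Y : ℤ → Ω → ℝ) (μ : Measure Ω) (k : ℕ) : ℝ :=
  (max (eLpNorm (fun ω => Y 0 ω * (μ[Y k | past Y 0]) ω) (ENNReal.ofReal (p / 2)) μ)
    (⨆ (i : ℕ) (j : ℕ) (_ : k ≤ i) (_ : i ≤ j),
      eLpNorm (fun ω => (μ[fun ω' => Y i ω' * Y j ω' | past Y 0]) ω - ∫ ω', Y i ω' * Y j ω' ∂μ)
        (ENNReal.ofReal (p / 2)) μ)).toReal

/-- `Λ_n = ∑_{i=1}^n i λ_i`. -/
def Lam (p : ℝ) (Y : ℤ → Ω → ℝ) (μ : Measure Ω) (n : ℕ) : ℝ :=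
  ∑ i ∈ Finset.Icc 1 n, (i : ℝ) * lam p Y μ i

/-- `∑_{i=0}^n ‖E(Y_i | G_0)‖_q`. -/
def condSum (q : ℝ) (Y : ℤ → Ω → ℝ) (μ : Measure Ω) (n : ℕ) : ℝ :=
  ∑ i ∈ Finset.range (n + 1), normL q (μ[Y i | past Y 0]) μ

/-- `η_n = ∑_{i=0}^n ‖E(Y_i | G_0)‖_p`. -/
def eta (p : ℝ) (Y : ℤ → Ω → ℝ) (μ : Measure Ω) (n : ℕ) : ℝ :=
  condSum p Y μ n

/-! ### The linear statistic; `α i n` stands for `α_{i,n}` -/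

/-- `m_n = max_{1 ≤ ℓ ≤ n} |α_{ℓ,n}|` (and `0` if `n = 0`). -/
def maxCoef (α : ℕ → ℕ → ℝ) (n : ℕ) : ℝ :=
  (((Finset.Icc 1 n).sup fun l => ‖α l n‖₊ : ℝ≥0) : ℝ)

/-- `∑_{ℓ=1}^n α_{ℓ,n}²`. -/
def sumSq (α : ℕ → ℕ → ℝ) (n : ℕ) : ℝ :=
  ∑ l ∈ Finset.Icc 1 n, α l n ^ 2

/-- `S_n = ∑_{i=1}^n α_{i,n} Y_i`. -/
def linStat (α : ℕ → ℕ → ℝ) (Y : ℤ → Ω → ℝ) (n : ℕ) (ω : Ω) : ℝ :=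
  ∑ i ∈ Finset.Icc 1 n, α i n * Y i ω

/-- `V_n = Var(S_n)`, as a nonnegative real. -/
def linVar (α : ℕ → ℕ → ℝ) (Y : ℤ → Ω → ℝ) (μ : Measure Ω) (n : ℕ) : ℝ≥0 :=
  (variance (linStat α Y n) μ).toNNReal

/-- The quantity `B(n,p)`. For `p = 3` the logarithm is that of `m_n⁻¹ (∑ α_{ℓ,n}²)^{1/2}`, which is
at least `1` unless all the coefficients `α_{ℓ,n}` vanish (and then `m_n = 0`). -/
def B (α : ℕ → ℕ → ℝ) (p : ℝ) (Y : ℤ → Ω → ℝ) (μ : Measure Ω) (n : ℕ) : ℝ :=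
  if p = 3 then
    maxCoef α n * eta p Y μ n * (Lam p Y μ n + eta p Y μ n ^ 2) *
      Real.log ((maxCoef α n)⁻¹ * Real.sqrt (sumSq α n))
  else
    maxCoef α n ^ (p - 2) * eta p Y μ n ^ (p - 2) * (Lam p Y μ n + eta p Y μ n ^ 2) *
      sumSq α n ^ ((3 - p) / 2)

end LinStat

end

/-! The proof is Lindeberg's replacement method for dependent variables, run directly on Lipschitz
test functions. By duality (`wasserstein_one_le_of_forall_lipschitz`) it suffices to bound `E f(S_n)
- E f(N)` uniformly over bounded 1-Lipschitz `f`, with `N` centered normal of variance `V_n`.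

Write `a_l = α_{l+1,n}` for `l < n` and `0` beyond, `δ²` for the sum of squared increments in the
statement, `t = m_n + δ`, and `s = γ_0 + 2 ∑_{k≥1} γ_k = 2π f_Y(0) > 0`. Let `f_v` be `f` smoothed
by `N(0,v)`, `S_i` the partial sum and `v_i = t² + s ∑_{l≥i} a_l²`. Then `E f_{v_i}(S_i)` passes
from the integral of `f` under `N(0,v_0)` at `i = 0` to `E f_{t²}(S_n)` at `i = n`. Removing the
smoothing costs `t`, and exchanging `v_0` for `V_n` costs a multiple of `t`.

The second derivative of `f_v` is Hölder of exponent `p - 2` with constant of order `v^{-(p-1)/2}`,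
so step `i` has Taylor error `|a_i|^p K_i`, `K_i = v_{i+1}^{-(p-1)/2}` (`exists_lindeberg_step`).
Under dependence the first-order term does not vanish: it is unwound along the past into terms `a_i
a_j E(q_j Y_{j+1} Y_{i+1})`, with `q_j` the second derivative at time `j`. Unwinding `q_j` in turn
replaces the product by `γ_{i-j}`, with errors `λ` at the larger of two time gaps, whose sum is of
order `Λ_n`. The quadratic form that remains is nearly diagonal, since `a` and `E q_j` vary slowly
and `∑ k²|γ_k|` converges (`abs_quadratic_sub_le`). By the choice of `s`, its diagonal part cancels
the Gaussian second-order term (`abs_integral_G_sub_le`).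

Apart from terms of order `t`, every error is a multiple of `m_n^{p-2} (1 + Λ_n + η_n) ∑ a_i² K_i`.
As `s a_i² = v_i - v_{i+1}`, the last sum is a Riemann sum of `v^{-(p-1)/2}`: it gives a power when
`p < 3` (`sum_weights_le_rpow`) and a logarithm when `p = 3` (`sum_weights_le_log`). Positivity of
`f_Y(0)` also forces `Y_0 ≠ 0`, which bounds `η_n` below and lets `m_n`, `1` and `η_n` be absorbed
into the stated terms. -/

namespace LinStat

/-! ### Kantorovich duality on the real line -/

/-- The quantile function of a law on `ℝ`. -/
noncomputable def quantile (μ : Measure ℝ) (u : ℝ) : ℝ := sInf {x | u ≤ cdf μ x}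

/-- Right continuity of the distribution function makes the infimum attained; `0 < u < 1` makes the
defining set nonempty and bounded below. -/
lemma quantile_le_iff (μ : Measure ℝ) {u : ℝ} (hu : u ∈ Set.Ioo (0 : ℝ) 1) (x : ℝ) :
    quantile μ u ≤ x ↔ u ≤ cdf μ x := by
  have hne : {x | u ≤ cdf μ x}.Nonempty := by
    obtain ⟨y, hy⟩ := ((tendsto_cdf_atTop μ).eventually (eventually_gt_nhds hu.2)).exists
    exact ⟨y, hy.le⟩
  have hbdd : BddBelow {x | u ≤ cdf μ x} := by
    obtain ⟨y, hy⟩ := ((tendsto_cdf_atBot μ).eventually (eventually_lt_nhds hu.1)).exists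
    refine ⟨y, fun z hz => ?_⟩
    by_contra hlt
    exact absurd (hz.trans (monotone_cdf μ (not_le.1 hlt).le)) (not_le.2 hy)
  constructor
  · intro h
    have hr : Filter.Tendsto (cdf μ) (nhdsWithin x (Set.Ioi x)) (nhds (cdf μ x)) :=
      ((cdf μ).right_continuous x).mono Set.Ioi_subset_Ici_self
    refine ge_of_tendsto hr ?_
    filter_upwards [self_mem_nhdsWithin] with y hy
    obtain ⟨z, hz, hzy⟩ := exists_lt_of_csInf_lt hne (lt_of_le_of_lt h hy)
    exact le_trans hz (monotone_cdf μ hzy.le)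
  · intro h
    exact csInf_le hbdd h

lemma aemeasurable_quantile (μ : Measure ℝ) :
    AEMeasurable (quantile μ) (volume.restrict (Set.Ioo (0 : ℝ) 1)) := by
  refine aemeasurable_restrict_of_monotoneOn measurableSet_Ioo fun u hu v hv huv => ?_
  rw [quantile_le_iff μ hu]
  exact huv.trans ((quantile_le_iff μ hv _).1 le_rfl)

lemma map_quantile (μ : Measure ℝ) [IsProbabilityMeasure μ] :
    (volume.restrict (Set.Ioo (0 : ℝ) 1)).map (quantile μ) = μ := by
  have : IsProbabilityMeasure (volume.restrict (Set.Ioo (0 : ℝ) 1)) := ⟨by simp⟩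
  have : IsProbabilityMeasure ((volume.restrict (Set.Ioo (0 : ℝ) 1)).map (quantile μ)) :=
    Measure.isProbabilityMeasure_map (aemeasurable_quantile μ)
  refine Measure.ext_of_Iic _ _ fun x => ?_
  rw [Measure.map_apply_of_aemeasurable (aemeasurable_quantile μ) measurableSet_Iic,
    ← ofReal_cdf μ x]
  have h0 := cdf_nonneg μ x
  have h1 := cdf_le_one μ x
  rw [Measure.restrict_apply' measurableSet_Ioo]
  have : quantile μ ⁻¹' Set.Iic x ∩ Set.Ioo 0 1 = Set.Ioc 0 (cdf μ x) ∩ Set.Ioo 0 1 := by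
    ext u
    simp only [Set.mem_inter_iff, Set.mem_preimage, Set.mem_Iic, Set.mem_Ioc]
    constructor
    · rintro ⟨h, hu⟩
      exact ⟨⟨hu.1, (quantile_le_iff μ hu x).1 h⟩, hu⟩
    · rintro ⟨h, hu⟩
      exact ⟨(quantile_le_iff μ hu x).2 h.2, hu⟩
  rw [this]
  apply le_antisymm
  · refine (measure_mono Set.inter_subset_left).trans ?_
    simp
  · have hsub : Set.Ioo 0 (cdf μ x) ⊆ Set.Ioc 0 (cdf μ x) ∩ Set.Ioo 0 1 :=
      fun u hu => ⟨⟨hu.1, hu.2.le⟩, hu.1, hu.2.trans_le h1⟩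
    simpa using measure_mono (μ := volume) hsub

/-- The quantile coupling drives both laws by the same uniform variable. The gap between the two
quantiles is the length of an interval of levels, and Tonelli's theorem turns it into the gap
between the distribution functions. -/
lemma wasserstein_one_le_lintegral_cdf (μ ν : Measure ℝ) [IsProbabilityMeasure μ]
    [IsProbabilityMeasure ν] :
    wasserstein 1 μ ν ≤ ∫⁻ t, ENNReal.ofReal |cdf μ t - cdf ν t| := by
  have hP : IsProbabilityMeasure (volume.restrict (Set.Ioo (0 : ℝ) 1)) := ⟨by simp⟩
  have hm : AEMeasurable (fun u => (quantile μ u, quantile ν u))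
      (volume.restrict (Set.Ioo (0 : ℝ) 1)) :=
    (aemeasurable_quantile μ).prodMk (aemeasurable_quantile ν)
  set P := (volume.restrict (Set.Ioo (0 : ℝ) 1)).map fun u => (quantile μ u, quantile ν u) with hPdef
  have hc : IsCoupling μ ν P := by
    refine ⟨Measure.isProbabilityMeasure_map hm, ?_, ?_⟩
    · rw [hPdef, AEMeasurable.map_map_of_aemeasurable measurable_fst.aemeasurable hm]
      exact map_quantile μ
    · rw [hPdef, AEMeasurable.map_map_of_aemeasurable measurable_snd.aemeasurable hm]
      exact map_quantile ν
  refine (iInf₂_le P hc).trans ?_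
  simp only [Real.rpow_one, max_self, div_one, ENNReal.rpow_one]
  have hF : Measurable (cdf μ) := (monotone_cdf μ).measurable
  have hG : Measurable (cdf ν) := (monotone_cdf ν).measurable
  -- The region between the two distribution functions: its section at fixed `u` is the interval
  -- between the quantiles, at fixed `t` the interval between the values of the distribution
  -- functions.
  set E : Set (ℝ × ℝ) := {z | min (cdf μ z.2) (cdf ν z.2) < z.1 ∧
    z.1 ≤ max (cdf μ z.2) (cdf ν z.2)} with hE
  have hEm : MeasurableSet E := by
    refine MeasurableSet.inter ?_ ?_
    · exact measurableSet_lt ((hF.comp measurable_snd).min (hG.comp measurable_snd)) measurable_fst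
    · exact measurableSet_le measurable_fst ((hF.comp measurable_snd).max (hG.comp measurable_snd))
  calc ∫⁻ z, ENNReal.ofReal |z.1 - z.2| ∂P
      = ∫⁻ u in Set.Ioo (0 : ℝ) 1, ENNReal.ofReal |quantile μ u - quantile ν u| :=
        lintegral_map' (by fun_prop) hm
    _ = ∫⁻ u in Set.Ioo (0 : ℝ) 1, ∫⁻ t, E.indicator 1 (u, t) := by
        refine setLIntegral_congr_fun measurableSet_Ioo fun u hu => ?_
        have h1 : ∀ t, E.indicator (1 : ℝ × ℝ → ℝ≥0∞) (u, t) =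
            (Set.Ico (min (quantile μ u) (quantile ν u)) (max (quantile μ u) (quantile ν u))).indicator
              1 t := by
          intro t
          have a1 := quantile_le_iff μ hu t
          have a2 := quantile_le_iff ν hu t
          have : (u, t) ∈ E ↔
              t ∈ Set.Ico (min (quantile μ u) (quantile ν u)) (max (quantile μ u) (quantile ν u)) := by
            simp only [hE, Set.mem_ofPred_eq, Set.mem_Ico, ← not_le, le_max_iff, le_min_iff,
              max_le_iff, min_le_iff, a1, a2]
            tauto
          by_cases h : (u, t) ∈ E
          · rw [Set.indicator_of_mem h, Set.indicator_of_mem (this.1 h)]; rfl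
          · rw [Set.indicator_of_notMem h, Set.indicator_of_notMem (fun h' => h (this.2 h'))]
        simp only [h1]
        rw [lintegral_indicator_one measurableSet_Ico, Real.volume_Ico, max_sub_min_eq_abs']
    _ = ∫⁻ t, ∫⁻ u in Set.Ioo (0 : ℝ) 1, E.indicator 1 (u, t) := by
        refine lintegral_lintegral_swap ?_
        exact ((measurable_one.indicator hEm)).aemeasurable
    _ ≤ ∫⁻ t, ENNReal.ofReal |cdf μ t - cdf ν t| := by
        refine lintegral_mono fun t => ?_
        refine (lintegral_mono' Measure.restrict_le_self le_rfl).trans ?_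
        have h1 : ∀ u, E.indicator (1 : ℝ × ℝ → ℝ≥0∞) (u, t) =
            (Set.Ioc (min (cdf μ t) (cdf ν t)) (max (cdf μ t) (cdf ν t))).indicator 1 u := by
          intro u; rfl
        simp only [h1]
        rw [lintegral_indicator_one measurableSet_Ioc, Real.volume_Ioc, max_sub_min_eq_abs']

/-- The function `x ↦ ∫_{t < x} s(t) dt`. -/
noncomputable def primitive (s : ℝ → ℝ) (x : ℝ) : ℝ := ∫ t in Set.Iio x, s t

lemma abs_primitive_sub_le {s : ℝ → ℝ} (hs : Integrable s) (hb : ∀ t, |s t| ≤ 1) (x y : ℝ) :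
    |primitive s x - primitive s y| ≤ |x - y| := by
  wlog h : y ≤ x generalizing x y
  · rw [abs_sub_comm, abs_sub_comm x]; exact this y x (not_le.1 h).le
  have : primitive s x - primitive s y = ∫ t in Set.Ico y x, s t := by
    have hu : Set.Iio x = Set.Iio y ∪ Set.Ico y x := (Set.Iio_union_Ico_eq_Iio h).symm
    unfold primitive
    rw [hu, setIntegral_union _ measurableSet_Ico hs.integrableOn hs.integrableOn]
    · ring
    · rw [Set.disjoint_left]; intro z hz hz'; exact absurd hz'.1 (not_le.2 hz)
  rw [this]
  have h2 := norm_setIntegral_le_of_norm_le_const (μ := volume) (s := Set.Ico y x) (f := s) (C := 1)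
    (by simp) (fun t _ => hb t)
  rw [Real.norm_eq_abs] at h2
  refine h2.trans ?_
  rw [one_mul, measureReal_def, Real.volume_Ico, ENNReal.toReal_ofReal (by linarith)]
  exact le_abs_self _

lemma abs_primitive_le {s : ℝ → ℝ} (hs : Integrable s) (x : ℝ) :
    |primitive s x| ≤ ∫ t, |s t| := by
  unfold primitive
  refine (abs_integral_le_integral_abs).trans ?_
  exact setIntegral_le_integral hs.abs (Filter.Eventually.of_forall fun t => abs_nonneg _)

/-- Fubini. When `s` is a sign, it makes an integral of `|cdf μ - cdf ν|` the difference of the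
integrals of one Lipschitz function. -/
lemma integral_primitive {s : ℝ → ℝ} (hs : Integrable s) (μ : Measure ℝ)
    [IsProbabilityMeasure μ] :
    ∫ x, primitive s x ∂μ = ∫ t, s t * (1 - cdf μ t) := by
  have hE : MeasurableSet {z : ℝ × ℝ | z.2 < z.1} := measurableSet_lt measurable_snd measurable_fst
  have h1 : ∀ x, primitive s x = ∫ t, {z : ℝ × ℝ | z.2 < z.1}.indicator (fun z => s z.2) (x, t) := by
    intro x
    unfold primitive
    rw [← integral_indicator measurableSet_Iio]
    rfl
  simp only [h1]
  rw [integral_integral_swap]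
  · refine integral_congr_ae (Filter.Eventually.of_forall fun t => ?_)
    have h2 : ∀ x, {z : ℝ × ℝ | z.2 < z.1}.indicator (fun z => s z.2) (x, t) =
        (Set.Ioi t).indicator (fun _ => s t) x := fun x => rfl
    simp only [h2]
    rw [integral_indicator measurableSet_Ioi, setIntegral_const, smul_eq_mul, mul_comm,
      cdf_eq_real, ← Set.compl_Iic, measureReal_compl measurableSet_Iic]
    simp
  · exact (hs.comp_snd μ).indicator hE

/-- The hard half of Kantorovich duality, in dimension one: the extremal test function is a
primitive of the sign of the difference of the distribution functions. -/
theorem wasserstein_one_le_of_forall_lipschitz (μ ν : Measure ℝ) [IsProbabilityMeasure μ]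
    [IsProbabilityMeasure ν] (K : ℝ)
    (h : ∀ f : ℝ → ℝ, (∀ x y, |f x - f y| ≤ |x - y|) → (∃ M, ∀ x, |f x| ≤ M) →
      ∫ x, f x ∂μ - ∫ x, f x ∂ν ≤ K) :
    wasserstein 1 μ ν ≤ ENNReal.ofReal K := by
  refine (wasserstein_one_le_lintegral_cdf μ ν).trans ?_
  have hF : Measurable (cdf μ) := (monotone_cdf μ).measurable
  have hG : Measurable (cdf ν) := (monotone_cdf ν).measurable
  have hcov := aecover_Icc (μ := (volume : Measure ℝ)) (l := Filter.atTop)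
    (a := fun N : ℕ => -(N : ℝ)) (b := fun N : ℕ => (N : ℝ))
    (Filter.tendsto_neg_atTop_atBot.comp tendsto_natCast_atTop_atTop) tendsto_natCast_atTop_atTop
  have hlim := hcov.lintegral_tendsto_of_countably_generated
    (f := fun t => ENNReal.ofReal |cdf μ t - cdf ν t|) (by fun_prop)
  refine le_of_tendsto' hlim fun N => ?_
  -- Truncating the sign to `[-N, N]` keeps its primitive bounded; the limit in `N` is already taken
  -- by `le_of_tendsto'`.
  set s : ℝ → ℝ := (Set.Icc (-(N : ℝ)) N).indicator
    fun t => if cdf μ t ≤ cdf ν t then 1 else -1 with hs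
  have hsm : Measurable s := by
    refine Measurable.indicator ?_ measurableSet_Icc
    exact Measurable.ite (measurableSet_le hF hG) measurable_const measurable_const
  have hsb : ∀ t, |s t| ≤ (Set.Icc (-(N : ℝ)) N).indicator (fun _ => (1 : ℝ)) t := by
    intro t
    by_cases ht : t ∈ Set.Icc (-(N : ℝ)) N
    · rw [hs, Set.indicator_of_mem ht, Set.indicator_of_mem ht]; split_ifs <;> simp
    · rw [hs, Set.indicator_of_notMem ht, Set.indicator_of_notMem ht]; simp
  have hsb1 : ∀ t, |s t| ≤ 1 := fun t => (hsb t).trans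
    (Set.indicator_le_self' (fun _ _ => zero_le_one) t)
  have hind : Integrable ((Set.Icc (-(N : ℝ)) N).indicator (fun _ => (1 : ℝ))) := by
    rw [integrable_indicator_iff measurableSet_Icc]
    exact integrableOn_const (by simp)
  have hsi : Integrable s := hind.mono' hsm.aestronglyMeasurable (Filter.Eventually.of_forall hsb)
  have key := h (primitive s) (abs_primitive_sub_le hsi hsb1) ⟨_, abs_primitive_le hsi⟩
  rw [integral_primitive hsi, integral_primitive hsi, ← integral_sub] at key
  · have h3 : ∀ t, s t * (1 - cdf μ t) - s t * (1 - cdf ν t) =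
        (Set.Icc (-(N : ℝ)) N).indicator (fun t => |cdf μ t - cdf ν t|) t := by
      intro t
      by_cases ht : t ∈ Set.Icc (-(N : ℝ)) N
      · rw [hs, Set.indicator_of_mem ht, Set.indicator_of_mem ht]
        split_ifs with hle
        · rw [abs_of_nonpos (by linarith)]; ring
        · rw [abs_of_pos (by linarith [not_le.1 hle])]; ring
      · rw [hs, Set.indicator_of_notMem ht, Set.indicator_of_notMem ht]; ring
    simp only [h3] at key
    rw [integral_indicator measurableSet_Icc] at key
    rw [← ofReal_integral_eq_lintegral_ofReal]
    · exact ENNReal.ofReal_le_ofReal key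
    · refine Integrable.mono' (g := fun _ => (1 : ℝ)) (integrableOn_const (by simp))
        (by fun_prop) (Filter.Eventually.of_forall fun t => ?_)
      have a1 := cdf_nonneg μ t
      have a2 := cdf_le_one μ t
      have a3 := cdf_nonneg ν t
      have a4 := cdf_le_one ν t
      rw [Real.norm_eq_abs, abs_abs, abs_le]
      constructor <;> linarith
    · exact Filter.Eventually.of_forall fun t => abs_nonneg _
  all_goals
    refine hsi.mul_bdd (c := 1) (by fun_prop) (Filter.Eventually.of_forall fun t => ?_)
    rw [Real.norm_eq_abs, abs_le]
  · constructor <;> linarith [cdf_nonneg μ t, cdf_le_one μ t]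
  · constructor <;> linarith [cdf_nonneg ν t, cdf_le_one ν t]

end LinStat

namespace LinStat

/-! ### Gaussian smoothing of Lipschitz functions -/

/-- A function is a bounded contraction. -/
def BddContraction (f : ℝ → ℝ) : Prop :=
  (∀ x y, |f x - f y| ≤ |x - y|) ∧ ∃ M, ∀ x, |f x| ≤ M

lemma BddContraction.continuous {f : ℝ → ℝ} (hf : BddContraction f) : Continuous f := by
  have : LipschitzWith 1 f := LipschitzWith.of_dist_le_mul fun x y => by
    simpa [Real.dist_eq] using hf.1 x y
  exact this.continuous

lemma integrable_exp_neg_abs : Integrable fun z : ℝ => Real.exp (-|z|) := by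
  rw [← integrableOn_univ, ← Set.Iic_union_Ioi (a := (0 : ℝ)), integrableOn_union]
  constructor
  · refine (integrableOn_exp_Iic 0).congr_fun (fun z hz => ?_) measurableSet_Iic
    rw [abs_of_nonpos hz, neg_neg]
  · refine (integrableOn_exp_neg_Ioi 0).congr_fun (fun z hz => ?_) measurableSet_Ioi
    rw [abs_of_pos hz]

/-- Convolution with a kernel. -/
noncomputable def kernelConv (f K : ℝ → ℝ) (x : ℝ) : ℝ := ∫ y, f y * K (x - y)

/-- A continuous kernel with exponential decay. -/
def ExpDecay (K : ℝ → ℝ) : Prop :=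
  Continuous K ∧ ∃ C, ∀ z, |K z| ≤ C * Real.exp (-(2 * |z|))

lemma ExpDecay.le {K : ℝ → ℝ} (hK : ExpDecay K) :
    ∃ C, 0 ≤ C ∧ ∀ z, |K z| ≤ C * Real.exp (-|z|) ∧ |z| * |K z| ≤ C * Real.exp (-|z|) := by
  obtain ⟨C, hC⟩ := hK.2
  have hC0 : 0 ≤ C := by
    have := (abs_nonneg _).trans (hC 0)
    simpa using this
  refine ⟨C, hC0, fun z => ?_⟩
  have h1 : Real.exp (-(2 * |z|)) = Real.exp (-|z|) * Real.exp (-|z|) := by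
    rw [← Real.exp_add]; ring_nf
  have h2 : Real.exp (-|z|) ≤ 1 := Real.exp_le_one_iff.2 (by simp)
  have h3 : |z| * Real.exp (-|z|) ≤ 1 := by
    have := Real.add_one_le_exp |z|
    rw [Real.exp_neg, ← div_eq_mul_inv, div_le_one (Real.exp_pos _)]
    linarith
  have hp := Real.exp_pos (-|z|)
  constructor
  · refine (hC z).trans ?_
    rw [h1]
    exact mul_le_mul_of_nonneg_left (by nlinarith) hC0
  · calc |z| * |K z| ≤ |z| * (C * Real.exp (-(2 * |z|))) :=
          mul_le_mul_of_nonneg_left (hC z) (abs_nonneg _)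
      _ = C * Real.exp (-|z|) * (|z| * Real.exp (-|z|)) := by rw [h1]; ring
      _ ≤ C * Real.exp (-|z|) * 1 := mul_le_mul_of_nonneg_left h3 (by positivity)
      _ = _ := mul_one _

lemma ExpDecay.integrable {K : ℝ → ℝ} (hK : ExpDecay K) : Integrable K := by
  obtain ⟨C, -, hC⟩ := hK.le
  exact (integrable_exp_neg_abs.const_mul C).mono' hK.1.aestronglyMeasurable
    (Filter.Eventually.of_forall fun z => (hC z).1)

lemma ExpDecay.integrable_abs_mul {K : ℝ → ℝ} (hK : ExpDecay K) :
    Integrable fun z => |z| * |K z| := by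
  obtain ⟨C, -, hC⟩ := hK.le
  have := hK.1
  refine (integrable_exp_neg_abs.const_mul C).mono' (by fun_prop)
    (Filter.Eventually.of_forall fun z => ?_)
  rw [Real.norm_eq_abs, abs_of_nonneg (by positivity)]
  exact (hC z).2

lemma ExpDecay.hasDerivAt_kernelConv {f K K' : ℝ → ℝ} (hf : BddContraction f) (hK : ExpDecay K)
    (hK' : ExpDecay K') (hd : ∀ z, HasDerivAt K (K' z) z) (x : ℝ) :
    HasDerivAt (kernelConv f K) (kernelConv f K' x) x := by
  obtain ⟨M, hM⟩ := hf.2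
  have hfc := hf.continuous
  have hKc := hK.1
  have hKc' := hK'.1
  obtain ⟨C, hC0, hC⟩ := hK'.le
  have hM0 : 0 ≤ M := (abs_nonneg _).trans (hM 0)
  unfold kernelConv
  refine (hasDerivAt_integral_of_dominated_loc_of_deriv_le
    (F := fun x y => f y * K (x - y)) (F' := fun x y => f y * K' (x - y))
    (bound := fun y => M * (C * (Real.exp 1 * Real.exp (-|x - y|))))
    (Metric.ball_mem_nhds x one_pos) ?_ ?_ ?_ ?_ ?_ ?_).2
  · exact Filter.Eventually.of_forall fun x => by fun_prop
  · exact (hK.integrable.comp_sub_left x).bdd_mul (c := M) (by fun_prop)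
      (Filter.Eventually.of_forall hM)
  · fun_prop
  · refine Filter.Eventually.of_forall fun y x' hx' => ?_
    rw [norm_mul]
    refine mul_le_mul (hM y) ((hC _).1.trans (mul_le_mul_of_nonneg_left ?_ hC0))
      (norm_nonneg _) hM0
    -- Within distance one of `x` the exponential grows by a factor at most `e`, hence `Real.exp 1`
    -- in the dominating function.
    rw [← Real.exp_add, Real.exp_le_exp]
    rw [Metric.mem_ball, Real.dist_eq] at hx'
    have h1 : |x - y| ≤ |x' - y| + |x' - x| := by
      have := abs_sub (x' - y) (x' - x)
      rwa [show x' - y - (x' - x) = x - y by ring] at this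
    linarith
  · exact (((integrable_exp_neg_abs.comp_sub_left x).const_mul _).const_mul _).const_mul _
  · refine Filter.Eventually.of_forall fun y x' _ => ?_
    have := ((hd (x' - y)).comp_sub_const x' y).const_mul (f y)
    simpa using this

/-- Since the kernel has integral zero, `f x` may be subtracted from `f y`, and only the Lipschitz
constant of `f` enters: the bound does not depend on the supremum of `f`. -/
lemma ExpDecay.abs_kernelConv_le {f K : ℝ → ℝ} (hf : BddContraction f) (hK : ExpDecay K)
    (h0 : ∫ z, K z = 0) (x : ℝ) : |kernelConv f K x| ≤ ∫ z, |z| * |K z| := by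
  obtain ⟨M, hM⟩ := hf.2
  have hfc := hf.continuous
  have hKi := hK.integrable.comp_sub_left x
  have h1 : kernelConv f K x = ∫ y, (f y - f x) * K (x - y) := by
    simp only [sub_mul]
    rw [integral_sub (hKi.bdd_mul (c := M) (by fun_prop) (Filter.Eventually.of_forall hM))
      (hKi.const_mul _), integral_const_mul, integral_sub_left_eq_self K volume x, h0]
    simp [kernelConv]
  have hi := hK.integrable_abs_mul.comp_sub_left x
  rw [h1, ← integral_sub_left_eq_self (fun z => |z| * |K z|) volume x]
  refine abs_integral_le_integral_abs.trans ?_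
  refine integral_mono_of_nonneg (Filter.Eventually.of_forall fun _ => abs_nonneg _) hi
    (Filter.Eventually.of_forall fun y => ?_)
  simp only [abs_mul]
  rw [abs_sub_comm x y]
  exact mul_le_mul_of_nonneg_right (hf.1 y x) (abs_nonneg _)

/-- The standard normal density. -/
noncomputable def stdDensity (z : ℝ) : ℝ := gaussianPDFReal 0 1 z

lemma stdDensity_eq (z : ℝ) : stdDensity z = (√(2 * Real.pi))⁻¹ * Real.exp (-z ^ 2 / 2) := by
  simp [stdDensity, gaussianPDFReal]

lemma hasDerivAt_stdDensity (z : ℝ) : HasDerivAt stdDensity (-z * stdDensity z) z := by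
  have h : stdDensity = fun z => (√(2 * Real.pi))⁻¹ * Real.exp (-z ^ 2 / 2) :=
    funext stdDensity_eq
  have h1 : HasDerivAt (fun z : ℝ => -z ^ 2 / 2) (-z) z := by
    refine ((hasDerivAt_pow 2 z).neg.div_const 2).congr_deriv ?_
    simp; ring
  rw [stdDensity_eq, h]
  refine ((h1.exp).const_mul _).congr_deriv ?_
  ring

lemma continuous_stdDensity : Continuous stdDensity :=
  continuous_iff_continuousAt.2 fun z => (hasDerivAt_stdDensity z).continuousAt

/-- Meant for the polynomial factors of the normal density and its first three derivatives; 24 is a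
generous constant for all of them. -/
lemma expDecay_mul_stdDensity {P : ℝ → ℝ} (hP : Continuous P)
    (hb : ∀ z, |P z| ≤ 24 * Real.exp |z|) : ExpDecay fun z => P z * stdDensity z := by
  refine ⟨hP.mul continuous_stdDensity, 24 * ((√(2 * Real.pi))⁻¹ * Real.exp 5), fun z => ?_⟩
  have h0 : 0 ≤ stdDensity z := gaussianPDFReal_nonneg _ _ _
  rw [abs_mul, abs_of_nonneg h0]
  refine (mul_le_mul_of_nonneg_right (hb z) h0).trans ?_
  rw [stdDensity_eq]
  -- The `5` comes from `3|z| - z²/2 ≤ 9/2`.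
  have : Real.exp |z| * Real.exp (-z ^ 2 / 2) ≤ Real.exp 5 * Real.exp (-(2 * |z|)) := by
    rw [← Real.exp_add, ← Real.exp_add, Real.exp_le_exp]
    have := sq_abs z
    nlinarith [sq_nonneg (|z| - 3)]
  calc 24 * Real.exp |z| * ((√(2 * Real.pi))⁻¹ * Real.exp (-z ^ 2 / 2))
      = 24 * (√(2 * Real.pi))⁻¹ * (Real.exp |z| * Real.exp (-z ^ 2 / 2)) := by ring
    _ ≤ 24 * (√(2 * Real.pi))⁻¹ * (Real.exp 5 * Real.exp (-(2 * |z|))) :=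
        mul_le_mul_of_nonneg_left this (by positivity)
    _ = _ := by ring

/-- Smoothing by a centered normal law. -/
noncomputable def gaussSmooth (v : ℝ≥0) (f : ℝ → ℝ) (x : ℝ) : ℝ := ∫ z, f (x + z) ∂gaussianReal 0 v

lemma gaussSmooth_one (f : ℝ → ℝ) : gaussSmooth 1 f = kernelConv f stdDensity := by
  ext x
  unfold gaussSmooth kernelConv
  rw [integral_gaussianReal_eq_integral_smul one_ne_zero,
    ← integral_sub_right_eq_self (μ := volume) _ x]
  refine integral_congr_ae (Filter.Eventually.of_forall fun y => ?_)
  have : stdDensity (x - y) = gaussianPDFReal 0 1 (y - x) := by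
    rw [stdDensity_eq, ← stdDensity, stdDensity_eq]; congr 2; ring
  simp only [smul_eq_mul, this, add_sub_cancel]
  ring

/-- The derivatives fall on the normal density. Each differentiated kernel has integral zero, being
the derivative of an integrable function, so `ExpDecay.abs_kernelConv_le` applies; the third
derivative gives the Lipschitz constant of the second. -/
lemma exists_bound_gaussSmooth_one : ∃ c : ℝ, 0 < c ∧ ∀ f, BddContraction f → ∃ g₁ g₂ : ℝ → ℝ,
    (∀ x, HasDerivAt (gaussSmooth 1 f) (g₁ x) x) ∧ (∀ x, HasDerivAt g₁ (g₂ x) x) ∧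
    (∀ x, |g₁ x| ≤ c) ∧ (∀ x, |g₂ x| ≤ c) ∧ ∀ x y, |g₂ x - g₂ y| ≤ c * |x - y| := by
  have hexp : ∀ z : ℝ, 1 + |z| + |z| ^ 2 / 2 + |z| ^ 3 / 6 ≤ Real.exp |z| := by
    intro z
    have := Real.sum_le_exp_of_nonneg (abs_nonneg z) 4
    simpa [Finset.sum_range_succ, Nat.factorial] using this
  have hz : ∀ z : ℝ, 0 ≤ |z| := abs_nonneg
  have d0 : ExpDecay stdDensity := by
    have := expDecay_mul_stdDensity (P := fun _ => 1) continuous_const (fun z => by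
      have := hexp z; have h1 := pow_nonneg (hz z) 2; have h2 := pow_nonneg (hz z) 3
      rw [abs_one]; linarith [hz z])
    simpa using this
  have d1 : ExpDecay fun z => -z * stdDensity z :=
    expDecay_mul_stdDensity (by fun_prop) (fun z => by
      have := hexp z; have h1 := pow_nonneg (hz z) 2; have h2 := pow_nonneg (hz z) 3
      rw [abs_neg]; linarith [hz z])
  have d2 : ExpDecay fun z => (z ^ 2 - 1) * stdDensity z :=
    expDecay_mul_stdDensity (by fun_prop) (fun z => by
      have := hexp z; have h1 := pow_nonneg (hz z) 2; have h2 := pow_nonneg (hz z) 3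
      have := abs_sub (z ^ 2) 1
      rw [abs_one, abs_pow] at this; linarith [hz z])
  have d3 : ExpDecay fun z => (3 * z - z ^ 3) * stdDensity z :=
    expDecay_mul_stdDensity (by fun_prop) (fun z => by
      have := hexp z; have h1 := pow_nonneg (hz z) 2; have h2 := pow_nonneg (hz z) 3
      have := abs_sub (3 * z) (z ^ 3)
      rw [abs_mul, abs_pow, abs_of_pos (by norm_num : (0 : ℝ) < 3)] at this; linarith [hz z])
  have e1 : ∀ z, HasDerivAt (fun z => -z * stdDensity z) ((z ^ 2 - 1) * stdDensity z) z := by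
    intro z
    refine ((hasDerivAt_neg z).mul (hasDerivAt_stdDensity z)).congr_deriv ?_
    ring
  have e2 : ∀ z, HasDerivAt (fun z => (z ^ 2 - 1) * stdDensity z)
      ((3 * z - z ^ 3) * stdDensity z) z := by
    intro z
    have h := (hasDerivAt_pow 2 z).sub_const 1
    refine (h.mul (hasDerivAt_stdDensity z)).congr_deriv ?_
    simp; ring
  have i1 := integral_eq_zero_of_hasDerivAt_of_integrable hasDerivAt_stdDensity d1.integrable
    d0.integrable
  have i2 := integral_eq_zero_of_hasDerivAt_of_integrable e1 d2.integrable d1.integrable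
  have i3 := integral_eq_zero_of_hasDerivAt_of_integrable e2 d3.integrable d2.integrable
  set c1 := ∫ z, |z| * |-z * stdDensity z| with hc1
  set c2 := ∫ z, |z| * |(z ^ 2 - 1) * stdDensity z| with hc2
  set c3 := ∫ z, |z| * |(3 * z - z ^ 3) * stdDensity z| with hc3
  have p1 : 0 ≤ c1 := integral_nonneg fun z => by positivity
  have p2 : 0 ≤ c2 := integral_nonneg fun z => by positivity
  have p3 : 0 ≤ c3 := integral_nonneg fun z => by positivity
  refine ⟨1 + c1 + c2 + c3, by positivity, fun f hf => ?_⟩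
  rw [gaussSmooth_one]
  refine ⟨_, _, d0.hasDerivAt_kernelConv hf d1 hasDerivAt_stdDensity,
    d1.hasDerivAt_kernelConv hf d2 e1, fun x => ?_, fun x => ?_, fun x y => ?_⟩
  · exact (d1.abs_kernelConv_le hf i1 x).trans (by linarith)
  · exact (d2.abs_kernelConv_le hf i2 x).trans (by linarith)
  · have h := Convex.norm_image_sub_le_of_norm_hasDerivWithin_le (s := Set.univ) (C := c3)
      (fun z _ => (d2.hasDerivAt_kernelConv hf d3 e2 z).hasDerivWithinAt)
      (fun z _ => d3.abs_kernelConv_le hf i3 z) convex_univ (Set.mem_univ y) (Set.mem_univ x)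
    rw [Real.norm_eq_abs, Real.norm_eq_abs] at h
    refine h.trans (mul_le_mul_of_nonneg_right (by linarith) (abs_nonneg _))

lemma gaussSmooth_sq (f : ℝ → ℝ) {s : ℝ} (hs : 0 < s) (v : ℝ≥0) (hv : (v : ℝ) = s ^ 2) (x : ℝ) :
    gaussSmooth v f x = s * gaussSmooth 1 (fun y => f (s * y) / s) (x / s) := by
  have h : gaussianReal 0 v = (gaussianReal 0 1).map (fun z => s * z) := by
    rw [gaussianReal_map_const_mul]
    congr 1
    · simp
    · ext; simp [hv]
  unfold gaussSmooth
  rw [h, MeasurableEmbedding.integral_map (measurableEmbedding_mulLeft₀ hs.ne'),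
    ← integral_const_mul]
  refine integral_congr_ae (Filter.Eventually.of_forall fun z => ?_)
  simp only
  rw [mul_div_cancel₀ _ hs.ne']
  congr 1
  field_simp

/-- Derivative bounds for a Gaussian smoothing of variance `v`. -/
theorem exists_bound_gaussSmooth : ∃ c : ℝ, 0 < c ∧ ∀ f, BddContraction f → ∀ v : ℝ≥0, 0 < v →
    ∃ g₁ g₂ : ℝ → ℝ, (∀ x, HasDerivAt (gaussSmooth v f) (g₁ x) x) ∧
    (∀ x, HasDerivAt g₁ (g₂ x) x) ∧ (∀ x, |g₁ x| ≤ c) ∧ (∀ x, |g₂ x| ≤ c / √v) ∧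
    ∀ x y, |g₂ x - g₂ y| ≤ c / v * |x - y| := by
  obtain ⟨c, hc, H⟩ := exists_bound_gaussSmooth_one
  refine ⟨c, hc, fun f hf v hv => ?_⟩
  have hs : 0 < √(v : ℝ) := Real.sqrt_pos.2 (by exact_mod_cast hv)
  have hsv : (v : ℝ) = √(v : ℝ) ^ 2 := (Real.sq_sqrt v.2).symm
  set s := √(v : ℝ) with hsdef
  have hf' : BddContraction fun y => f (s * y) / s := by
    refine ⟨fun x y => ?_, ?_⟩
    · rw [← sub_div, abs_div, abs_of_pos hs, div_le_iff₀ hs]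
      refine (hf.1 _ _).trans ?_
      rw [← mul_sub, abs_mul, abs_of_pos hs, mul_comm]
    · obtain ⟨M, hM⟩ := hf.2
      refine ⟨M / s, fun x => ?_⟩
      rw [abs_div, abs_of_pos hs]
      exact div_le_div_of_nonneg_right (hM _) hs.le
  obtain ⟨g₁, g₂, h1, h2, b1, b2, b3⟩ := H _ hf'
  have hdiv : ∀ x : ℝ, HasDerivAt (fun x => x / s) (1 / s) x := fun x => (hasDerivAt_id x).div_const s
  refine ⟨fun x => g₁ (x / s), fun x => g₂ (x / s) / s, fun x => ?_, fun x => ?_, fun x => b1 _,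
    fun x => ?_, fun x y => ?_⟩
  · have : gaussSmooth v f = fun x => s * gaussSmooth 1 (fun y => f (s * y) / s) (x / s) :=
      funext (gaussSmooth_sq f hs v hsv)
    rw [this]
    refine (((h1 (x / s)).comp x (hdiv x)).const_mul s).congr_deriv ?_
    field_simp
  · refine ((h2 (x / s)).comp x (hdiv x)).congr_deriv ?_
    field_simp
  · rw [abs_div, abs_of_pos hs]
    exact div_le_div_of_nonneg_right (b2 _) hs.le
  · rw [← sub_div, abs_div, abs_of_pos hs, hsv]
    calc |g₂ (x / s) - g₂ (y / s)| / s ≤ c * |x / s - y / s| / s :=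
          div_le_div_of_nonneg_right (b3 _ _) hs.le
      _ = c / s ^ 2 * |x - y| := by
          rw [← sub_div, abs_div, abs_of_pos hs]; field_simp

end LinStat

namespace LinStat

/-! ### Taylor expansions and the Lindeberg step -/

lemma abs_sub_sub_mul_le_of_hasDerivAt {g g' : ℝ → ℝ} (hg : ∀ x, HasDerivAt g (g' x) x) (x y : ℝ)
    (d C : ℝ) (h : ∀ z, |z - x| ≤ |y - x| → |g' z - d| ≤ C) :
    |g y - g x - d * (y - x)| ≤ C * |y - x| := by
  have h1 : ∀ z ∈ Set.uIcc x y, HasDerivWithinAt (fun z => g z - d * z) (g' z - d) (Set.uIcc x y) z := by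
    intro z _
    have := (hg z).sub ((hasDerivAt_id z).const_mul d)
    simp only [mul_one] at this
    exact this.hasDerivWithinAt
  have h2 := Convex.norm_image_sub_le_of_norm_hasDerivWithin_le h1
    (fun z hz => h z (Set.abs_sub_left_of_mem_uIcc hz)) (convex_uIcc x y)
    Set.left_mem_uIcc Set.right_mem_uIcc
  simp only [Real.norm_eq_abs] at h2
  rwa [show g y - d * y - (g x - d * x) = g y - g x - d * (y - x) by ring] at h2

lemma taylor_one {g g' : ℝ → ℝ} (hg : ∀ x, HasDerivAt g (g' x) x) {H r : ℝ} (hH : 0 ≤ H)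
    (hr : 0 ≤ r) (h : ∀ x y, |g' x - g' y| ≤ H * |x - y| ^ r) (x y : ℝ) :
    |g (x + y) - g x - y * g' x| ≤ H * |y| ^ (1 + r) := by
  have := abs_sub_sub_mul_le_of_hasDerivAt hg x (x + y) (g' x) (H * |y| ^ r) (fun z hz => by
    refine (h z x).trans (mul_le_mul_of_nonneg_left ?_ hH)
    rw [add_sub_cancel_left] at hz
    exact Real.rpow_le_rpow (abs_nonneg _) hz hr)
  rw [add_sub_cancel_left] at this
  rw [mul_comm y]
  refine this.trans_eq ?_
  rw [Real.rpow_one_add' (abs_nonneg _) (by positivity)]; ring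

lemma taylor_two {g g' g'' : ℝ → ℝ} (hg : ∀ x, HasDerivAt g (g' x) x)
    (hg' : ∀ x, HasDerivAt g' (g'' x) x) {H r : ℝ} (hH : 0 ≤ H)
    (hr : 0 ≤ r) (h : ∀ x y, |g'' x - g'' y| ≤ H * |x - y| ^ r) (x y : ℝ) :
    |g (x + y) - g x - y * g' x - y ^ 2 / 2 * g'' x| ≤ H * |y| ^ (2 + r) := by
  -- After subtraction of the quadratic term with second derivative frozen at `x`, the derivative
  -- differs from `g' x` by a first-order remainder, which `taylor_one` controls.
  have hd : ∀ z, HasDerivAt (fun z => g z - (z - x) ^ 2 / 2 * g'' x) (g' z - (z - x) * g'' x) z := by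
    intro z
    have h1 : HasDerivAt (fun z : ℝ => (z - x) ^ 2 / 2 * g'' x) ((z - x) * g'' x) z := by
      refine ((((hasDerivAt_id z).sub_const x).pow 2).div_const 2 |>.mul_const _).congr_deriv ?_
      simp
    exact (hg z).sub h1
  have := abs_sub_sub_mul_le_of_hasDerivAt hd x (x + y) (g' x) (H * |y| ^ (1 + r)) (fun z hz => by
    have h2 := taylor_one hg' hH hr h x (z - x)
    rw [add_sub_cancel, sub_right_comm] at h2
    refine h2.trans (mul_le_mul_of_nonneg_left ?_ hH)
    rw [add_sub_cancel_left] at hz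
    exact Real.rpow_le_rpow (abs_nonneg _) hz (by positivity))
  rw [add_sub_cancel_left] at this
  have e : g (x + y) - y ^ 2 / 2 * g'' x - (g x - (x - x) ^ 2 / 2 * g'' x) - g' x * y =
      g (x + y) - g x - y * g' x - y ^ 2 / 2 * g'' x := by ring
  rw [e] at this
  refine this.trans_eq ?_
  rw [show 2 + r = 1 + (1 + r) by ring, Real.rpow_one_add' (y := 1 + r) (abs_nonneg y)
    (by positivity)]; ring

/-- A bounded Lipschitz function is Hölder continuous. -/
lemma abs_sub_le_rpow {g : ℝ → ℝ} {c s r : ℝ} (hc : 0 ≤ c) (hs : 0 < s) (hr : 0 ≤ r) (hr1 : r ≤ 1)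
    (hb : ∀ x, |g x| ≤ c / s) (hl : ∀ x y, |g x - g y| ≤ c / s ^ 2 * |x - y|) (x y : ℝ) :
    |g x - g y| ≤ 2 * c * s ^ (-(1 + r)) * |x - y| ^ r := by
  have hpow : s ^ (-(1 + r)) * |x - y| ^ r = s⁻¹ * (|x - y| / s) ^ r := by
    rw [Real.div_rpow (abs_nonneg _) hs.le, Real.rpow_neg hs.le, Real.rpow_one_add' hs.le (by positivity)]
    field_simp
  rw [mul_assoc, hpow]
  -- Interpolation at the natural scale `s`: the Lipschitz bound below it, the sup bound above it.
  rcases le_total |x - y| s with h | h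
  · have h1 : |x - y| / s ≤ (|x - y| / s) ^ r := by
      have h0 : 0 ≤ |x - y| / s := by positivity
      have := Real.rpow_le_rpow_of_exponent_ge' h0 ((div_le_one hs).2 h) hr hr1
      rwa [Real.rpow_one] at this
    calc |g x - g y| ≤ c / s ^ 2 * |x - y| := hl x y
      _ = c * (s⁻¹ * (|x - y| / s)) := by field_simp
      _ ≤ c * (s⁻¹ * (|x - y| / s) ^ r) := by gcongr
      _ ≤ 2 * c * (s⁻¹ * (|x - y| / s) ^ r) := by gcongr; linarith
  · have h1 : 1 ≤ (|x - y| / s) ^ r := Real.one_le_rpow ((one_le_div hs).2 h) hr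
    calc |g x - g y| ≤ |g x| + |g y| := abs_sub _ _
      _ ≤ c / s + c / s := add_le_add (hb x) (hb y)
      _ = 2 * c * (s⁻¹ * 1) := by field_simp; ring
      _ ≤ 2 * c * (s⁻¹ * (|x - y| / s) ^ r) := by gcongr

lemma BddContraction.integrable_comp {f : ℝ → ℝ} (hf : BddContraction f) {Ω : Type*}
    [MeasurableSpace Ω] (μ : Measure Ω) [IsFiniteMeasure μ] {X : Ω → ℝ} (hX : AEMeasurable X μ) :
    Integrable (fun ω => f (X ω)) μ := by
  obtain ⟨M, hM⟩ := hf.2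
  exact Integrable.of_bound (hf.continuous.measurable.comp_aemeasurable hX).aestronglyMeasurable M
    (Filter.Eventually.of_forall fun ω => hM _)

/-- The semigroup property: one Gaussian increment of variance `w` can be split off and compared
with one term of the sum. -/
lemma gaussSmooth_add {f : ℝ → ℝ} (hf : BddContraction f) (v w : ℝ≥0) :
    gaussSmooth (v + w) f = gaussSmooth w (gaussSmooth v f) := by
  ext x
  have h : gaussianReal 0 (v + w) = (gaussianReal 0 w).conv (gaussianReal 0 v) := by
    rw [gaussianReal_conv_gaussianReal]; simp [add_comm]
  unfold gaussSmooth
  rw [h, integral_conv]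
  · simp only [add_assoc]
  · exact hf.integrable_comp _ (by fun_prop)

lemma hasDerivAt_gaussSmooth {g g' : ℝ → ℝ} (hg : ∀ x, HasDerivAt g (g' x) x) {c M : ℝ}
    (hb : ∀ x, |g' x| ≤ c) (hM : ∀ x, |g x| ≤ M) (hc : Continuous g') (w : ℝ≥0) (x : ℝ) :
    HasDerivAt (gaussSmooth w g) (gaussSmooth w g' x) x := by
  have hgc : Continuous g := continuous_iff_continuousAt.2 fun z => (hg z).continuousAt
  refine (hasDerivAt_integral_of_dominated_loc_of_deriv_le (F := fun x z => g (x + z))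
    (F' := fun x z => g' (x + z)) (bound := fun _ => c) Filter.univ_mem ?_ ?_ ?_ ?_ ?_ ?_).2
  · exact Filter.Eventually.of_forall fun x => by fun_prop
  · exact Integrable.of_bound (by fun_prop) M (Filter.Eventually.of_forall fun ω => hM _)
  · fun_prop
  · exact Filter.Eventually.of_forall fun y x' _ => hb _
  · exact integrable_const _
  · exact Filter.Eventually.of_forall fun y x' _ => (hg (x' + y)).comp_add_const x' y

/-- Absolute moments of the standard normal law. -/
noncomputable def gaussMoment (q : ℝ) : ℝ := ∫ z, |z| ^ q ∂gaussianReal 0 1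

lemma gaussMoment_nonneg (q : ℝ) : 0 ≤ gaussMoment q :=
  integral_nonneg fun z => by positivity

lemma integrable_rpow_abs_gaussianReal (w : ℝ≥0) {q : ℝ} (hq : 0 ≤ q) :
    Integrable (fun z : ℝ => |z| ^ q) (gaussianReal 0 w) := by
  have h := (memLp_id_gaussianReal' (μ := 0) (v := w) (ENNReal.ofReal q)
    ENNReal.ofReal_ne_top).integrable_norm_rpow'
  simpa [ENNReal.toReal_ofReal hq] using h

lemma integral_rpow_abs_gaussianReal {h : ℝ} (hh : 0 ≤ h) (w : ℝ≥0) (hw : (w : ℝ) = h ^ 2) (q : ℝ) :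
    ∫ z, |z| ^ q ∂gaussianReal 0 w = h ^ q * gaussMoment q := by
  have e : gaussianReal 0 w = (gaussianReal 0 1).map (fun z => h * z) := by
    rw [gaussianReal_map_const_mul]
    congr 1
    · simp
    · ext; simp [hw]
  rw [e, integral_map (by fun_prop) (by
    exact (measurable_norm.pow_const q).aestronglyMeasurable), gaussMoment, ← integral_const_mul]
  refine integral_congr_ae (Filter.Eventually.of_forall fun z => ?_)
  simp only
  rw [abs_mul, Real.mul_rpow (abs_nonneg _) (abs_nonneg _), abs_of_nonneg hh]

/-- If the increments of `ψ` are controlled by `H |z| ^ q`, so is its Gaussian average. -/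
lemma abs_integral_gaussianReal_le {ψ : ℝ → ℝ} {H q h : ℝ} (hq : 0 ≤ q) (hh : 0 ≤ h) {w : ℝ≥0}
    (hw : (w : ℝ) = h ^ 2) (hψ : ∀ z, |ψ z| ≤ H * |z| ^ q) :
    |∫ z, ψ z ∂gaussianReal 0 w| ≤ H * (h ^ q * gaussMoment q) := by
  rw [← integral_rpow_abs_gaussianReal hh w hw, ← integral_const_mul]
  refine abs_integral_le_integral_abs.trans ?_
  exact integral_mono_of_nonneg (Filter.Eventually.of_forall fun _ => abs_nonneg _)
    ((integrable_rpow_abs_gaussianReal w hq).const_mul H) (Filter.Eventually.of_forall hψ)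

lemma integral_sq_gaussianReal (w : ℝ≥0) : ∫ z, z ^ 2 ∂gaussianReal 0 w = w := by
  have h := variance_fun_id_gaussianReal (μ := 0) (v := w)
  rw [variance_eq_integral (by fun_prop), integral_id_gaussianReal] at h
  simpa using h

/-! ### Taylor expansions of a Gaussian average -/

section Step

variable {g g' g'' : ℝ → ℝ} {H r h M c₁ c₂ : ℝ} {w : ℝ≥0}

lemma abs_gaussSmooth_sub_le (hr : 0 ≤ r) (hh : 0 ≤ h) (hw : (w : ℝ) = h ^ 2)
    (hc : Continuous g'') (hb : ∀ x, |g'' x| ≤ c₂) (hH : ∀ x y, |g'' x - g'' y| ≤ H * |x - y| ^ r)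
    (x : ℝ) : |gaussSmooth w g'' x - g'' x| ≤ H * (h ^ r * gaussMoment r) := by
  have e : gaussSmooth w g'' x - g'' x = ∫ z, (g'' (x + z) - g'' x) ∂gaussianReal 0 w := by
    rw [integral_sub _ (integrable_const _)]
    · simp [gaussSmooth]
    · exact Integrable.of_bound (by fun_prop) c₂ (Filter.Eventually.of_forall fun _ => hb _)
  rw [e]
  refine abs_integral_gaussianReal_le hr hh hw fun z => ?_
  simpa using hH (x + z) x

lemma abs_gaussSmooth_sub_le_one (hg' : ∀ x, HasDerivAt g' (g'' x) x) (hr : 0 ≤ r) (hh : 0 ≤ h)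
    (hH0 : 0 ≤ H) (hw : (w : ℝ) = h ^ 2) (hb : ∀ x, |g' x| ≤ c₁)
    (hH : ∀ x y, |g'' x - g'' y| ≤ H * |x - y| ^ r) (x : ℝ) :
    |gaussSmooth w g' x - g' x| ≤ H * (h ^ (1 + r) * gaussMoment (1 + r)) := by
  have hgc : Continuous g' := continuous_iff_continuousAt.2 fun z => (hg' z).continuousAt
  have hi : Integrable (fun z => g' (x + z)) (gaussianReal 0 w) :=
    Integrable.of_bound (by fun_prop) c₁ (Filter.Eventually.of_forall fun _ => hb _)
  have hz : Integrable (fun z : ℝ => z * g'' x) (gaussianReal 0 w) :=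
    ((memLp_id_gaussianReal 1).integrable (by simp)).mul_const _
  have e : gaussSmooth w g' x - g' x =
      ∫ z, (g' (x + z) - g' x - z * g'' x) ∂gaussianReal 0 w := by
    have hi1 : Integrable (fun z => g' (x + z) - g' x) (gaussianReal 0 w) :=
      hi.sub (integrable_const _)
    rw [integral_sub hi1 hz, integral_sub hi (integrable_const _),
      integral_mul_const, integral_id_gaussianReal]
    simp [gaussSmooth]
  rw [e]
  exact abs_integral_gaussianReal_le (by positivity) hh hw fun z => taylor_one hg' hH0 hr hH x z

/-- The Taylor polynomial is integrated exactly, using mean zero and variance `h²`; only the Hölder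
remainder is estimated. -/
lemma abs_gaussSmooth_sub_le_two (hg : ∀ x, HasDerivAt g (g' x) x)
    (hg' : ∀ x, HasDerivAt g' (g'' x) x) (hr : 0 ≤ r) (hh : 0 ≤ h)
    (hH0 : 0 ≤ H) (hw : (w : ℝ) = h ^ 2) (hb : ∀ x, |g x| ≤ M)
    (hH : ∀ x y, |g'' x - g'' y| ≤ H * |x - y| ^ r) (x : ℝ) :
    |gaussSmooth w g x - g x - h ^ 2 / 2 * g'' x| ≤ H * (h ^ (2 + r) * gaussMoment (2 + r)) := by
  have hgc : Continuous g := continuous_iff_continuousAt.2 fun z => (hg z).continuousAt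
  have hi : Integrable (fun z => g (x + z)) (gaussianReal 0 w) :=
    Integrable.of_bound (by fun_prop) M (Filter.Eventually.of_forall fun _ => hb _)
  have hz : Integrable (fun z : ℝ => z * g' x) (gaussianReal 0 w) :=
    ((memLp_id_gaussianReal 1).integrable (by simp)).mul_const _
  have hz2 : Integrable (fun z : ℝ => z ^ 2 / 2 * g'' x) (gaussianReal 0 w) :=
    ((memLp_id_gaussianReal 2).integrable_sq.div_const _).mul_const _
  have e : gaussSmooth w g x - g x - h ^ 2 / 2 * g'' x =
      ∫ z, (g (x + z) - g x - z * g' x - z ^ 2 / 2 * g'' x) ∂gaussianReal 0 w := by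
    have hi1 : Integrable (fun z => g (x + z) - g x) (gaussianReal 0 w) :=
      hi.sub (integrable_const _)
    have hi2 : Integrable (fun z => g (x + z) - g x - z * g' x) (gaussianReal 0 w) := hi1.sub hz
    rw [integral_sub hi2 hz2, integral_sub hi1 hz, integral_sub hi (integrable_const _),
      integral_mul_const, integral_mul_const, integral_div, integral_id_gaussianReal,
      integral_sq_gaussianReal, hw]
    simp [gaussSmooth]
  rw [e]
  exact abs_integral_gaussianReal_le (by positivity) hh hw
    fun z => taylor_two hg hg' hH0 hr hH x z

end Step

lemma rpow_abs_le_one_add {a b : ℝ} (ha : 0 ≤ a) (hab : a ≤ b) (X : ℝ) : |X| ^ a ≤ 1 + |X| ^ b := by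
  have hb : 0 ≤ |X| ^ b := by positivity
  rcases le_total |X| 1 with h | h
  · have := Real.rpow_le_one (abs_nonneg X) h ha
    linarith
  · have := Real.rpow_le_rpow_of_exponent_le h hab
    linarith


/-- First derivative of the Gaussian smoothing. -/
noncomputable def gaussSmoothD1 (v : ℝ≥0) (f : ℝ → ℝ) : ℝ → ℝ := deriv (gaussSmooth v f)

/-- Second derivative of the Gaussian smoothing. -/
noncomputable def gaussSmoothD2 (v : ℝ≥0) (f : ℝ → ℝ) : ℝ → ℝ := deriv (gaussSmoothD1 v f)

lemma abs_gaussSmooth_le {f : ℝ → ℝ} {M : ℝ} (hM : ∀ x, |f x| ≤ M) (v : ℝ≥0) (x : ℝ) :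
    |gaussSmooth v f x| ≤ M := by
  have := norm_integral_le_of_norm_le_const (μ := gaussianReal 0 v) (f := fun z => f (x + z))
    (C := M) (Filter.Eventually.of_forall fun z => hM _)
  simpa [gaussSmooth] using this

-- Exchange of `a X` for a normal variable of variance `σ² a²`. Both `f_v(x + a X)` and `f_{v+w}(x)`
-- are expanded around `x`. The expansion is needed at three levels because the scheme later unwinds
-- the first and second derivatives along the past as well.
set_option maxHeartbeats 400000 in
theorem exists_lindeberg_step {r σ : ℝ} (hr : 0 < r) (hr1 : r ≤ 1) (hσ : 0 ≤ σ) :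
    ∃ C : ℝ, 0 < C ∧ ∀ f, BddContraction f → ∀ v : ℝ≥0, 0 < v →
      (∀ x, |gaussSmoothD1 v f x| ≤ C) ∧ (∀ x, |gaussSmoothD2 v f x| ≤ C / √v) ∧
      ∀ w : ℝ≥0, ∀ a X x : ℝ, (w : ℝ) = σ ^ 2 * a ^ 2 →
        |gaussSmoothD2 v f (x + a * X) - gaussSmoothD2 (v + w) f x|
          ≤ C * (v : ℝ) ^ (-(1 + r) / 2) * |a| ^ r * (1 + |X| ^ r) ∧
        |gaussSmoothD1 v f (x + a * X) - gaussSmoothD1 (v + w) f x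
            - a * X * gaussSmoothD2 (v + w) f x|
          ≤ C * (v : ℝ) ^ (-(1 + r) / 2) * |a| ^ (1 + r) * (1 + |X| ^ (1 + r)) ∧
        |gaussSmooth v f (x + a * X) - gaussSmooth (v + w) f x
            - a * X * gaussSmoothD1 (v + w) f x
            - a ^ 2 * (X ^ 2 - σ ^ 2) / 2 * gaussSmoothD2 (v + w) f x|
          ≤ C * (v : ℝ) ^ (-(1 + r) / 2) * |a| ^ (2 + r) * (1 + |X| ^ (2 + r)) := by
  obtain ⟨c, hc, hsm⟩ := exists_bound_gaussSmooth
  have m0 := gaussMoment_nonneg r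
  have m1 := gaussMoment_nonneg (1 + r)
  have m2 := gaussMoment_nonneg (2 + r)
  obtain ⟨s0, hs0⟩ : ∃ s, s = σ ^ r * gaussMoment r := ⟨_, rfl⟩
  obtain ⟨s1, hs1⟩ : ∃ s, s = σ ^ (1 + r) * gaussMoment (1 + r) := ⟨_, rfl⟩
  obtain ⟨s2, hs2⟩ : ∃ s, s = σ ^ (2 + r) * gaussMoment (2 + r) := ⟨_, rfl⟩
  have p0 : 0 ≤ s0 := by rw [hs0]; positivity
  have p1 : 0 ≤ s1 := by rw [hs1]; positivity
  have p2 : 0 ≤ s2 := by rw [hs2]; positivity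
  -- `s0`, `s1`, `s2` are the Gaussian remainders of orders 0, 1, 2, and `σ ^ 2 * s0` comes from the
  -- variance part of the quadratic coefficient. The factor `2 * c` in the constant is the Hölder
  -- constant of `abs_sub_le_rpow`.
  obtain ⟨D, hD⟩ : ∃ D, D = 1 + s0 + s1 + s2 + σ ^ 2 * s0 := ⟨_, rfl⟩
  have hD1 : 1 ≤ D := by rw [hD]; nlinarith [mul_nonneg (sq_nonneg σ) p0]
  have hC : c ≤ 2 * c * D := by nlinarith
  refine ⟨2 * c * D, by positivity, fun f hf v hv => ?_⟩
  obtain ⟨g₁, g₂, h1, h2, b1, b2, b3⟩ := hsm f hf v hv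
  have e1 : gaussSmoothD1 v f = g₁ := funext fun x => (h1 x).deriv
  have e2 : gaussSmoothD2 v f = g₂ := by
    unfold gaussSmoothD2; rw [e1]; exact funext fun x => (h2 x).deriv
  refine ⟨fun x => ?_, fun x => ?_, fun w a X x hw => ?_⟩
  · rw [e1]; exact (b1 x).trans hC
  · rw [e2]; exact (b2 x).trans (div_le_div_of_nonneg_right hC (Real.sqrt_nonneg _))
  obtain ⟨M, hM⟩ := hf.2
  have hv' : (0 : ℝ) < v := by exact_mod_cast hv
  have hs : 0 < √(v : ℝ) := Real.sqrt_pos.2 hv'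
  have hsv : √(v : ℝ) ^ 2 = v := Real.sq_sqrt v.2
  have hpow : √(v : ℝ) ^ (-(1 + r)) = (v : ℝ) ^ (-(1 + r) / 2) := by
    rw [Real.sqrt_eq_rpow, ← Real.rpow_mul hv'.le]; congr 1; ring
  have c2 : Continuous g₂ := by
    have : LipschitzWith ⟨c / v, by positivity⟩ g₂ := LipschitzWith.of_dist_le_mul fun x y => by
      rw [Real.dist_eq, Real.dist_eq]; exact b3 x y
    exact this.continuous
  have c1 : Continuous g₁ := continuous_iff_continuousAt.2 fun z => (h2 z).continuousAt
  have hH := abs_sub_le_rpow hc.le hs hr.le hr1 b2 (by rw [hsv]; exact b3)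
  rw [hpow] at hH
  have hVp : 0 ≤ (v : ℝ) ^ (-(1 + r) / 2) := by positivity
  generalize (v : ℝ) ^ (-(1 + r) / 2) = V at hH hVp ⊢
  have hH0 : 0 ≤ 2 * c * V := by positivity
  have k1 : gaussSmoothD1 (v + w) f = gaussSmooth w g₁ := by
    unfold gaussSmoothD1
    rw [gaussSmooth_add hf]
    exact funext fun x => (hasDerivAt_gaussSmooth h1 b1 (abs_gaussSmooth_le hM v) c1 w x).deriv
  have k2 : gaussSmoothD2 (v + w) f = gaussSmooth w g₂ := by
    unfold gaussSmoothD2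
    rw [k1]
    exact funext fun x => (hasDerivAt_gaussSmooth h2 b2 b1 c2 w x).deriv
  have hh : 0 ≤ σ * |a| := by positivity
  have hw' : (w : ℝ) = (σ * |a|) ^ 2 := by rw [hw, mul_pow, sq_abs]
  have t0 := abs_gaussSmooth_sub_le hr.le hh hw' c2 b2 hH x
  have t1 := abs_gaussSmooth_sub_le_one h2 hr.le hh hH0 hw' b1 hH x
  have t2 := abs_gaussSmooth_sub_le_two h1 h2 hr.le hh hH0 hw' (abs_gaussSmooth_le hM v) hH x
  have u0 := hH (x + a * X) x
  have u1 := taylor_one h2 hH0 hr.le hH x (a * X)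
  have u2 := taylor_two h1 h2 hH0 hr.le hH x (a * X)
  rw [k1, k2, e1, e2, gaussSmooth_add hf]
  rw [add_sub_cancel_left] at u0
  have sp : ∀ q : ℝ, (σ * |a|) ^ q = σ ^ q * |a| ^ q := fun q => Real.mul_rpow hσ (abs_nonneg _)
  have sq' : ∀ q : ℝ, |a * X| ^ q = |a| ^ q * |X| ^ q := fun q => by
    rw [abs_mul, Real.mul_rpow (abs_nonneg _) (abs_nonneg _)]
  rw [sp] at t0 t1 t2
  rw [sq'] at u0 u1 u2
  have q0 : |a| * |a| ^ r = |a| ^ (1 + r) := (Real.rpow_one_add' (abs_nonneg _) (by positivity)).symm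
  have q1 : |a| * |a| ^ (1 + r) = |a| ^ (2 + r) := by
    rw [show 2 + r = 1 + (1 + r) by ring, Real.rpow_one_add' (y := 1 + r) (abs_nonneg a) (by positivity)]
  have x1 : |X| ≤ 1 + |X| ^ (1 + r) := by
    have := rpow_abs_le_one_add zero_le_one (by linarith : (1 : ℝ) ≤ 1 + r) X
    simpa using this
  have x1' : |X| ≤ 1 + |X| ^ (2 + r) := by
    have := rpow_abs_le_one_add zero_le_one (by linarith : (1 : ℝ) ≤ 2 + r) X
    simpa using this
  have x2 : X ^ 2 ≤ 1 + |X| ^ (2 + r) := by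
    have := rpow_abs_le_one_add zero_le_two (by linarith : (2 : ℝ) ≤ 2 + r) X
    simpa using this
  have y0 : 0 ≤ |X| ^ r := by positivity
  have y1 : 0 ≤ |X| ^ (1 + r) := by positivity
  have y2 : 0 ≤ |X| ^ (2 + r) := by positivity
  have a0 : 0 ≤ |a| ^ r := by positivity
  have a1 : 0 ≤ |a| ^ (1 + r) := by positivity
  have a2 : 0 ≤ |a| ^ (2 + r) := by positivity
  have hσs : 0 ≤ σ ^ 2 * s0 := by positivity
  have t0' : |gaussSmooth w g₂ x - g₂ x| ≤ 2 * c * V * |a| ^ r * s0 := t0.trans_eq (by rw [hs0]; ring)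
  have t1' : |gaussSmooth w g₁ x - g₁ x| ≤ 2 * c * V * |a| ^ (1 + r) * s1 :=
    t1.trans_eq (by rw [hs1]; ring)
  refine ⟨?_, ?_, ?_⟩
  · have e : g₂ (x + a * X) - gaussSmooth w g₂ x
        = (g₂ (x + a * X) - g₂ x) - (gaussSmooth w g₂ x - g₂ x) := by ring
    rw [e]
    refine (abs_sub _ _).trans ((add_le_add u0 t0').trans ?_)
    calc 2 * c * V * (|a| ^ r * |X| ^ r) + 2 * c * V * |a| ^ r * s0
        = 2 * c * V * |a| ^ r * (|X| ^ r + s0) := by ring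
      _ ≤ 2 * c * V * |a| ^ r * (D * (1 + |X| ^ r)) := by
          refine mul_le_mul_of_nonneg_left ?_ (by positivity)
          rw [hD]
          linarith [mul_nonneg p0 y0, mul_nonneg p1 y0, mul_nonneg p2 y0, mul_nonneg hσs y0]
      _ = _ := by ring
  · have e : g₁ (x + a * X) - gaussSmooth w g₁ x - a * X * gaussSmooth w g₂ x
        = (g₁ (x + a * X) - g₁ x - a * X * g₂ x) - (gaussSmooth w g₁ x - g₁ x)
          - a * X * (gaussSmooth w g₂ x - g₂ x) := by ring
    have t3 : |a * X * (gaussSmooth w g₂ x - g₂ x)| ≤ 2 * c * V * |a| ^ (1 + r) * (s0 * |X|) := by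
      rw [abs_mul, abs_mul, ← q0]
      calc |a| * |X| * |gaussSmooth w g₂ x - g₂ x| ≤ |a| * |X| * (2 * c * V * |a| ^ r * s0) :=
            mul_le_mul_of_nonneg_left t0' (by positivity)
        _ = _ := by ring
    rw [e]
    refine (abs_sub _ _).trans ((add_le_add ((abs_sub _ _).trans (add_le_add u1 t1')) t3).trans ?_)
    calc 2 * c * V * (|a| ^ (1 + r) * |X| ^ (1 + r)) + 2 * c * V * |a| ^ (1 + r) * s1
          + 2 * c * V * |a| ^ (1 + r) * (s0 * |X|)
        = 2 * c * V * |a| ^ (1 + r) * (|X| ^ (1 + r) + s1 + s0 * |X|) := by ring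
      _ ≤ 2 * c * V * |a| ^ (1 + r) * (D * (1 + |X| ^ (1 + r))) := by
          refine mul_le_mul_of_nonneg_left ?_ (by positivity)
          have := mul_le_mul_of_nonneg_left x1 p0
          rw [hD]
          linarith [mul_nonneg p0 y1, mul_nonneg p1 y1, mul_nonneg p2 y1, mul_nonneg hσs y1]
      _ = _ := by ring
  -- Taylor's formula yields coefficients at variance `v`, the statement has them at `v + w`; the
  -- last two differences correct for this and are bounded by `t1'` and `t0'`.
  · have e : gaussSmooth v f (x + a * X) - gaussSmooth w (gaussSmooth v f) x
          - a * X * gaussSmooth w g₁ x - a ^ 2 * (X ^ 2 - σ ^ 2) / 2 * gaussSmooth w g₂ x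
        = (gaussSmooth v f (x + a * X) - gaussSmooth v f x - a * X * g₁ x
            - (a * X) ^ 2 / 2 * g₂ x)
          - (gaussSmooth w (gaussSmooth v f) x - gaussSmooth v f x - (σ * |a|) ^ 2 / 2 * g₂ x)
          - a * X * (gaussSmooth w g₁ x - g₁ x)
          - a ^ 2 * (X ^ 2 - σ ^ 2) / 2 * (gaussSmooth w g₂ x - g₂ x) := by
      rw [mul_pow σ, sq_abs]; ring
    have t2' : |gaussSmooth w (gaussSmooth v f) x - gaussSmooth v f x - (σ * |a|) ^ 2 / 2 * g₂ x|
        ≤ 2 * c * V * |a| ^ (2 + r) * s2 := t2.trans_eq (by rw [hs2]; ring)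
    have t3 : |a * X * (gaussSmooth w g₁ x - g₁ x)| ≤ 2 * c * V * |a| ^ (2 + r) * (s1 * |X|) := by
      rw [abs_mul, abs_mul, ← q1]
      calc |a| * |X| * |gaussSmooth w g₁ x - g₁ x| ≤ |a| * |X| * (2 * c * V * |a| ^ (1 + r) * s1) :=
            mul_le_mul_of_nonneg_left t1' (by positivity)
        _ = _ := by ring
    have t4 : |a ^ 2 * (X ^ 2 - σ ^ 2) / 2 * (gaussSmooth w g₂ x - g₂ x)|
        ≤ 2 * c * V * |a| ^ (2 + r) * (s0 * ((X ^ 2 + σ ^ 2) / 2)) := by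
      have : |a ^ 2 * (X ^ 2 - σ ^ 2) / 2| ≤ |a| * |a| * ((X ^ 2 + σ ^ 2) / 2) := by
        rw [mul_div_assoc, abs_mul, abs_of_nonneg (sq_nonneg a), abs_mul_abs_self, ← sq]
        refine mul_le_mul_of_nonneg_left ?_ (sq_nonneg a)
        rw [abs_le]; constructor <;> linarith [sq_nonneg X, sq_nonneg σ]
      rw [abs_mul, ← q1, ← q0]
      calc |a ^ 2 * (X ^ 2 - σ ^ 2) / 2| * |gaussSmooth w g₂ x - g₂ x|
          ≤ (|a| * |a| * ((X ^ 2 + σ ^ 2) / 2)) * (2 * c * V * |a| ^ r * s0) :=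
            mul_le_mul this t0' (abs_nonneg _) (by positivity)
        _ = _ := by ring
    rw [e]
    refine (abs_sub _ _).trans ((add_le_add ((abs_sub _ _).trans (add_le_add ((abs_sub _ _).trans
      (add_le_add u2 t2')) t3)) t4).trans ?_)
    calc 2 * c * V * (|a| ^ (2 + r) * |X| ^ (2 + r)) + 2 * c * V * |a| ^ (2 + r) * s2
          + 2 * c * V * |a| ^ (2 + r) * (s1 * |X|)
          + 2 * c * V * |a| ^ (2 + r) * (s0 * ((X ^ 2 + σ ^ 2) / 2))
        = 2 * c * V * |a| ^ (2 + r)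
          * (|X| ^ (2 + r) + s2 + s1 * |X| + s0 * ((X ^ 2 + σ ^ 2) / 2)) := by ring
      _ ≤ 2 * c * V * |a| ^ (2 + r) * (D * (1 + |X| ^ (2 + r))) := by
          refine mul_le_mul_of_nonneg_left ?_ (by positivity)
          have z1 := mul_le_mul_of_nonneg_left x1' p1
          have z2 := mul_le_mul_of_nonneg_left x2 p0
          rw [hD]
          linarith [mul_nonneg p0 y2, mul_nonneg p1 y2, mul_nonneg p2 y2, mul_nonneg hσs y2]
      _ = _ := by ring

end LinStat

namespace LinStat

/-! ### Conditional expectations along a stationary sequence -/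

/-- Change of variables for conditional expectations. It moves them to path space, where
stationarity is the equality of the laws of shifted trajectories. -/
lemma condExp_comp_ae_eq {Ω X : Type*} [mΩ : MeasurableSpace Ω] {m : MeasurableSpace X}
    [mX : MeasurableSpace X] (μ : Measure Ω) [IsFiniteMeasure μ] {T : Ω → X} (hT : Measurable T)
       (hm : m ≤ mX) {g : X → ℝ} (hg : Integrable g (μ.map T)) :
    (fun ω => ((μ.map T)[g | m]) (T ω)) =ᵐ[μ] μ[fun ω => g (T ω) | m.comap T] := by
  have hle : m.comap T ≤ mΩ := (MeasurableSpace.comap_mono hm).trans hT.comap_le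
  have hi : Integrable (fun ω => ((μ.map T)[g | m]) (T ω)) μ :=
    integrable_condExp.comp_measurable hT
  refine ae_eq_condExp_of_forall_setIntegral_eq hle (hg.comp_measurable hT)
    (fun s _ _ => hi.integrableOn) ?_ ?_
  · rintro s ⟨t, ht, rfl⟩ -
    have h1 := setIntegral_map (μ := μ) (f := (μ.map T)[g | m]) (hm t ht)
      integrable_condExp.aestronglyMeasurable hT.aemeasurable
    have h2 := setIntegral_map (μ := μ) (f := g) (hm t ht) hg.aestronglyMeasurable hT.aemeasurable
    rw [← h1, ← h2, setIntegral_condExp hm hg ht]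
  · have h3 : StronglyMeasurable[m] ((μ.map T)[g | m]) := stronglyMeasurable_condExp
    exact (h3.comp_measurable (comap_measurable T)).aestronglyMeasurable

lemma past_mono {Ω : Type*} (Y : ℤ → Ω → ℝ) : Monotone (past Y) := fun _ _ hkl =>
  biSup_mono fun _ hi => hi.trans hkl

lemma measurable_past {Ω : Type*} (Y : ℤ → Ω → ℝ) {i k : ℤ} (h : i ≤ k) : Measurable[past Y k] (Y i) :=
  (comap_measurable (Y i)).mono (le_iSup₂ (f := fun (i : ℤ) (_ : i ≤ k) =>
    MeasurableSpace.comap (Y i) inferInstance) i h) le_rfl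

/-- The trajectory seen from time `k`. -/
def shiftedPath {Ω : Type*} (Y : ℤ → Ω → ℝ) (k : ℤ) (ω : Ω) (i : ℤ) : ℝ := Y (i + k) ω

lemma past_eq_comap {Ω : Type*} (Y : ℤ → Ω → ℝ) (k : ℤ) :
    past Y k = (past (fun (i : ℤ) (x : ℤ → ℝ) => x i) 0).comap (shiftedPath Y k) := by
  simp only [past, MeasurableSpace.comap_iSup, MeasurableSpace.comap_comp]
  apply le_antisymm
  · refine iSup₂_le fun i hi => ?_
    refine le_iSup₂_of_le (i - k) (by linarith) (le_of_eq ?_)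
    congr 1
    ext ω
    simp [shiftedPath]
  · refine iSup₂_le fun i hi => ?_
    exact le_iSup₂_of_le (i + k) (by linarith) le_rfl

variable {Ω : Type*} [mΩ : MeasurableSpace Ω]

lemma past_le {Y : ℤ → Ω → ℝ} (hmeas : ∀ i, Measurable (Y i)) (k : ℤ) : past Y k ≤ mΩ :=
  iSup₂_le fun i _ => (hmeas i).comap_le

lemma measurable_shiftedPath {Y : ℤ → Ω → ℝ} (hmeas : ∀ i, Measurable (Y i)) (k : ℤ) :
    Measurable (shiftedPath Y k) := measurable_pi_lambda _ fun i => hmeas (i + k)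

/-- Both sides equal the same norm computed under the law of the trajectory. The form `A * E(Φ |
past) - c` covers both quantities defining `lam` as well as the norms in `eta`. -/
lemma eLpNorm_condExp_shift {μ : Measure Ω} [IsProbabilityMeasure μ] {Y : ℤ → Ω → ℝ}
    (hmeas : ∀ i, Measurable (Y i)) (hstat : StrictlyStationary Y μ) (q : ℝ≥0∞) (c : ℝ)
    {A Φ : (ℤ → ℝ) → ℝ} (hA : Measurable A) (hΦ : Measurable Φ)
    (hi : Integrable (fun ω => Φ (shiftedPath Y 0 ω)) μ) (l : ℤ) :
    eLpNorm (fun ω => A (shiftedPath Y l ω) *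
        (μ[fun ω => Φ (shiftedPath Y l ω) | past Y l]) ω - c) q μ =
      eLpNorm (fun ω => A (shiftedPath Y 0 ω) *
        (μ[fun ω => Φ (shiftedPath Y 0 ω) | past Y 0]) ω - c) q μ := by
  have hmap : ∀ l, μ.map (shiftedPath Y l) = μ.map (fun ω (i : ℤ) => Y i ω) := hstat
  have hcle : past (fun (i : ℤ) (x : ℤ → ℝ) => x i) 0 ≤ MeasurableSpace.pi :=
    past_le (fun i => measurable_pi_apply i) 0
  have hint : ∀ l, Integrable Φ (μ.map (shiftedPath Y l)) := by
    intro l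
    rw [hmap l, ← hmap 0]
    exact (integrable_map_measure hΦ.aestronglyMeasurable
      (measurable_shiftedPath hmeas 0).aemeasurable).2 hi
  have key : ∀ l, eLpNorm (fun ω => A (shiftedPath Y l ω) *
      (μ[fun ω => Φ (shiftedPath Y l ω) | past Y l]) ω - c) q μ =
      eLpNorm (fun x => A x * ((μ.map (fun ω (i : ℤ) => Y i ω))[Φ |
        past (fun (i : ℤ) (x : ℤ → ℝ) => x i) 0]) x - c) q (μ.map (fun ω (i : ℤ) => Y i ω)) := by
    intro l
    rw [← hmap l, eLpNorm_map_measure]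
    · refine eLpNorm_congr_ae ?_
      have := condExp_comp_ae_eq μ (measurable_shiftedPath hmeas l) hcle (hint l)
      rw [← past_eq_comap] at this
      filter_upwards [this] with ω hω
      simp only [Function.comp, hω]
    · exact (hA.aestronglyMeasurable.mul integrable_condExp.aestronglyMeasurable).sub
        aestronglyMeasurable_const
    · exact (measurable_shiftedPath hmeas l).aemeasurable
  rw [key l, key 0]

/-- The law of `Φ (Y_{i+l})_i` does not depend on `l`. -/
lemma integral_shift {μ : Measure Ω} {Y : ℤ → Ω → ℝ}
    (hmeas : ∀ i, Measurable (Y i)) (hstat : StrictlyStationary Y μ)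
    {Φ : (ℤ → ℝ) → ℝ} (hΦ : Measurable Φ) (l : ℤ) :
    ∫ ω, Φ (shiftedPath Y l ω) ∂μ = ∫ ω, Φ (shiftedPath Y 0 ω) ∂μ := by
  have hmap : ∀ l, μ.map (shiftedPath Y l) = μ.map (fun ω (i : ℤ) => Y i ω) := hstat
  rw [← integral_map (measurable_shiftedPath hmeas l).aemeasurable hΦ.aestronglyMeasurable,
    ← integral_map (measurable_shiftedPath hmeas 0).aemeasurable hΦ.aestronglyMeasurable,
    hmap l, hmap 0]

lemma eLpNorm_shift {μ : Measure Ω} {Y : ℤ → Ω → ℝ}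
    (hmeas : ∀ i, Measurable (Y i)) (hstat : StrictlyStationary Y μ) (q : ℝ≥0∞) (l : ℤ) :
    eLpNorm (Y l) q μ = eLpNorm (Y 0) q μ := by
  have hmap : ∀ l, μ.map (shiftedPath Y l) = μ.map (fun ω (i : ℤ) => Y i ω) := hstat
  have h : ∀ l, eLpNorm (Y l) q μ =
      eLpNorm (fun x : ℤ → ℝ => x 0) q (μ.map (fun ω (i : ℤ) => Y i ω)) := by
    intro l
    rw [← hmap l, eLpNorm_map_measure (measurable_pi_apply 0).aestronglyMeasurable
      (measurable_shiftedPath hmeas l).aemeasurable]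
    congr 1
    ext ω
    simp [shiftedPath]
  rw [h l, h 0]

lemma normL_eq_integral {q : ℝ} (hq : 0 < q) {μ : Measure Ω} {f : Ω → ℝ}
    (hf : MemLp f (ENNReal.ofReal q) μ) : normL q f μ = (∫ ω, |f ω| ^ q ∂μ) ^ (1 / q) := by
  have h0 : ENNReal.ofReal q ≠ 0 := by simpa using hq
  rw [normL, hf.eLpNorm_eq_integral_rpow_norm h0 ENNReal.ofReal_ne_top, ENNReal.toReal_ofReal hq.le,
    ENNReal.toReal_ofReal (by positivity), one_div]
  rfl

lemma integral_abs_le_normL {q : ℝ} (hq : 1 ≤ q) {μ : Measure Ω} [IsProbabilityMeasure μ]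
    {f : Ω → ℝ} (hf : MemLp f (ENNReal.ofReal q) μ) : ∫ ω, |f ω| ∂μ ≤ normL q f μ := by
  have h1 : (1 : ℝ≥0∞) ≤ ENNReal.ofReal q := by simpa using ENNReal.ofReal_le_ofReal hq
  have h2 := eLpNorm_le_eLpNorm_of_exponent_le h1 hf.1
  have h3 := ENNReal.toReal_mono hf.2.ne h2
  rw [eLpNorm_one_eq_lintegral_enorm, ← integral_norm_eq_lintegral_enorm hf.1] at h3
  exact h3

lemma normL_nonneg (q : ℝ) (f : Ω → ℝ) (μ : Measure Ω) : 0 ≤ normL q f μ := ENNReal.toReal_nonneg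

/-- Hölder's inequality with exponents `p / (p - 2)` and `p / 2`. -/
lemma integral_rpow_abs_mul_abs_le {p : ℝ} (hp : 2 < p) {μ : Measure Ω} [IsProbabilityMeasure μ]
    {f g : Ω → ℝ} (hf : MemLp f (ENNReal.ofReal p) μ) (hg : MemLp g (ENNReal.ofReal (p / 2)) μ) :
    Integrable (fun ω => |f ω| ^ (p - 2) * |g ω|) μ ∧
    ∫ ω, |f ω| ^ (p - 2) * |g ω| ∂μ ≤ (∫ ω, |f ω| ^ p ∂μ) ^ ((p - 2) / p) * normL (p / 2) g μ := by
  have hconj : (p / (p - 2)).HolderConjugate (p / 2) := by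
    rw [Real.holderConjugate_iff]
    refine ⟨by rw [lt_div_iff₀ (by linarith)]; linarith, ?_⟩
    rw [inv_div, inv_div]; field_simp; ring
  have hf' : MemLp (fun ω => |f ω| ^ (p - 2)) (ENNReal.ofReal (p / (p - 2))) μ := by
    have h := hf.norm_rpow_div (ENNReal.ofReal (p - 2))
    rw [ENNReal.toReal_ofReal (by linarith), ← ENNReal.ofReal_div_of_pos (by linarith)] at h
    exact h
  have h1 := integral_mul_norm_le_Lp_mul_Lq hconj hf' hg
  constructor
  · have := hconj.ennrealOfReal
    have := (hf'.norm.integrable_mul (q := ENNReal.ofReal (p / 2)) hg.norm)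
    refine this.congr (Filter.Eventually.of_forall fun ω => ?_)
    simp only [Pi.mul_apply, Real.norm_eq_abs]
    rw [abs_of_nonneg (by positivity : (0 : ℝ) ≤ |f ω| ^ (p - 2))]
  · rw [normL_eq_integral (by linarith) hg]
    simp only [Real.norm_eq_abs] at h1
    have e1 : ∀ ω, |(|f ω| ^ (p - 2))| = |f ω| ^ (p - 2) := fun ω => abs_of_nonneg (by positivity)
    have e2 : ∀ ω, (|f ω| ^ (p - 2)) ^ (p / (p - 2)) = |f ω| ^ p := fun ω => by
      rw [← Real.rpow_mul (abs_nonneg _)]; congr 1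
      rw [mul_div_cancel₀ _ (by linarith)]
    simp only [e1, e2, one_div_div] at h1
    rwa [one_div_div]

end LinStat

/-! ### Decorrelation inequalities for the stationary sequence -/

namespace LinStat

variable {Ω : Type*} [mΩ : MeasurableSpace Ω]

/-- The standing assumptions on the stationary sequence. -/
structure IsAdmissible (p : ℝ) (Y : ℤ → Ω → ℝ) (μ : Measure Ω) : Prop where
  two_lt : 2 < p
  measurable : ∀ i, Measurable (Y i)
  stationary : StrictlyStationary Y μ
  memLp : ∀ i, MemLp (Y i) (ENNReal.ofReal p) μ
  centered : ∀ i, ∫ ω, Y i ω ∂μ = 0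

namespace IsAdmissible

lemma weight_nonneg {Y : ℤ → Ω → ℝ} {W : Ω → ℝ} {w q : ℝ} {l : ℤ}
    (μ : Measure Ω) [IsProbabilityMeasure μ] (hw : ∀ ω, |W ω| ≤ w * (1 + |Y l ω| ^ q)) : 0 ≤ w := by
  obtain ⟨ω⟩ : Nonempty Ω := nonempty_of_isProbabilityMeasure μ
  have h1 := (abs_nonneg _).trans (hw ω)
  have : 0 ≤ |Y l ω| ^ q := by positivity
  by_contra hneg
  nlinarith

variable {p : ℝ} {Y : ℤ → Ω → ℝ} {μ : Measure Ω}

lemma one_le_half (h : IsAdmissible p Y μ) : (1 : ℝ≥0∞) ≤ ENNReal.ofReal (p / 2) := by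
  have := h.two_lt
  simpa using ENNReal.ofReal_le_ofReal (show (1 : ℝ) ≤ p / 2 by linarith)

lemma one_le (h : IsAdmissible p Y μ) : (1 : ℝ≥0∞) ≤ ENNReal.ofReal p := by
  have := h.two_lt
  simpa using ENNReal.ofReal_le_ofReal (show (1 : ℝ) ≤ p by linarith)

lemma memLp_mul (h : IsAdmissible p Y μ) {f g : Ω → ℝ} (hf : MemLp f (ENNReal.ofReal p) μ)
    (hg : MemLp g (ENNReal.ofReal p) μ) :
    MemLp (fun ω => f ω * g ω) (ENNReal.ofReal (p / 2)) μ := by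
  have := h.two_lt
  have hT : Real.HolderTriple p p (p / 2) := by
    constructor
    · field_simp; norm_num
    · linarith
    · linarith
  have := hT.ennrealOfReal
  exact hg.mul' hf

lemma lam_nonneg (k : ℕ) : 0 ≤ lam p Y μ k := ENNReal.toReal_nonneg

lemma autocov_shift (h : IsAdmissible p Y μ) (l k : ℤ) :
    ∫ ω, Y l ω * Y (l + k) ω ∂μ = autocov Y μ k := by
  have h1 := integral_shift h.measurable h.stationary (Φ := fun x => x 0 * x k) (by fun_prop) l
  simp only [shiftedPath, zero_add, add_zero] at h1
  rw [add_comm l k, h1, autocov, covariance]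
  simp [h.centered]

lemma autocov_neg (h : IsAdmissible p Y μ) (k : ℤ) : autocov Y μ (-k) = autocov Y μ k := by
  rw [← h.autocov_shift k (-k), ← h.autocov_shift 0 k]
  simp [mul_comm]

/-- The constant `1 + ‖Y_0‖_p^{p-2}`. -/
noncomputable def _root_.LinStat.momentConst (p : ℝ) (Y : ℤ → Ω → ℝ) (μ : Measure Ω) : ℝ :=
  1 + (∫ ω, |Y 0 ω| ^ p ∂μ) ^ ((p - 2) / p)

lemma one_le_momentConst : 1 ≤ momentConst p Y μ := by
  have : 0 ≤ ∫ ω, |Y 0 ω| ^ p ∂μ := integral_nonneg fun ω => by positivity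
  unfold momentConst
  have : 0 ≤ (∫ ω, |Y 0 ω| ^ p ∂μ) ^ ((p - 2) / p) := by positivity
  linarith

lemma integral_rpow_shift (h : IsAdmissible p Y μ) (l : ℤ) :
    ∫ ω, |Y l ω| ^ p ∂μ = ∫ ω, |Y 0 ω| ^ p ∂μ := by
  have h1 := integral_shift h.measurable h.stationary (Φ := fun x => |x 0| ^ p)
    ((measurable_pi_apply 0).norm.pow_const p) l
  simpa [shiftedPath] using h1

lemma eLpNorm_mul_le (h : IsAdmissible p Y μ) {f g : Ω → ℝ} (hf : MemLp f (ENNReal.ofReal p) μ)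
    (hg : MemLp g (ENNReal.ofReal p) μ) :
    eLpNorm (fun ω => f ω * g ω) (ENNReal.ofReal (p / 2)) μ ≤
      eLpNorm f (ENNReal.ofReal p) μ * eLpNorm g (ENNReal.ofReal p) μ := by
  have := h.two_lt
  have hT : Real.HolderTriple p p (p / 2) := by
    constructor
    · field_simp; norm_num
    · linarith
    · linarith
  have := hT.ennrealOfReal
  have h0 : eLpNorm (f • g) (ENNReal.ofReal (p / 2)) μ ≤
      eLpNorm f (ENNReal.ofReal p) μ * eLpNorm g (ENNReal.ofReal p) μ :=
    eLpNorm_smul_le_mul_eLpNorm hg.1 hf.1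
  exact h0

lemma memLp_condExp (h : IsAdmissible p Y μ) (i k : ℤ) :
    MemLp (μ[Y i | past Y k]) (ENNReal.ofReal p) μ := (h.memLp i).condExp h.one_le

variable [IsProbabilityMeasure μ]

lemma integrable (h : IsAdmissible p Y μ) (i : ℤ) : Integrable (Y i) μ :=
  (h.memLp i).integrable h.one_le

lemma integrable_mul (h : IsAdmissible p Y μ) (i j : ℤ) :
    Integrable (fun ω => Y i ω * Y j ω) μ :=
  (h.memLp_mul (h.memLp i) (h.memLp j)).integrable h.one_le_half

lemma eLpNorm_sub_const_le (h : IsAdmissible p Y μ) (i j l : ℤ) :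
    eLpNorm (fun ω => (μ[fun ω' => Y i ω' * Y j ω' | past Y l]) ω - ∫ ω', Y i ω' * Y j ω' ∂μ)
      (ENNReal.ofReal (p / 2)) μ ≤
      2 * (eLpNorm (Y 0) (ENNReal.ofReal p) μ * eLpNorm (Y 0) (ENNReal.ofReal p) μ) := by
  have hZ := h.memLp_mul (h.memLp i) (h.memLp j)
  have h0 := h.eLpNorm_mul_le (h.memLp i) (h.memLp j)
  rw [eLpNorm_shift h.measurable h.stationary _ i, eLpNorm_shift h.measurable h.stationary _ j] at h0
  refine (eLpNorm_sub_le integrable_condExp.aestronglyMeasurable aestronglyMeasurable_const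
    h.one_le_half).trans ?_
  rw [two_mul]
  refine add_le_add ((eLpNorm_condExp_le_eLpNorm _ h.one_le_half).trans h0) (le_trans ?_ h0)
  have hp0 : ENNReal.ofReal (p / 2) ≠ 0 := (one_pos.trans_le h.one_le_half).ne'
  rw [eLpNorm_const _ hp0 (NeZero.ne μ), measure_univ, ENNReal.one_rpow, mul_one]
  refine (enorm_integral_le_lintegral_enorm _).trans ?_
  rw [← eLpNorm_one_eq_lintegral_enorm]
  exact eLpNorm_le_eLpNorm_of_exponent_le h.one_le_half hZ.1

/-- Finiteness matters because `lam` is a `toReal`, which sends `∞` to `0`: comparisons in `ℝ≥0∞`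
pass to `lam` only through this fact. -/
lemma lam_lt_top (h : IsAdmissible p Y μ) (k : ℕ) :
    (max (eLpNorm (fun ω => Y 0 ω * (μ[Y k | past Y 0]) ω) (ENNReal.ofReal (p / 2)) μ)
    (⨆ (i : ℕ) (j : ℕ) (_ : k ≤ i) (_ : i ≤ j),
      eLpNorm (fun ω => (μ[fun ω' => Y i ω' * Y j ω' | past Y 0]) ω - ∫ ω', Y i ω' * Y j ω' ∂μ)
        (ENNReal.ofReal (p / 2)) μ)) ≠ ∞ := by
  refine (max_lt ?_ ?_).ne
  · exact (h.memLp_mul (h.memLp 0) (h.memLp_condExp k 0)).2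
  · refine lt_of_le_of_lt (iSup_le fun i => iSup_le fun j => iSup_le fun _ => iSup_le fun _ =>
      h.eLpNorm_sub_const_le i j 0) ?_
    exact ENNReal.mul_lt_top (by simp) (ENNReal.mul_lt_top (h.memLp 0).2 (h.memLp 0).2)

lemma normL_mul_condExp_le (h : IsAdmissible p Y μ) (l : ℤ) (k : ℕ) :
    normL (p / 2) (fun ω => Y l ω * (μ[Y (l + k) | past Y l]) ω) μ ≤ lam p Y μ k := by
  have h1 := eLpNorm_condExp_shift h.measurable h.stationary (ENNReal.ofReal (p / 2)) 0
    (A := fun x => x 0) (Φ := fun x => x k) (by fun_prop) (by fun_prop)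
    (by simpa [shiftedPath] using h.integrable k) l
  simp only [shiftedPath, zero_add, add_zero, sub_zero] at h1
  rw [normL, lam, add_comm l]
  refine ENNReal.toReal_mono (h.lam_lt_top k) ?_
  exact h1.le.trans (le_max_left _ _)

lemma normL_condExp_mul_sub_le (h : IsAdmissible p Y μ) (l : ℤ) {k i j : ℕ} (hki : k ≤ i)
    (hij : i ≤ j) :
    normL (p / 2) (fun ω => (μ[fun ω' => Y (l + i) ω' * Y (l + j) ω' | past Y l]) ω
      - autocov Y μ (j - i)) μ ≤ lam p Y μ k := by
  have h1 := eLpNorm_condExp_shift h.measurable h.stationary (ENNReal.ofReal (p / 2))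
    (autocov Y μ (j - i))
    (A := fun x => 1) (Φ := fun x => x i * x j) (by fun_prop) (by fun_prop)
    (by simpa [shiftedPath] using h.integrable_mul i j) l
  simp only [shiftedPath, add_zero, one_mul] at h1
  have h2 : autocov Y μ (j - i) = ∫ ω', Y i ω' * Y j ω' ∂μ := by
    rw [← h.autocov_shift i]; simp
  rw [normL, lam, add_comm l, add_comm l]
  refine ENNReal.toReal_mono (h.lam_lt_top k) ?_
  refine h1.le.trans (le_trans ?_ (le_max_right _ _))
  rw [h2]
  exact le_iSup_of_le i (le_iSup_of_le j (le_iSup_of_le hki (le_iSup_of_le hij le_rfl)))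

lemma normL_condExp_shift (h : IsAdmissible p Y μ) (q : ℝ) (l : ℤ) (k : ℕ) :
    normL q (μ[Y (l + k) | past Y l]) μ = normL q (μ[Y k | past Y 0]) μ := by
  have h1 := eLpNorm_condExp_shift h.measurable h.stationary (ENNReal.ofReal q) 0
    (A := fun x => 1) (Φ := fun x => x k) (by fun_prop) (by fun_prop)
    (by simpa [shiftedPath] using h.integrable k) l
  simp only [shiftedPath, add_zero, sub_zero, one_mul] at h1
  rw [normL, normL, add_comm l]
  exact congrArg ENNReal.toReal h1

lemma condExp_mul (h : IsAdmissible p Y μ) (l i : ℤ) :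
    μ[fun ω => Y l ω * Y i ω | past Y l] =ᵐ[μ] fun ω => Y l ω * (μ[Y i | past Y l]) ω :=
  condExp_mul_of_stronglyMeasurable_left (measurable_past Y le_rfl).stronglyMeasurable
    (h.integrable_mul l i) (h.integrable i)

/-- Conditioning on the past gives `γ_k = E(Y_0 E(Y_k | G_0))`. -/
lemma abs_autocov_le (h : IsAdmissible p Y μ) (k : ℕ) : |autocov Y μ k| ≤ lam p Y μ k := by
  have h2 := h.two_lt
  rw [← h.autocov_shift 0 k, ← integral_condExp (past_le h.measurable 0)]
  refine (abs_integral_le_integral_abs).trans ?_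
  have hm : MemLp (fun ω => Y 0 ω * (μ[Y (0 + k) | past Y 0]) ω) (ENNReal.ofReal (p / 2)) μ :=
    h.memLp_mul (h.memLp 0) (h.memLp_condExp _ 0)
  refine le_trans ?_ (h.normL_mul_condExp_le 0 k)
  refine le_trans (le_of_eq ?_) (integral_abs_le_normL (by linarith) hm)
  refine integral_congr_ae ?_
  filter_upwards [h.condExp_mul 0 (0 + k)] with ω hω
  rw [hω]

lemma integral_weight_mul_abs_le (h : IsAdmissible p Y μ) (l : ℤ) {g : Ω → ℝ}
    (hg : MemLp g (ENNReal.ofReal (p / 2)) μ) :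
    Integrable (fun ω => (1 + |Y l ω| ^ (p - 2)) * |g ω|) μ ∧
    ∫ ω, (1 + |Y l ω| ^ (p - 2)) * |g ω| ∂μ ≤ momentConst p Y μ * normL (p / 2) g μ := by
  have h2 := h.two_lt
  obtain ⟨i1, b1⟩ := integral_rpow_abs_mul_abs_le h2 (h.memLp l) hg
  have i2 : Integrable (fun ω => |g ω|) μ := (hg.integrable h.one_le_half).abs
  have b2 := integral_abs_le_normL (by linarith) hg
  have e : (fun ω => (1 + |Y l ω| ^ (p - 2)) * |g ω|) =
      fun ω => |g ω| + |Y l ω| ^ (p - 2) * |g ω| := by ext ω; ring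
  rw [e]
  refine ⟨i2.add i1, ?_⟩
  rw [integral_add i2 i1, momentConst, add_mul, one_mul]
  rw [h.integral_rpow_shift] at b1
  exact add_le_add b2 b1

/-- Condition `Z` on the past that makes `W` measurable, then apply Hölder. The time `l` of the
weight may differ from the time `m` of conditioning, which is needed when `W` is an increment at an
earlier time. -/
lemma abs_integral_mul_le (h : IsAdmissible p Y μ) (l m : ℤ)
    {W Z : Ω → ℝ} {w : ℝ} (hW : Measurable[past Y m] W)
    (hw : ∀ ω, |W ω| ≤ w * (1 + |Y l ω| ^ (p - 2)))
    (hZ : Integrable Z μ) (hWZ : Integrable (fun ω => W ω * Z ω) μ)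
    (hZp : MemLp (μ[Z | past Y m]) (ENNReal.ofReal (p / 2)) μ) :
    |∫ ω, W ω * Z ω ∂μ| ≤ w * (momentConst p Y μ * normL (p / 2) (μ[Z | past Y m]) μ) := by
  have e := condExp_mul_of_stronglyMeasurable_left (μ := μ) hW.stronglyMeasurable hWZ hZ
  obtain ⟨i1, b1⟩ := h.integral_weight_mul_abs_le l hZp
  have hw0 : 0 ≤ w := weight_nonneg μ hw
  have e2 : ∫ ω, W ω * Z ω ∂μ = ∫ ω, W ω * (μ[Z | past Y m]) ω ∂μ := by
    rw [← integral_condExp (past_le h.measurable m) (f := fun ω => W ω * Z ω)]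
    exact integral_congr_ae e
  rw [e2]
  refine abs_integral_le_integral_abs.trans ?_
  calc ∫ ω, |W ω * (μ[Z | past Y m]) ω| ∂μ
      ≤ ∫ ω, w * ((1 + |Y l ω| ^ (p - 2)) * |(μ[Z | past Y m]) ω|) ∂μ := by
        refine integral_mono_of_nonneg (Filter.Eventually.of_forall fun _ => abs_nonneg _)
          (i1.const_mul w) (Filter.Eventually.of_forall fun ω => ?_)
        simp only [abs_mul]
        rw [← mul_assoc]
        exact mul_le_mul_of_nonneg_right (hw ω) (abs_nonneg _)
    _ ≤ _ := by
        rw [integral_const_mul]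
        exact mul_le_mul_of_nonneg_left b1 hw0

/-- Decorrelation of a product from the remote past. -/
lemma abs_integral_mul_product_le_of_past (h : IsAdmissible p Y μ) (l : ℤ) {k i j : ℕ}
    (hki : k ≤ i) (hij : i ≤ j) {W : Ω → ℝ} {w B : ℝ} (hW : Measurable[past Y l] W)
    (hB : ∀ ω, |W ω| ≤ B) (hw : ∀ ω, |W ω| ≤ w * (1 + |Y l ω| ^ (p - 2))) :
    |∫ ω, W ω * (Y (l + i) ω * Y (l + j) ω - autocov Y μ (j - i)) ∂μ|
      ≤ w * (momentConst p Y μ * lam p Y μ k) := by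
  have hpl := past_le h.measurable l
  have hI := h.integrable_mul (l + i) (l + j)
  have hZ : Integrable (fun ω => Y (l + i) ω * Y (l + j) ω - autocov Y μ (j - i)) μ :=
    hI.sub (integrable_const _)
  have hce : μ[fun ω => Y (l + i) ω * Y (l + j) ω - autocov Y μ (j - i) | past Y l] =ᵐ[μ]
      fun ω => (μ[fun ω' => Y (l + i) ω' * Y (l + j) ω' | past Y l]) ω - autocov Y μ (j - i) := by
    have h1 := condExp_sub (m := past Y l) hI (integrable_const (autocov Y μ (j - i)))
    rw [condExp_const hpl] at h1
    exact h1
  have hmem := ((h.memLp_mul (h.memLp (l + i)) (h.memLp (l + j))).sub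
    (memLp_const (autocov Y μ (j - i)))).condExp (m := past Y l) h.one_le_half
  have := h.abs_integral_mul_le l _ hW hw hZ
    (hZ.bdd_mul (hW.mono hpl le_rfl).aestronglyMeasurable (Filter.Eventually.of_forall hB)) hmem
  have hw0 : 0 ≤ w := weight_nonneg μ hw
  refine this.trans (mul_le_mul_of_nonneg_left (mul_le_mul_of_nonneg_left ?_
    (zero_le_one.trans one_le_momentConst)) hw0)
  rw [normL, eLpNorm_congr_ae hce]
  exact h.normL_condExp_mul_sub_le l hki hij

/-- Decorrelation of a product with a distant second factor. -/
lemma abs_integral_mul_product_le_of_far (h : IsAdmissible p Y μ) (l j : ℤ) (k : ℕ)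
    {W : Ω → ℝ} {w B : ℝ} (hW : Measurable[past Y j] W)
    (hB : ∀ ω, |W ω| ≤ B) (hw : ∀ ω, |W ω| ≤ w * (1 + |Y l ω| ^ (p - 2))) :
    |∫ ω, W ω * (Y j ω * Y (j + k) ω - autocov Y μ k) ∂μ|
      ≤ w * (momentConst p Y μ * (2 * lam p Y μ k)) := by
  have h2 := h.two_lt
  have hpl := past_le h.measurable j
  have hI := h.integrable_mul j (j + k)
  have hZ : Integrable (fun ω => Y j ω * Y (j + k) ω - autocov Y μ k) μ :=
    hI.sub (integrable_const _)
  have hce : μ[fun ω => Y j ω * Y (j + k) ω - autocov Y μ k | past Y j] =ᵐ[μ]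
      fun ω => Y j ω * (μ[Y (j + k) | past Y j]) ω - autocov Y μ k := by
    have h1 := condExp_sub (m := past Y j) hI (integrable_const (autocov Y μ k))
    rw [condExp_const hpl] at h1
    refine h1.trans ?_
    filter_upwards [h.condExp_mul j (j + k)] with ω hω
    simp only [Pi.sub_apply, hω]
  have hmem := ((h.memLp_mul (h.memLp j) (h.memLp (j + k))).sub
    (memLp_const (autocov Y μ k))).condExp (m := past Y j) h.one_le_half
  have := h.abs_integral_mul_le l _ hW hw hZ
    (hZ.bdd_mul (hW.mono hpl le_rfl).aestronglyMeasurable (Filter.Eventually.of_forall hB)) hmem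
  have hw0 : 0 ≤ w := weight_nonneg μ hw
  refine this.trans (mul_le_mul_of_nonneg_left (mul_le_mul_of_nonneg_left ?_
    (zero_le_one.trans one_le_momentConst)) hw0)
  have hm1 : MemLp (fun ω => Y j ω * (μ[Y (j + k) | past Y j]) ω) (ENNReal.ofReal (p / 2)) μ :=
    h.memLp_mul (h.memLp j) (h.memLp_condExp (j + k) j)
  rw [normL, eLpNorm_congr_ae hce]
  have h3 := eLpNorm_sub_le (p := ENNReal.ofReal (p / 2)) hm1.1
    (aestronglyMeasurable_const (b := autocov Y μ k)) h.one_le_half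
  have h4 : eLpNorm (fun _ : Ω => autocov Y μ k) (ENNReal.ofReal (p / 2)) μ =
      ENNReal.ofReal |autocov Y μ k| := by
    have hp0 : ENNReal.ofReal (p / 2) ≠ 0 := (one_pos.trans_le h.one_le_half).ne'
    rw [eLpNorm_const _ hp0 (NeZero.ne μ), measure_univ, ENNReal.one_rpow, mul_one,
      Real.enorm_eq_ofReal_abs]
  rw [h4] at h3
  have h5 := ENNReal.toReal_mono (ENNReal.add_ne_top.2 ⟨hm1.2.ne, ENNReal.ofReal_ne_top⟩) h3
  rw [ENNReal.toReal_add hm1.2.ne ENNReal.ofReal_ne_top, ENNReal.toReal_ofReal (abs_nonneg _)] at h5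
  -- The factor 2: one `lam` for `Y_j E(Y_{j+k} | past)`, one for the subtracted constant `γ_k`.
  refine le_trans h5 ?_
  have h6 := h.normL_mul_condExp_le j k
  rw [normL] at h6
  linarith [h.abs_autocov_le k]

/-- Decorrelation of a distant variable. -/
lemma abs_integral_mul_le_of_far (h : IsAdmissible p Y μ) (j : ℤ) (k : ℕ)
    {W : Ω → ℝ} {w : ℝ} (hW : Measurable[past Y j] W)
    (hw : ∀ ω, |W ω| ≤ w * (1 + |Y j ω| ^ (p - 1))) :
    |∫ ω, W ω * Y (j + k) ω ∂μ|
      ≤ w * (momentConst p Y μ * (lam p Y μ k + normL p (μ[Y k | past Y 0]) μ)) := by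
  have h2 := h.two_lt
  have hpl := past_le h.measurable j
  have hw0 : 0 ≤ w := weight_nonneg μ hw
  have hpint : ∀ i, Integrable (fun ω => |Y i ω| ^ p) μ := by
    intro i
    have := (h.memLp i).integrable_norm_rpow'
    rwa [ENNReal.toReal_ofReal (by linarith)] at this
  have hWm := (hW.mono hpl le_rfl)
  have hWZ : Integrable (fun ω => W ω * Y (j + k) ω) μ := by
    refine Integrable.mono' (g := fun ω => w * (|Y (j + k) ω| + (|Y j ω| ^ p + |Y (j + k) ω| ^ p)))
      (((h.integrable _).abs.add ((hpint _).add (hpint _))).const_mul w)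
      (hWm.mul (h.measurable _)).aestronglyMeasurable (Filter.Eventually.of_forall fun ω => ?_)
    rw [norm_mul, Real.norm_eq_abs, Real.norm_eq_abs]
    refine (mul_le_mul_of_nonneg_right (hw ω) (abs_nonneg _)).trans ?_
    rw [mul_assoc]
    refine mul_le_mul_of_nonneg_left ?_ hw0
    rw [add_mul, one_mul]
    refine add_le_add le_rfl ?_
    -- Used for integrability only: the product is at most the `p`-th power of the larger factor.
    have hmax : ∀ a b : ℝ, 0 ≤ a → 0 ≤ b → a ^ (p - 1) * b ≤ a ^ p + b ^ p := by
      intro a b ha hb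
      have hs : ∀ x : ℝ, 0 ≤ x → x ^ (p - 1) * x = x ^ p := fun x hx => by
        conv_rhs => rw [show p = (p - 1) + 1 by ring,
          Real.rpow_add_one' hx (by linarith)]
      have ha' := Real.rpow_nonneg ha p
      have hb' := Real.rpow_nonneg hb p
      rcases le_total a b with hab | hab
      · have := mul_le_mul_of_nonneg_right (Real.rpow_le_rpow ha hab (by linarith : 0 ≤ p - 1)) hb
        rw [hs b hb] at this
        linarith
      · have := mul_le_mul_of_nonneg_left hab (Real.rpow_nonneg ha (p - 1))
        rw [hs a ha] at this
        linarith
    exact hmax _ _ (abs_nonneg _) (abs_nonneg _)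
  have e := condExp_mul_of_stronglyMeasurable_left (μ := μ) hW.stronglyMeasurable hWZ
    (h.integrable (j + k))
  have e2 : ∫ ω, W ω * Y (j + k) ω ∂μ = ∫ ω, W ω * (μ[Y (j + k) | past Y j]) ω ∂μ := by
    rw [← integral_condExp hpl (f := fun ω => W ω * Y (j + k) ω)]
    exact integral_congr_ae e
  have hm0 := h.memLp_condExp (j + k) j
  have hm1 : MemLp (fun ω => Y j ω * (μ[Y (j + k) | past Y j]) ω) (ENNReal.ofReal (p / 2)) μ :=
    h.memLp_mul (h.memLp j) hm0
  obtain ⟨i1, b1⟩ := integral_rpow_abs_mul_abs_le h2 (h.memLp j) hm1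
  have i0 := (hm0.integrable h.one_le).abs
  have b0 := integral_abs_le_normL (by linarith) hm0
  rw [h.normL_condExp_shift] at b0
  rw [h.integral_rpow_shift] at b1
  have b2 := h.normL_mul_condExp_le j k
  rw [e2]
  refine abs_integral_le_integral_abs.trans ?_
  -- One factor `|Y_j|` is moved into the conditional expectation. The power part of the weight then
  -- produces `lam`, and its constant part the norm of `E(Y_k | G_0)`.
  have hpt : ∀ ω, |W ω * (μ[Y (j + k) | past Y j]) ω| ≤ w * (|(μ[Y (j + k) | past Y j]) ω| +
      |Y j ω| ^ (p - 2) * |Y j ω * (μ[Y (j + k) | past Y j]) ω|) := by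
    intro ω
    rw [abs_mul, abs_mul, ← mul_assoc (|Y j ω| ^ (p - 2)), ← Real.rpow_add_one' (abs_nonneg _)
      (by linarith), show p - 2 + 1 = p - 1 by ring]
    refine (mul_le_mul_of_nonneg_right (hw ω) (abs_nonneg _)).trans_eq ?_
    ring
  calc ∫ ω, |W ω * (μ[Y (j + k) | past Y j]) ω| ∂μ
      ≤ ∫ ω, w * (|(μ[Y (j + k) | past Y j]) ω| +
          |Y j ω| ^ (p - 2) * |Y j ω * (μ[Y (j + k) | past Y j]) ω|) ∂μ :=
        integral_mono_of_nonneg (Filter.Eventually.of_forall fun _ => abs_nonneg _)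
          ((i0.add i1).const_mul w) (Filter.Eventually.of_forall hpt)
    _ ≤ _ := by
        rw [integral_const_mul, integral_add i0 i1]
        refine mul_le_mul_of_nonneg_left ?_ hw0
        have hP : 0 ≤ (∫ ω, |Y 0 ω| ^ p ∂μ) ^ ((p - 2) / p) := by
          have : 0 ≤ ∫ ω, |Y 0 ω| ^ p ∂μ := integral_nonneg fun ω => by positivity
          positivity
        have hl : 0 ≤ lam p Y μ k := lam_nonneg k
        have hn : 0 ≤ normL p (μ[Y k | past Y 0]) μ := normL_nonneg _ _ _
        unfold momentConst
        generalize (∫ ω, |Y 0 ω| ^ p ∂μ) ^ ((p - 2) / p) = P at *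
        have := mul_le_mul_of_nonneg_left b2 hP
        have := mul_nonneg hP hn
        linarith

end IsAdmissible

end LinStat

namespace LinStat

/-! ### Deterministic summation lemmas -/

lemma sum_range_shift_le {g : ℕ → ℝ} {n : ℕ} (h0 : ∀ l, 0 ≤ g l) (hz : ∀ l, n ≤ l → g l = 0)
    (i : ℕ) : ∑ j ∈ Finset.range n, g (j + i) ≤ ∑ j ∈ Finset.range n, g j := by
  induction i with
  | zero => simp
  | succ i ih =>
    refine le_trans ?_ ih
    have h1 := Finset.sum_range_succ' (fun j => g (j + i)) n
    rw [Finset.sum_range_succ, hz (n + i) (by omega)] at h1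
    have h2 : ∀ j, g (j + (i + 1)) = g (j + 1 + i) := fun j => by congr 1; omega
    simp only [h2]
    linarith [h0 (0 + i)]

lemma sum_range_sub_le {x : ℕ → ℝ} (hx : ∀ k, 0 ≤ x k) {i n : ℕ} (hi : i ≤ n) :
    ∑ j ∈ Finset.range i, x (i - j) ≤ ∑ k ∈ Finset.Icc 1 n, x k := by
  have h1 : ∑ j ∈ Finset.range i, x (i - j) = ∑ k ∈ Finset.Icc 1 i, x k := by
    refine Finset.sum_bij' (fun j _ => i - j) (fun k _ => i - k) ?_ ?_ ?_ ?_ ?_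
    all_goals intros; simp_all <;> omega
  rw [h1]
  exact Finset.sum_le_sum_of_subset_of_nonneg (Finset.Icc_subset_Icc le_rfl hi) fun k _ _ => hx k

lemma sum_Ioo_sub_le {x : ℕ → ℝ} (hx : ∀ k, 0 ≤ x k) (j n : ℕ) :
    ∑ i ∈ Finset.Ioo j n, x (i - j) ≤ ∑ k ∈ Finset.Icc 1 n, x k := by
  have h1 : ∑ i ∈ Finset.Ioo j n, x (i - j) = ∑ k ∈ Finset.Icc 1 (n - 1 - j), x k := by
    refine Finset.sum_bij' (fun i _ => i - j) (fun k _ => k + j) ?_ ?_ ?_ ?_ ?_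
    all_goals intros; simp_all <;> omega
  rw [h1]
  exact Finset.sum_le_sum_of_subset_of_nonneg (Finset.Icc_subset_Icc le_rfl (by omega))
    fun k _ _ => hx k

/-- Pairs are attached to their lower index, whose weight is the smaller one. -/
lemma sum_pairs_le {a K x : ℕ → ℝ} (hK : Monotone K) (hx : ∀ k, 0 ≤ x k) (n : ℕ)
    (hK0 : ∀ i, 0 ≤ K i) :
    ∑ i ∈ Finset.range n, ∑ j ∈ Finset.range i, |a i| * |a j| * K j * x (i - j) ≤
      (∑ i ∈ Finset.range n, a i ^ 2 * K i) * ∑ k ∈ Finset.Icc 1 n, x k := by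
  have hpt : ∀ i, ∀ j ∈ Finset.range i, |a i| * |a j| * K j * x (i - j) ≤
      1 / 2 * (a i ^ 2 * K i * x (i - j)) + 1 / 2 * (a j ^ 2 * K j * x (i - j)) := by
    intro i j hj
    have h1 : K j ≤ K i := hK (Finset.mem_range.1 hj).le
    have h2 : |a i| * |a j| * K j ≤ 1 / 2 * (a i ^ 2 * K i) + 1 / 2 * (a j ^ 2 * K j) := by
      have h3 : |a i| * |a j| ≤ 1 / 2 * a i ^ 2 + 1 / 2 * a j ^ 2 := by
        rw [← sq_abs (a i), ← sq_abs (a j)]; nlinarith [sq_nonneg (|a i| - |a j|)]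
      calc |a i| * |a j| * K j ≤ (1 / 2 * a i ^ 2 + 1 / 2 * a j ^ 2) * K j :=
            mul_le_mul_of_nonneg_right h3 (hK0 j)
        _ ≤ _ := by nlinarith [mul_le_mul_of_nonneg_left h1 (sq_nonneg (a i))]
    have := mul_le_mul_of_nonneg_right h2 (hx (i - j))
    linarith
  have hA : ∀ i, 0 ≤ a i ^ 2 * K i := fun i => mul_nonneg (sq_nonneg _) (hK0 i)
  have s1 : ∑ i ∈ Finset.range n, ∑ j ∈ Finset.range i, a i ^ 2 * K i * x (i - j) ≤
      (∑ i ∈ Finset.range n, a i ^ 2 * K i) * ∑ k ∈ Finset.Icc 1 n, x k := by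
    rw [Finset.sum_mul]
    refine Finset.sum_le_sum fun i hi => ?_
    rw [← Finset.mul_sum]
    exact mul_le_mul_of_nonneg_left (sum_range_sub_le hx (Finset.mem_range.1 hi).le) (hA i)
  have s2 : ∑ i ∈ Finset.range n, ∑ j ∈ Finset.range i, a j ^ 2 * K j * x (i - j) ≤
      (∑ i ∈ Finset.range n, a i ^ 2 * K i) * ∑ k ∈ Finset.Icc 1 n, x k := by
    rw [Finset.sum_comm' (t' := Finset.range n) (s' := fun j => Finset.Ioo j n)
      (by intro i j; simp; omega), Finset.sum_mul]
    refine Finset.sum_le_sum fun j _ => ?_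
    rw [← Finset.mul_sum]
    exact mul_le_mul_of_nonneg_left (sum_Ioo_sub_le hx j n) (hA j)
  calc _ ≤ ∑ i ∈ Finset.range n, ∑ j ∈ Finset.range i,
        (1 / 2 * (a i ^ 2 * K i * x (i - j)) + 1 / 2 * (a j ^ 2 * K j * x (i - j))) :=
        Finset.sum_le_sum fun i _ => Finset.sum_le_sum (hpt i)
    _ = 1 / 2 * (∑ i ∈ Finset.range n, ∑ j ∈ Finset.range i, a i ^ 2 * K i * x (i - j)) +
        1 / 2 * (∑ i ∈ Finset.range n, ∑ j ∈ Finset.range i, a j ^ 2 * K j * x (i - j)) := by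
        simp only [Finset.sum_add_distrib, Finset.mul_sum]
    _ ≤ _ := by linarith

/-- The value `x k` occurs at most `k` times with `k` as the first index and `k` times as the
second. This is the origin of the factor `i` in `Λ_n`. -/
lemma sum_sum_max_le {x : ℕ → ℝ} (hx : ∀ k, 0 ≤ x k) (n : ℕ) :
    ∑ k ∈ Finset.Icc 1 n, ∑ u ∈ Finset.Icc 1 n, x (max u k) ≤
      2 * ∑ k ∈ Finset.Icc 1 n, (k : ℝ) * x k := by
  have hpt : ∀ k u, x (max u k) ≤ (if u ≤ k then x k else 0) + (if k ≤ u then x u else 0) := by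
    intro k u
    rcases le_total u k with h | h
    · rw [max_eq_right h, if_pos h]
      have : 0 ≤ if k ≤ u then x u else 0 := by split_ifs <;> simp [hx]
      linarith
    · rw [max_eq_left h, if_pos h]
      have : 0 ≤ if u ≤ k then x k else 0 := by split_ifs <;> simp [hx]
      linarith
  have hs : ∀ k ∈ Finset.Icc 1 n, ∑ u ∈ Finset.Icc 1 n, (if u ≤ k then x k else 0) = k * x k := by
    intro k hk
    rw [← Finset.sum_filter, Finset.sum_const, nsmul_eq_mul]
    congr 2
    have : Finset.filter (fun u => u ≤ k) (Finset.Icc 1 n) = Finset.Icc 1 k := by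
      ext u; simp at hk ⊢; omega
    rw [this]; simp
  calc _ ≤ ∑ k ∈ Finset.Icc 1 n, ∑ u ∈ Finset.Icc 1 n,
        ((if u ≤ k then x k else 0) + (if k ≤ u then x u else 0)) :=
        Finset.sum_le_sum fun k _ => Finset.sum_le_sum fun u _ => hpt k u
    _ = ∑ k ∈ Finset.Icc 1 n, ∑ u ∈ Finset.Icc 1 n, (if u ≤ k then x k else 0) +
        ∑ u ∈ Finset.Icc 1 n, ∑ k ∈ Finset.Icc 1 n, (if k ≤ u then x u else 0) := by
        simp only [Finset.sum_add_distrib]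
        congr 1
        exact Finset.sum_comm
    _ = _ := by rw [Finset.sum_congr rfl hs]; ring

/-! ### The covariance quadratic form and its diagonal approximation -/

section MainTerm

variable {a K Q : ℕ → ℝ} {n : ℕ} {m w b : ℝ}

/-- Moving the squared weights by one step. -/
lemma abs_sum_shift_one_le (haz : ∀ l, n ≤ l → a l = 0) (ham : ∀ l, |a l| ≤ m) (hK : Monotone K)
    (hK0 : ∀ i, 0 ≤ K i) (hQ : ∀ j, j < n → |Q j| ≤ b) (hb : 0 ≤ b) (hw : 0 ≤ w)
    (hdQ : ∀ j, j + 1 < n → |Q (j + 1) - Q j| ≤ w * K j) (k : ℕ) :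
    |∑ j ∈ Finset.range n, Q j * a (j + (k + 1)) ^ 2 - ∑ j ∈ Finset.range n, Q j * a (j + k) ^ 2| ≤
      w * (∑ j ∈ Finset.range n, a j ^ 2 * K j) + b * m ^ 2 := by
  have hA : ∀ i, 0 ≤ a i ^ 2 * K i := fun i => mul_nonneg (sq_nonneg _) (hK0 i)
  cases n with
  | zero => simp; positivity
  | succ n' =>
    rw [Finset.sum_range_succ (fun j => Q j * a (j + (k + 1)) ^ 2),
      Finset.sum_range_succ' (fun j => Q j * a (j + k) ^ 2), haz (n' + (k + 1)) (by omega)]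
    have e : ∑ j ∈ Finset.range n', Q j * a (j + (k + 1)) ^ 2 + Q n' * 0 ^ 2 -
        (∑ j ∈ Finset.range n', Q (j + 1) * a (j + 1 + k) ^ 2 + Q 0 * a (0 + k) ^ 2) =
        ∑ j ∈ Finset.range n', -((Q (j + 1) - Q j) * a (j + (k + 1)) ^ 2) - Q 0 * a (0 + k) ^ 2 := by
      have : ∀ j, a (j + 1 + k) = a (j + (k + 1)) := fun j => by congr 1; omega
      simp only [this, sub_mul, neg_sub, Finset.sum_sub_distrib]
      ring
    rw [e]
    refine (abs_sub _ _).trans (add_le_add ?_ ?_)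
    · refine (Finset.abs_sum_le_sum_abs _ _).trans ?_
      calc ∑ j ∈ Finset.range n', |-((Q (j + 1) - Q j) * a (j + (k + 1)) ^ 2)|
          ≤ ∑ j ∈ Finset.range n', w * (a (j + (k + 1)) ^ 2 * K (j + (k + 1))) := by
            refine Finset.sum_le_sum fun j hj => ?_
            rw [abs_neg, abs_mul, abs_of_nonneg (sq_nonneg (a _))]
            have h1 := hdQ j (by have := Finset.mem_range.1 hj; omega)
            -- Monotonicity moves the weight to the index of the shifted coefficient, so that the
            -- sum becomes a shift of `∑ a_j² K_j`.
            have h2 : K j ≤ K (j + (k + 1)) := hK (by omega)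
            calc |Q (j + 1) - Q j| * a (j + (k + 1)) ^ 2
                ≤ w * K (j + (k + 1)) * a (j + (k + 1)) ^ 2 :=
                  mul_le_mul_of_nonneg_right (h1.trans (mul_le_mul_of_nonneg_left h2 hw))
                    (sq_nonneg _)
              _ = _ := by ring
        _ ≤ ∑ j ∈ Finset.range (n' + 1), w * (a (j + (k + 1)) ^ 2 * K (j + (k + 1))) := by
            refine Finset.sum_le_sum_of_subset_of_nonneg (Finset.range_mono (by omega))
              fun j _ _ => mul_nonneg hw (hA _)
        _ ≤ w * ∑ j ∈ Finset.range (n' + 1), a j ^ 2 * K j := by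
            rw [← Finset.mul_sum]
            refine mul_le_mul_of_nonneg_left ?_ hw
            exact sum_range_shift_le hA (fun l hl => by rw [haz l hl]; ring) (k + 1)
    · rw [abs_mul, abs_of_nonneg (sq_nonneg (a _)), ← sq_abs (a _)]
      exact mul_le_mul (hQ 0 (by omega)) (pow_le_pow_left₀ (abs_nonneg _) (ham _) 2)
        (by positivity) hb

lemma abs_sum_shift_le (haz : ∀ l, n ≤ l → a l = 0) (ham : ∀ l, |a l| ≤ m) (hK : Monotone K)
    (hK0 : ∀ i, 0 ≤ K i) (hQ : ∀ j, j < n → |Q j| ≤ b) (hb : 0 ≤ b) (hw : 0 ≤ w)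
    (hdQ : ∀ j, j + 1 < n → |Q (j + 1) - Q j| ≤ w * K j) (k : ℕ) :
    |∑ j ∈ Finset.range n, Q j * a (j + k) ^ 2 - ∑ j ∈ Finset.range n, Q j * a j ^ 2| ≤
      k * (w * (∑ j ∈ Finset.range n, a j ^ 2 * K j) + b * m ^ 2) := by
  induction k with
  | zero => simp
  | succ k ih =>
    have h1 := abs_sum_shift_one_le haz ham hK hK0 hQ hb hw hdQ k
    have h2 := abs_add_le (∑ j ∈ Finset.range n, Q j * a (j + (k + 1)) ^ 2 -
      ∑ j ∈ Finset.range n, Q j * a (j + k) ^ 2)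
      (∑ j ∈ Finset.range n, Q j * a (j + k) ^ 2 - ∑ j ∈ Finset.range n, Q j * a j ^ 2)
    rw [sub_add_sub_cancel] at h2
    push_cast
    linarith

/-- A difference over `k` steps telescopes; Cauchy–Schwarz gives one factor `k`, the sum over the
`k` shifts the other. -/
lemma sum_sq_sub_shift_le (haz : ∀ l, n ≤ l → a l = 0) (k : ℕ) :
    ∑ j ∈ Finset.range n, (a j - a (j + k)) ^ 2 ≤
      k ^ 2 * ∑ j ∈ Finset.range n, (a (j + 1) - a j) ^ 2 := by
  have hpt : ∀ j, (a j - a (j + k)) ^ 2 ≤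
      k * ∑ i ∈ Finset.range k, (a (j + i + 1) - a (j + i)) ^ 2 := by
    intro j
    have h1 := Finset.sum_range_sub (fun i => a (j + i)) k
    have h2 := sq_sum_le_card_mul_sum_sq (s := Finset.range k)
      (f := fun i => a (j + (i + 1)) - a (j + i))
    rw [h1, Finset.card_range] at h2
    calc (a j - a (j + k)) ^ 2 = (a (j + k) - a (j + 0)) ^ 2 := by rw [add_zero]; ring
      _ ≤ _ := h2
  calc _ ≤ ∑ j ∈ Finset.range n, k * ∑ i ∈ Finset.range k, (a (j + i + 1) - a (j + i)) ^ 2 :=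
        Finset.sum_le_sum fun j _ => hpt j
    _ = k * ∑ i ∈ Finset.range k, ∑ j ∈ Finset.range n, (a (j + i + 1) - a (j + i)) ^ 2 := by
        rw [← Finset.mul_sum, Finset.sum_comm]
    _ ≤ k * ∑ i ∈ Finset.range k, ∑ j ∈ Finset.range n, (a (j + 1) - a j) ^ 2 := by
        refine mul_le_mul_of_nonneg_left (Finset.sum_le_sum fun i _ => ?_) (Nat.cast_nonneg k)
        exact sum_range_shift_le (g := fun l => (a (l + 1) - a l) ^ 2) (fun l => sq_nonneg _)
          (fun l hl => by rw [haz l hl, haz (l + 1) (by omega)]; ring) i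
    _ = _ := by rw [Finset.sum_const, Finset.card_range, nsmul_eq_mul]; ring

/-- By polarization, `2 a_j (a_{j+k} - a_j) = a_{j+k}² - a_j² - (a_j - a_{j+k})²`. The difference of
squares is summed by parts against the slowly varying `Q`, so the increments of `a` enter only
through their squares. -/
lemma abs_sum_mul_shift_sub_le (haz : ∀ l, n ≤ l → a l = 0) (ham : ∀ l, |a l| ≤ m) (hK : Monotone K)
    (hK0 : ∀ i, 0 ≤ K i) (hQ : ∀ j, j < n → |Q j| ≤ b) (hb : 0 ≤ b) (hw : 0 ≤ w)
    (hdQ : ∀ j, j + 1 < n → |Q (j + 1) - Q j| ≤ w * K j) (k : ℕ) :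
    |∑ j ∈ Finset.range n, Q j * (a j * (a (j + k) - a j))| ≤
      k ^ 2 * (w * (∑ j ∈ Finset.range n, a j ^ 2 * K j) + b * m ^ 2 +
        b * ∑ j ∈ Finset.range n, (a (j + 1) - a j) ^ 2) := by
  have e : ∑ j ∈ Finset.range n, Q j * (a j * (a (j + k) - a j)) =
      1 / 2 * (∑ j ∈ Finset.range n, Q j * a (j + k) ^ 2 - ∑ j ∈ Finset.range n, Q j * a j ^ 2) -
      1 / 2 * ∑ j ∈ Finset.range n, Q j * (a j - a (j + k)) ^ 2 := by
    rw [← Finset.sum_sub_distrib, Finset.mul_sum, Finset.mul_sum, ← Finset.sum_sub_distrib]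
    exact Finset.sum_congr rfl fun j _ => by ring
  have h1 := abs_sum_shift_le haz ham hK hK0 hQ hb hw hdQ k
  have h2 : |∑ j ∈ Finset.range n, Q j * (a j - a (j + k)) ^ 2| ≤
      b * (k ^ 2 * ∑ j ∈ Finset.range n, (a (j + 1) - a j) ^ 2) := by
    refine (Finset.abs_sum_le_sum_abs _ _).trans (le_trans ?_
      (mul_le_mul_of_nonneg_left (sum_sq_sub_shift_le haz k) hb))
    rw [Finset.mul_sum]
    refine Finset.sum_le_sum fun j hj => ?_
    rw [abs_mul, abs_of_nonneg (sq_nonneg (a j - _))]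
    exact mul_le_mul_of_nonneg_right (hQ j (Finset.mem_range.1 hj)) (sq_nonneg _)
  have hk : (k : ℝ) ≤ (k : ℝ) ^ 2 := by exact_mod_cast Nat.le_self_pow two_ne_zero k
  have hE : 0 ≤ w * (∑ j ∈ Finset.range n, a j ^ 2 * K j) + b * m ^ 2 :=
    add_nonneg (mul_nonneg hw (Finset.sum_nonneg fun j _ => mul_nonneg (sq_nonneg _) (hK0 j)))
      (mul_nonneg hb (sq_nonneg _))
  have h3 := h1.trans (mul_le_mul_of_nonneg_right hk hE)
  have hk0 : (0 : ℝ) ≤ (k : ℝ) ^ 2 := sq_nonneg _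
  rw [e]
  refine (abs_sub _ _).trans ?_
  rw [abs_mul, abs_mul, abs_of_pos (by norm_num : (0 : ℝ) < 1 / 2)]
  have h4 := abs_nonneg (∑ j ∈ Finset.range n, Q j * (a j - a (j + k)) ^ 2)
  have h5 := abs_nonneg
    (∑ j ∈ Finset.range n, Q j * a (j + k) ^ 2 - ∑ j ∈ Finset.range n, Q j * a j ^ 2)
  nlinarith

/-- The quadratic form with the covariances, compared with its diagonal approximation. -/
theorem abs_quadratic_sub_le (haz : ∀ l, n ≤ l → a l = 0) (ham : ∀ l, |a l| ≤ m) (hK : Monotone K)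
    (hK0 : ∀ i, 0 ≤ K i) (hQ : ∀ j, j < n → |Q j| ≤ b) (hb : 0 ≤ b) (hw : 0 ≤ w)
    (hdQ : ∀ j, j + 1 < n → |Q (j + 1) - Q j| ≤ w * K j) {γ : ℕ → ℝ}
    (hγ : Summable fun k : ℕ => (k : ℝ) ^ 2 * |γ k|) :
    |∑ i ∈ Finset.range n, ∑ j ∈ Finset.range i, a i * a j * γ (i - j) * Q j -
        (∑' k, γ (k + 1)) * ∑ i ∈ Finset.range n, a i ^ 2 * Q i| ≤
      (∑' k : ℕ, (k : ℝ) ^ 2 * |γ k|) * (w * (∑ j ∈ Finset.range n, a j ^ 2 * K j) + b * m ^ 2 +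
        b * ∑ j ∈ Finset.range n, (a (j + 1) - a j) ^ 2) := by
  obtain ⟨D, hD⟩ : ∃ D, D = w * (∑ j ∈ Finset.range n, a j ^ 2 * K j) + b * m ^ 2 +
        b * ∑ j ∈ Finset.range n, (a (j + 1) - a j) ^ 2 := ⟨_, rfl⟩
  have hγ1 : Summable fun k : ℕ => ((k + 1 : ℕ) : ℝ) ^ 2 * |γ (k + 1)| :=
    (summable_nat_add_iff 1).2 hγ
  have hle : ∀ k : ℕ, |γ (k + 1)| ≤ ((k + 1 : ℕ) : ℝ) ^ 2 * |γ (k + 1)| := by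
    intro k
    have : (1 : ℝ) ≤ ((k + 1 : ℕ) : ℝ) ^ 2 := by
      have : (1 : ℝ) ≤ ((k + 1 : ℕ) : ℝ) := by exact_mod_cast Nat.succ_le_succ (Nat.zero_le k)
      nlinarith
    nlinarith [abs_nonneg (γ (k + 1))]
  have hγ2 : Summable fun k : ℕ => γ (k + 1) :=
    Summable.of_norm_bounded hγ1 hle
  -- For fixed `j` all lags `k + 1` are summed: those with `j + (k + 1) ≥ n` contribute only to the
  -- diagonal term because `a` vanishes there.
  have hrow : ∀ j ∈ Finset.range n, HasSum (fun k => γ (k + 1) * (Q j * (a j * (a (j + (k + 1)) - a j))))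
      (∑ i ∈ Finset.Ioo j n, a i * a j * γ (i - j) * Q j - (∑' k, γ (k + 1)) * (a j ^ 2 * Q j)) := by
    intro j hj
    have h1 : HasSum (fun k => γ (k + 1) * (Q j * (a j * a (j + (k + 1)))))
        (∑ k ∈ Finset.range (n - 1 - j), γ (k + 1) * (Q j * (a j * a (j + (k + 1))))) := by
      refine hasSum_sum_of_ne_finset_zero fun k hk => ?_
      have hj' := Finset.mem_range.1 hj
      rw [haz (j + (k + 1)) (by simp at hk; omega)]; ring
    have h2 : ∑ k ∈ Finset.range (n - 1 - j), γ (k + 1) * (Q j * (a j * a (j + (k + 1)))) =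
        ∑ i ∈ Finset.Ioo j n, a i * a j * γ (i - j) * Q j := by
      refine Finset.sum_bij' (fun k _ => j + (k + 1)) (fun i _ => i - j - 1) ?_ ?_ ?_ ?_ ?_
      · intro k hk; simp at hk ⊢; omega
      · intro i hi; simp at hi ⊢; omega
      · intro k hk; omega
      · intro i hi; simp at hi ⊢; omega
      · intro k hk; rw [Nat.add_sub_cancel_left]; ring
    rw [h2] at h1
    refine (h1.sub (hγ2.hasSum.mul_right (a j ^ 2 * Q j))).congr_fun ?_
    intro k; ring
  have htot : HasSum (fun k => γ (k + 1) * ∑ j ∈ Finset.range n, Q j * (a j * (a (j + (k + 1)) - a j)))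
      (∑ i ∈ Finset.range n, ∑ j ∈ Finset.range i, a i * a j * γ (i - j) * Q j -
        (∑' k, γ (k + 1)) * ∑ i ∈ Finset.range n, a i ^ 2 * Q i) := by
    have h1 := hasSum_sum hrow
    rw [Finset.sum_sub_distrib, ← Finset.mul_sum] at h1
    rw [Finset.sum_comm' (t' := Finset.range n) (s' := fun j => Finset.Ioo j n)
      (by intro i j; simp; omega)]
    simpa only [Finset.mul_sum] using h1
  rw [← htot.tsum_eq, ← hD, ← Real.norm_eq_abs]
  have hb1 : ∀ k, ‖γ (k + 1) * ∑ j ∈ Finset.range n, Q j * (a j * (a (j + (k + 1)) - a j))‖ ≤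
      ((k + 1 : ℕ) : ℝ) ^ 2 * |γ (k + 1)| * D := by
    intro k
    rw [norm_mul, Real.norm_eq_abs, Real.norm_eq_abs]
    have := abs_sum_mul_shift_sub_le haz ham hK hK0 hQ hb hw hdQ (k + 1)
    rw [← hD] at this
    refine (mul_le_mul_of_nonneg_left this (abs_nonneg _)).trans_eq ?_
    ring
  refine (tsum_of_norm_bounded ((hγ1.mul_right D).hasSum) hb1).trans ?_
  rw [tsum_mul_right, hγ.tsum_eq_zero_add]
  simp

end MainTerm

end LinStat

namespace LinStat

variable {Ω : Type*} [mΩ : MeasurableSpace Ω]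

/-! ### The Lindeberg scheme for an adapted family of test functions -/

/-- Processes `G`, `H`, `q` (a test function along the partial sums, and its first two derivatives)
with the one-step expansions driven by the increments `a i * Y (i + 1)`. -/
structure LindebergScheme (p s C m b B : ℝ) (Y : ℤ → Ω → ℝ) (a K : ℕ → ℝ)
    (G H q : ℕ → Ω → ℝ) : Prop where
  C_nonneg : 0 ≤ C
  a_le : ∀ i, |a i| ≤ m
  K_mono : Monotone K
  K_nonneg : ∀ i, 0 ≤ K i
  G_meas : ∀ i, Measurable (G i)
  -- `B` serves integrability alone; the bound `b` on `q` enters the final estimate.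
  G_le : ∀ i ω, |G i ω| ≤ B
  H_meas : ∀ i : ℕ, Measurable[past Y i] (H i)
  H_le : ∀ i ω, |H i ω| ≤ B
  q_meas : ∀ i : ℕ, Measurable[past Y i] (q i)
  q_le : ∀ i ω, |q i ω| ≤ b
  H_zero : ∃ c, ∀ ω, H 0 ω = c
  q_zero : ∃ c, ∀ ω, q 0 ω = c
  q_step : ∀ (i : ℕ) ω, |q (i + 1) ω - q i ω| ≤
    C * K i * |a i| ^ (p - 2) * (1 + |Y (i + 1) ω| ^ (p - 2))
  H_step : ∀ (i : ℕ) ω, |H (i + 1) ω - H i ω - a i * Y (i + 1) ω * q i ω| ≤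
    C * K i * |a i| ^ (p - 1) * (1 + |Y (i + 1) ω| ^ (p - 1))
  G_step : ∀ (i : ℕ) ω, |G (i + 1) ω - G i ω - a i * Y (i + 1) ω * H i ω
      - a i ^ 2 * (Y (i + 1) ω ^ 2 - s) / 2 * q i ω| ≤
    C * K i * |a i| ^ p * (1 + |Y (i + 1) ω| ^ p)

namespace LindebergScheme

variable {p s C m b B : ℝ} {Y : ℤ → Ω → ℝ} {a K : ℕ → ℝ} {G H q : ℕ → Ω → ℝ} {μ : Measure Ω}
  [IsProbabilityMeasure μ]

lemma m_nonneg (D : LindebergScheme p s C m b B Y a K G H q) : 0 ≤ m :=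
  (abs_nonneg _).trans (D.a_le 0)

lemma rpow_a_le (D : LindebergScheme p s C m b B Y a K G H q) (hp : 2 < p) (i : ℕ) :
    |a i| ^ (p - 2) ≤ m ^ (p - 2) :=
  Real.rpow_le_rpow (abs_nonneg _) (D.a_le i) (by linarith)

/-- `q_j` is telescoped from the constant `q_0`, which contributes nothing because the product is
centered. Each increment of `q` is decorrelated from the centered product. -/
lemma abs_integral_q_mul_le (D : LindebergScheme p s C m b B Y a K G H q)
    (h : IsAdmissible p Y μ) {i j : ℕ} (hji : j ≤ i) :
    |∫ ω, q j ω * (Y (j + 1) ω * Y (i + 1) ω - autocov Y μ ((i - j : ℕ) : ℤ)) ∂μ| ≤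
      ∑ l ∈ Finset.range j, C * K l * m ^ (p - 2) *
        (momentConst p Y μ * (2 * lam p Y μ (max (j - l) (i - j)))) := by
  have h2 := h.two_lt
  have hcov : autocov Y μ ((i - j : ℕ) : ℤ) = ∫ ω, Y (j + 1) ω * Y (i + 1) ω ∂μ := by
    rw [← h.autocov_shift (j + 1)]
    have : (j : ℤ) + 1 + ((i - j : ℕ) : ℤ) = i + 1 := by omega
    rw [this]
  have hI := h.integrable_mul (j + 1) (i + 1)
  have hZ : Integrable (fun ω => Y (j + 1) ω * Y (i + 1) ω - autocov Y μ ((i - j : ℕ) : ℤ)) μ :=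
    hI.sub (integrable_const _)
  have hqi : ∀ l, Integrable
      (fun ω => q l ω * (Y (j + 1) ω * Y (i + 1) ω - autocov Y μ ((i - j : ℕ) : ℤ))) μ := fun l =>
    hZ.bdd_mul ((D.q_meas l).mono (past_le h.measurable l) le_rfl).aestronglyMeasurable
      (Filter.Eventually.of_forall (D.q_le l))
  suffices hs : ∀ j' ≤ j,
      |∫ ω, q j' ω * (Y (j + 1) ω * Y (i + 1) ω - autocov Y μ ((i - j : ℕ) : ℤ)) ∂μ| ≤
      ∑ l ∈ Finset.range j', C * K l * m ^ (p - 2) *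
        (momentConst p Y μ * (2 * lam p Y μ (max (j - l) (i - j)))) from hs j le_rfl
  intro j' hj'
  induction j' with
  | zero =>
    obtain ⟨c, hc⟩ := D.q_zero
    simp only [hc]
    rw [integral_const_mul, integral_sub hI (integrable_const _), hcov]
    simp
  | succ l ih =>
    have ih := ih (by omega)
    have e : ∫ ω, q (l + 1) ω * (Y (j + 1) ω * Y (i + 1) ω - autocov Y μ ((i - j : ℕ) : ℤ)) ∂μ =
        ∫ ω, q l ω * (Y (j + 1) ω * Y (i + 1) ω - autocov Y μ ((i - j : ℕ) : ℤ)) ∂μ +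
        ∫ ω, (q (l + 1) ω - q l ω) *
          (Y (j + 1) ω * Y (i + 1) ω - autocov Y μ ((i - j : ℕ) : ℤ)) ∂μ := by
      simp only [sub_mul (q (l + 1) _)]
      rw [integral_sub (hqi _) (hqi _)]; ring
    rw [e, Finset.sum_range_succ]
    refine (abs_add_le _ _).trans (add_le_add ih ?_)
    have hmeas : Measurable[past Y (l + 1)] fun ω => q (l + 1) ω - q l ω := by
      have m1 := D.q_meas (l + 1)
      have m2 : Measurable[past Y ((l : ℤ) + 1)] (q l) :=
        (D.q_meas l).mono (past_mono Y (by omega)) le_rfl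
      exact m1.sub m2
    have hbd : ∀ ω, |q (l + 1) ω - q l ω| ≤ b + b := fun ω =>
      (abs_sub _ _).trans (add_le_add (D.q_le _ _) (D.q_le _ _))
    have hwt : ∀ ω, |q (l + 1) ω - q l ω| ≤
        C * K l * m ^ (p - 2) * (1 + |Y (l + 1) ω| ^ (p - 2)) := fun ω => by
      refine (D.q_step l ω).trans (mul_le_mul_of_nonneg_right ?_ (by positivity))
      exact mul_le_mul_of_nonneg_left (D.rpow_a_le h2 l) (mul_nonneg D.C_nonneg (D.K_nonneg l))
    have hw0 : 0 ≤ C * K l * m ^ (p - 2) :=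
      mul_nonneg (mul_nonneg D.C_nonneg (D.K_nonneg l)) (Real.rpow_nonneg D.m_nonneg _)
    have hD0 : 0 ≤ momentConst p Y μ := zero_le_one.trans IsAdmissible.one_le_momentConst
    -- The larger of the two gaps is used: from the increment (time `l + 1`) to the pair, or between
    -- the two members of the pair.
    rcases le_total (i - j) (j - l) with hc | hc
    · rw [max_eq_left hc]
      have h3 := h.abs_integral_mul_product_le_of_past ((l : ℤ) + 1) (k := j - l) (i := j - l)
        (j := i - l) le_rfl (by omega) hmeas hbd hwt
      have e1 : (l : ℤ) + 1 + ((j - l : ℕ) : ℤ) = j + 1 := by omega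
      have e2 : (l : ℤ) + 1 + ((i - l : ℕ) : ℤ) = i + 1 := by omega
      have e3 : ((i - l : ℕ) : ℤ) - ((j - l : ℕ) : ℤ) = ((i - j : ℕ) : ℤ) := by omega
      rw [e1, e2, e3] at h3
      refine h3.trans (mul_le_mul_of_nonneg_left (mul_le_mul_of_nonneg_left ?_ hD0) hw0)
      linarith [IsAdmissible.lam_nonneg (p := p) (Y := Y) (μ := μ) (j - l)]
    · rw [max_eq_right hc]
      have h3 := h.abs_integral_mul_product_le_of_far ((l : ℤ) + 1) ((j : ℤ) + 1) (i - j)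
        (hmeas.mono (past_mono Y (by omega)) le_rfl) hbd hwt
      have e1 : (j : ℤ) + 1 + ((i - j : ℕ) : ℤ) = i + 1 := by omega
      rw [e1] at h3
      exact h3

/-- The same bound, after using that the weights `K` increase. -/
lemma abs_integral_q_mul_le' (D : LindebergScheme p s C m b B Y a K G H q)
    (h : IsAdmissible p Y μ) {i j n : ℕ} (hji : j ≤ i) (hjn : j ≤ n) :
    |∫ ω, q j ω * (Y (j + 1) ω * Y (i + 1) ω - autocov Y μ ((i - j : ℕ) : ℤ)) ∂μ| ≤
      K j * (2 * C * m ^ (p - 2) * momentConst p Y μ *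
        ∑ u ∈ Finset.Icc 1 n, lam p Y μ (max u (i - j))) := by
  have hD0 : 0 ≤ momentConst p Y μ := zero_le_one.trans IsAdmissible.one_le_momentConst
  have hm := Real.rpow_nonneg D.m_nonneg (p - 2)
  have hlam : ∀ k, 0 ≤ lam p Y μ k := fun k => IsAdmissible.lam_nonneg k
  refine (D.abs_integral_q_mul_le h hji).trans ?_
  calc _ ≤ ∑ l ∈ Finset.range j, K j * (2 * C * m ^ (p - 2) * momentConst p Y μ) *
        lam p Y μ (max (j - l) (i - j)) := by
        refine Finset.sum_le_sum fun l hl => ?_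
        have h1 : K l ≤ K j := D.K_mono (Finset.mem_range.1 hl).le
        have h3 : 0 ≤ 2 * C * m ^ (p - 2) * momentConst p Y μ * lam p Y μ (max (j - l) (i - j)) :=
          mul_nonneg (mul_nonneg (mul_nonneg (mul_nonneg zero_le_two D.C_nonneg) hm) hD0) (hlam _)
        have := mul_le_mul_of_nonneg_right h1 h3
        linarith
    _ = K j * (2 * C * m ^ (p - 2) * momentConst p Y μ) *
        ∑ l ∈ Finset.range j, lam p Y μ (max (j - l) (i - j)) := by rw [Finset.mul_sum]
    _ ≤ K j * (2 * C * m ^ (p - 2) * momentConst p Y μ) *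
        ∑ u ∈ Finset.Icc 1 n, lam p Y μ (max u (i - j)) := by
        refine mul_le_mul_of_nonneg_left
          (sum_range_sub_le (x := fun u => lam p Y μ (max u (i - j))) (fun k => hlam _) hjn) ?_
        exact mul_nonneg (D.K_nonneg j)
          (mul_nonneg (mul_nonneg (mul_nonneg zero_le_two D.C_nonneg) hm) hD0)
    _ = _ := by ring

lemma integrable_Y_mul_H (D : LindebergScheme p s C m b B Y a K G H q)
    (h : IsAdmissible p Y μ) (i : ℤ) (j : ℕ) : Integrable (fun ω => H j ω * Y i ω) μ :=
  (h.integrable i).bdd_mul ((D.H_meas j).mono (past_le h.measurable j) le_rfl).aestronglyMeasurable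
    (Filter.Eventually.of_forall (D.H_le j))

lemma integrable_q_mul_YY (D : LindebergScheme p s C m b B Y a K G H q)
    (h : IsAdmissible p Y μ) (i i' : ℤ) (j : ℕ) :
    Integrable (fun ω => q j ω * (Y i ω * Y i' ω)) μ :=
  (h.integrable_mul i i').bdd_mul
    ((D.q_meas j).mono (past_le h.measurable j) le_rfl).aestronglyMeasurable
    (Filter.Eventually.of_forall (D.q_le j))

lemma integrable_q (D : LindebergScheme p s C m b B Y a K G H q)
    (h : IsAdmissible p Y μ) (j : ℕ) : Integrable (q j) μ :=
  Integrable.of_bound ((D.q_meas j).mono (past_le h.measurable j) le_rfl).aestronglyMeasurable b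
    (Filter.Eventually.of_forall (D.q_le j))

lemma abs_a_rpow_sub_one_le (D : LindebergScheme p s C m b B Y a K G H q) (hp : 2 < p) (i : ℕ) :
    |a i| ^ (p - 1) ≤ m ^ (p - 2) * |a i| := by
  have : |a i| ^ (p - 1) = |a i| ^ (p - 2) * |a i| := by
    rw [show p - 1 = (p - 2) + 1 by ring, Real.rpow_add_one' (abs_nonneg _) (by linarith)]
  rw [this]
  exact mul_le_mul_of_nonneg_right (D.rpow_a_le hp i) (abs_nonneg _)

lemma abs_a_rpow_le (D : LindebergScheme p s C m b B Y a K G H q) (hp : 2 < p) (i : ℕ) :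
    |a i| ^ p ≤ m ^ (p - 2) * a i ^ 2 := by
  have : |a i| ^ p = |a i| ^ (p - 2) * a i ^ 2 := by
    rw [← sq_abs, ← Real.rpow_natCast, ← Real.rpow_add_of_nonneg (abs_nonneg _) (by linarith)
      (by norm_num)]
    congr 1; norm_num
  rw [this]
  exact mul_le_mul_of_nonneg_right (D.rpow_a_le hp i) (sq_nonneg _)

/-- The first-order term, expanded along the past. -/
lemma abs_integral_H_mul_sub_le (D : LindebergScheme p s C m b B Y a K G H q)
    (h : IsAdmissible p Y μ) (i : ℕ) :
    |∫ ω, H i ω * Y (i + 1) ω ∂μ -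
        ∑ j ∈ Finset.range i, a j * ∫ ω, q j ω * (Y (j + 1) ω * Y (i + 1) ω) ∂μ| ≤
      ∑ j ∈ Finset.range i, |a j| * K j * (C * m ^ (p - 2) * momentConst p Y μ *
        (lam p Y μ (i - j) + normL p (μ[Y (i - j : ℕ) | past Y 0]) μ)) := by
  have h2 := h.two_lt
  -- The telescoping starts from zero, as `H 0` is constant and `Y` is centered.
  have htel : ∫ ω, H i ω * Y (i + 1) ω ∂μ =
      ∑ j ∈ Finset.range i,
        (∫ ω, H (j + 1) ω * Y (i + 1) ω ∂μ - ∫ ω, H j ω * Y (i + 1) ω ∂μ) := by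
    rw [Finset.sum_range_sub (fun j => ∫ ω, H j ω * Y (i + 1) ω ∂μ)]
    obtain ⟨c, hc⟩ := D.H_zero
    simp only [hc]
    rw [integral_const_mul, h.centered]; simp
  rw [htel, ← Finset.sum_sub_distrib]
  refine (Finset.abs_sum_le_sum_abs _ _).trans (Finset.sum_le_sum fun j hj => ?_)
  have hji := Finset.mem_range.1 hj
  have e : ∫ ω, H (j + 1) ω * Y (i + 1) ω ∂μ - ∫ ω, H j ω * Y (i + 1) ω ∂μ -
      a j * ∫ ω, q j ω * (Y (j + 1) ω * Y (i + 1) ω) ∂μ =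
      ∫ ω, (H (j + 1) ω - H j ω - a j * Y (j + 1) ω * q j ω) * Y (i + 1) ω ∂μ := by
    rw [← integral_const_mul, ← integral_sub (D.integrable_Y_mul_H h _ _)
      (D.integrable_Y_mul_H h _ _), ← integral_sub]
    · congr 1; ext ω; ring
    · exact (D.integrable_Y_mul_H h _ _).sub (D.integrable_Y_mul_H h _ _)
    · exact (D.integrable_q_mul_YY h _ _ _).const_mul _
  rw [e]
  have hmeas : Measurable[past Y ((j : ℤ) + 1)]
      fun ω => H (j + 1) ω - H j ω - a j * Y (j + 1) ω * q j ω := by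
    have m1 : Measurable[past Y ((j : ℤ) + 1)] (H j) :=
      (D.H_meas j).mono (past_mono Y (by omega)) le_rfl
    have m2 : Measurable[past Y ((j : ℤ) + 1)] (q j) :=
      (D.q_meas j).mono (past_mono Y (by omega)) le_rfl
    have m3 := D.H_meas (j + 1)
    have m4 : Measurable[past Y ((j : ℤ) + 1)] (Y (j + 1)) := measurable_past Y le_rfl
    exact (m3.sub m1).sub ((m4.const_mul (a j)).mul m2)
  have hwt : ∀ ω, |H (j + 1) ω - H j ω - a j * Y (j + 1) ω * q j ω| ≤
      C * K j * (m ^ (p - 2) * |a j|) * (1 + |Y (j + 1) ω| ^ (p - 1)) := fun ω => by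
    refine (D.H_step j ω).trans (mul_le_mul_of_nonneg_right ?_ (by positivity))
    exact mul_le_mul_of_nonneg_left (D.abs_a_rpow_sub_one_le h2 j)
      (mul_nonneg D.C_nonneg (D.K_nonneg j))
  have h3 := h.abs_integral_mul_le_of_far ((j : ℤ) + 1) (i - j) hmeas hwt
  have e1 : (j : ℤ) + 1 + ((i - j : ℕ) : ℤ) = i + 1 := by omega
  rw [e1] at h3
  exact h3.trans_eq (by ring)

/-- The remainder of one step. -/
lemma abs_integral_step_le (D : LindebergScheme p s C m b B Y a K G H q)
    (h : IsAdmissible p Y μ) (i : ℕ) :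
    |∫ ω, G (i + 1) ω ∂μ - ∫ ω, G i ω ∂μ - a i * ∫ ω, H i ω * Y (i + 1) ω ∂μ -
        a i ^ 2 / 2 * (∫ ω, q i ω * (Y (i + 1) ω * Y (i + 1) ω) ∂μ - s * ∫ ω, q i ω ∂μ)| ≤
      a i ^ 2 * K i * (C * m ^ (p - 2) * (1 + ∫ ω, |Y 0 ω| ^ p ∂μ)) := by
  have h2 := h.two_lt
  have hG : ∀ i, Integrable (G i) μ := fun i =>
    Integrable.of_bound (D.G_meas i).aestronglyMeasurable B (Filter.Eventually.of_forall (D.G_le i))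
  have i1 := (D.integrable_Y_mul_H h (i + 1) i).const_mul (a i)
  have i2 : Integrable (fun ω => a i ^ 2 / 2 * (q i ω * (Y (i + 1) ω * Y (i + 1) ω) - s * q i ω)) μ :=
    ((D.integrable_q_mul_YY h (i + 1) (i + 1) i).sub
      ((D.integrable_q h i).const_mul s)).const_mul (a i ^ 2 / 2)
  have i3 : Integrable (fun ω => G (i + 1) ω - G i ω) μ := (hG _).sub (hG _)
  have i4 : Integrable (fun ω => G (i + 1) ω - G i ω - a i * (H i ω * Y (i + 1) ω)) μ := i3.sub i1
  have e : ∫ ω, G (i + 1) ω ∂μ - ∫ ω, G i ω ∂μ - a i * ∫ ω, H i ω * Y (i + 1) ω ∂μ -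
        a i ^ 2 / 2 * (∫ ω, q i ω * (Y (i + 1) ω * Y (i + 1) ω) ∂μ - s * ∫ ω, q i ω ∂μ) =
      ∫ ω, (G (i + 1) ω - G i ω - a i * Y (i + 1) ω * H i ω
      - a i ^ 2 * (Y (i + 1) ω ^ 2 - s) / 2 * q i ω) ∂μ := by
    rw [← integral_const_mul s, ← integral_sub (D.integrable_q_mul_YY h _ _ _)
      ((D.integrable_q h i).const_mul s), ← integral_const_mul, ← integral_const_mul,
      ← integral_sub (hG _) (hG _), ← integral_sub i3 i1, ← integral_sub i4 i2]
    congr 1; ext ω; ring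
  have hpint : Integrable (fun ω => |Y (i + 1) ω| ^ p) μ := by
    have := (h.memLp (i + 1)).integrable_norm_rpow'
    rwa [ENNReal.toReal_ofReal (by linarith)] at this
  rw [e]
  refine abs_integral_le_integral_abs.trans ?_
  calc _ ≤ ∫ ω, C * K i * |a i| ^ p * (1 + |Y (i + 1) ω| ^ p) ∂μ :=
        integral_mono_of_nonneg (Filter.Eventually.of_forall fun _ => abs_nonneg _)
          (((integrable_const _).add hpint).const_mul _)
          (Filter.Eventually.of_forall fun ω => D.G_step i ω)
    _ = C * K i * |a i| ^ p * (1 + ∫ ω, |Y 0 ω| ^ p ∂μ) := by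
        rw [integral_const_mul, integral_add (integrable_const _) hpint, h.integral_rpow_shift]
        simp
    _ ≤ C * K i * (m ^ (p - 2) * a i ^ 2) * (1 + ∫ ω, |Y 0 ω| ^ p ∂μ) := by
        have : 0 ≤ ∫ ω, |Y 0 ω| ^ p ∂μ := integral_nonneg fun ω => by positivity
        refine mul_le_mul_of_nonneg_right ?_ (by linarith)
        exact mul_le_mul_of_nonneg_left (D.abs_a_rpow_le h2 i)
          (mul_nonneg D.C_nonneg (D.K_nonneg i))
    _ = _ := by ring

/-- The slow variation of `E q_i`, required by the diagonal approximation of the quadratic form. -/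
lemma abs_integral_q_sub_le (D : LindebergScheme p s C m b B Y a K G H q)
    (h : IsAdmissible p Y μ) (i : ℕ) :
    |∫ ω, q (i + 1) ω ∂μ - ∫ ω, q i ω ∂μ| ≤
      C * m ^ (p - 2) * (2 + ∫ ω, |Y 0 ω| ^ p ∂μ) * K i := by
  have h2 := h.two_lt
  have hpint : Integrable (fun ω => |Y (i + 1) ω| ^ p) μ := by
    have := (h.memLp (i + 1)).integrable_norm_rpow'
    rwa [ENNReal.toReal_ofReal (by linarith)] at this
  rw [← integral_sub (D.integrable_q h _) (D.integrable_q h _)]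
  refine abs_integral_le_integral_abs.trans ?_
  calc _ ≤ ∫ ω, C * K i * m ^ (p - 2) * (2 + |Y (i + 1) ω| ^ p) ∂μ := by
        refine integral_mono_of_nonneg (Filter.Eventually.of_forall fun _ => abs_nonneg _)
          (((integrable_const _).add hpint).const_mul _) (Filter.Eventually.of_forall fun ω => ?_)
        have h3 := rpow_abs_le_one_add (by linarith : 0 ≤ p - 2) (by linarith : p - 2 ≤ p)
          (Y (i + 1) ω)
        have hCK := mul_nonneg D.C_nonneg (D.K_nonneg i)
        refine (D.q_step i ω).trans (mul_le_mul
          (mul_le_mul_of_nonneg_left (D.rpow_a_le h2 i) hCK) (by linarith) (by positivity) ?_)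
        exact mul_nonneg hCK (Real.rpow_nonneg D.m_nonneg _)
    _ = C * K i * m ^ (p - 2) * (2 + ∫ ω, |Y 0 ω| ^ p ∂μ) := by
        rw [integral_const_mul, integral_add (integrable_const _) hpint, h.integral_rpow_shift]
        simp
    _ = _ := by ring

end LindebergScheme

end LinStat

/-! ### The total error of the Lindeberg replacement -/

namespace LinStat

variable {Ω : Type*} [mΩ : MeasurableSpace Ω]

lemma Lam_nonneg (p : ℝ) (Y : ℤ → Ω → ℝ) (μ : Measure Ω) (n : ℕ) : 0 ≤ Lam p Y μ n :=
  Finset.sum_nonneg fun k _ => mul_nonneg (Nat.cast_nonneg k) (IsAdmissible.lam_nonneg k)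

lemma sum_lam_le_Lam (p : ℝ) (Y : ℤ → Ω → ℝ) (μ : Measure Ω) (n : ℕ) :
    ∑ k ∈ Finset.Icc 1 n, lam p Y μ k ≤ Lam p Y μ n := by
  refine Finset.sum_le_sum fun k hk => ?_
  have h1 : (1 : ℝ) ≤ k := by exact_mod_cast (Finset.mem_Icc.1 hk).1
  have := IsAdmissible.lam_nonneg (p := p) (Y := Y) (μ := μ) k
  nlinarith

lemma sum_normL_le_condSum (p : ℝ) (Y : ℤ → Ω → ℝ) (μ : Measure Ω) (n : ℕ) :
    ∑ k ∈ Finset.Icc 1 n, normL p (μ[Y k | past Y 0]) μ ≤ condSum p Y μ n := by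
  refine Finset.sum_le_sum_of_subset_of_nonneg (fun k hk => ?_) fun k _ _ => normL_nonneg _ _ _
  simp at hk ⊢; omega

namespace LindebergScheme

variable {p s C m b B : ℝ} {Y : ℤ → Ω → ℝ} {a K : ℕ → ℝ} {G H q : ℕ → Ω → ℝ} {μ : Measure Ω}
  [IsProbabilityMeasure μ]

lemma abs_integral_q_YY_sub_le (D : LindebergScheme p s C m b B Y a K G H q)
    (h : IsAdmissible p Y μ) {i j n : ℕ} (hji : j ≤ i) (hjn : j ≤ n) :
    |∫ ω, q j ω * (Y (j + 1) ω * Y (i + 1) ω) ∂μ -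
        autocov Y μ ((i - j : ℕ) : ℤ) * ∫ ω, q j ω ∂μ| ≤
      K j * (2 * C * m ^ (p - 2) * momentConst p Y μ *
        ∑ u ∈ Finset.Icc 1 n, lam p Y μ (max u (i - j))) := by
  refine le_trans (le_of_eq ?_) (D.abs_integral_q_mul_le' h hji hjn)
  rw [← integral_const_mul, ← integral_sub (D.integrable_q_mul_YY h _ _ _)
    ((D.integrable_q h j).const_mul _)]
  congr 2; ext ω; ring

/-- The total error of the Lindeberg replacement. -/
theorem abs_integral_G_sub_le (D : LindebergScheme p s C m b B Y a K G H q)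
    (h : IsAdmissible p Y μ) (n : ℕ) (haz : ∀ l, n ≤ l → a l = 0) (hb : 0 ≤ b)
    (hγ : Summable fun k : ℕ => (k : ℝ) ^ 2 * |autocov Y μ k|)
    (hs : s = autocov Y μ 0 + 2 * ∑' k : ℕ, autocov Y μ (k + 1 : ℕ)) :
    |∫ ω, G n ω ∂μ - ∫ ω, G 0 ω ∂μ| ≤
      (∑ i ∈ Finset.range n, a i ^ 2 * K i) * (C * m ^ (p - 2) * (1 + ∫ ω, |Y 0 ω| ^ p ∂μ) +
        C * m ^ (p - 2) * momentConst p Y μ * (6 * Lam p Y μ n + eta p Y μ n)) +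
      (∑' k : ℕ, (k : ℝ) ^ 2 * |autocov Y μ k|) *
        (C * m ^ (p - 2) * (2 + ∫ ω, |Y 0 ω| ^ p ∂μ) * (∑ j ∈ Finset.range n, a j ^ 2 * K j) +
          b * m ^ 2 + b * ∑ j ∈ Finset.range n, (a (j + 1) - a j) ^ 2) := by
  obtain ⟨Q, hQ⟩ : ∃ Q : ℕ → ℝ, ∀ j, Q j = ∫ ω, q j ω ∂μ := ⟨_, fun _ => rfl⟩
  obtain ⟨E, hE⟩ : ∃ E, E = C * m ^ (p - 2) * momentConst p Y μ := ⟨_, rfl⟩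
  obtain ⟨R, hR⟩ : ∃ R, R = C * m ^ (p - 2) * (1 + ∫ ω, |Y 0 ω| ^ p ∂μ) := ⟨_, rfl⟩
  obtain ⟨A, hA⟩ : ∃ A, A = ∑ i ∈ Finset.range n, a i ^ 2 * K i := ⟨_, rfl⟩
  have hMp : 0 ≤ ∫ ω, |Y 0 ω| ^ p ∂μ := integral_nonneg fun ω => by positivity
  have hD0 : 0 ≤ momentConst p Y μ := zero_le_one.trans IsAdmissible.one_le_momentConst
  have hCm : 0 ≤ C * m ^ (p - 2) := mul_nonneg D.C_nonneg (Real.rpow_nonneg D.m_nonneg _)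
  have hE0 : 0 ≤ E := by rw [hE]; exact mul_nonneg hCm hD0
  have hA0 : 0 ≤ A := by
    rw [hA]; exact Finset.sum_nonneg fun i _ => mul_nonneg (sq_nonneg _) (D.K_nonneg i)
  have hlam : ∀ k, 0 ≤ lam p Y μ k := fun k => IsAdmissible.lam_nonneg k
  have hL0 := Lam_nonneg p Y μ n
  have hQb : ∀ j, j < n → |Q j| ≤ b := fun j _ => by
    rw [hQ]
    have := norm_integral_le_of_norm_le_const (μ := μ) (f := q j) (C := b) (Filter.Eventually.of_forall (D.q_le j))
    simpa using this
  have hdQ : ∀ j, j + 1 < n → |Q (j + 1) - Q j| ≤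
      C * m ^ (p - 2) * (2 + ∫ ω, |Y 0 ω| ^ p ∂μ) * K j := fun j _ => by
    rw [hQ, hQ]; exact D.abs_integral_q_sub_le h j
  have hmain := abs_quadratic_sub_le (γ := fun k => autocov Y μ k) haz D.a_le D.K_mono D.K_nonneg
    hQb hb (mul_nonneg hCm (by linarith)) hdQ hγ
  -- the three error terms
  obtain ⟨x₂, hx₂⟩ : ∃ x : ℕ → ℝ, ∀ k, x k = E * (lam p Y μ k + normL p (μ[Y k | past Y 0]) μ) :=
    ⟨_, fun _ => rfl⟩
  obtain ⟨x₃, hx₃⟩ : ∃ x : ℕ → ℝ, ∀ k, x k = 2 * E * ∑ u ∈ Finset.Icc 1 n, lam p Y μ (max u k) :=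
    ⟨_, fun _ => rfl⟩
  have hx₂0 : ∀ k, 0 ≤ x₂ k := fun k => by
    rw [hx₂]; exact mul_nonneg hE0 (add_nonneg (hlam k) (normL_nonneg _ _ _))
  have hx₃0 : ∀ k, 0 ≤ x₃ k := fun k => by
    rw [hx₃]; exact mul_nonneg (by linarith) (Finset.sum_nonneg fun u _ => hlam _)
  have e1 : ∀ i, |∫ ω, G (i + 1) ω ∂μ - ∫ ω, G i ω ∂μ - a i * ∫ ω, H i ω * Y (i + 1) ω ∂μ -
        a i ^ 2 / 2 * (∫ ω, q i ω * (Y (i + 1) ω * Y (i + 1) ω) ∂μ - s * Q i)| ≤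
      a i ^ 2 * K i * R := fun i => by rw [hQ, hR]; exact D.abs_integral_step_le h i
  have e2 : ∀ i, |a i * (∫ ω, H i ω * Y (i + 1) ω ∂μ) -
        ∑ j ∈ Finset.range i, a i * a j * ∫ ω, q j ω * (Y (j + 1) ω * Y (i + 1) ω) ∂μ| ≤
      ∑ j ∈ Finset.range i, |a i| * |a j| * K j * x₂ (i - j) := fun i => by
    have := mul_le_mul_of_nonneg_left (D.abs_integral_H_mul_sub_le h i) (abs_nonneg (a i))
    rw [← abs_mul, mul_sub, Finset.mul_sum, Finset.mul_sum] at this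
    simp only [← mul_assoc] at this ⊢
    refine this.trans_eq (Finset.sum_congr rfl fun j _ => ?_)
    rw [hx₂, hE]; ring
  have e3 : ∀ i j, j ≤ i → j ≤ n → |∫ ω, q j ω * (Y (j + 1) ω * Y (i + 1) ω) ∂μ -
      autocov Y μ ((i - j : ℕ) : ℤ) * Q j| ≤ K j * x₃ (i - j) := fun i j hji hjn => by
    rw [hQ, hx₃, hE]
    refine (D.abs_integral_q_YY_sub_le h hji hjn).trans_eq (by ring)
  -- algebraic decomposition of the total
  have htel : ∫ ω, G n ω ∂μ - ∫ ω, G 0 ω ∂μ =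
      ∑ i ∈ Finset.range n, (∫ ω, G (i + 1) ω ∂μ - ∫ ω, G i ω ∂μ) :=
    (Finset.sum_range_sub (fun i => ∫ ω, G i ω ∂μ) n).symm
  -- Five errors: Taylor remainder, unwinding of the first derivative, decorrelation off the
  -- diagonal, decorrelation on it, and diagonal approximation of the quadratic form. No main term
  -- is left, by the value of `s`.
  have hdec : ∫ ω, G n ω ∂μ - ∫ ω, G 0 ω ∂μ =
      ∑ i ∈ Finset.range n, (∫ ω, G (i + 1) ω ∂μ - ∫ ω, G i ω ∂μ -
        a i * ∫ ω, H i ω * Y (i + 1) ω ∂μ -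
        a i ^ 2 / 2 * (∫ ω, q i ω * (Y (i + 1) ω * Y (i + 1) ω) ∂μ - s * Q i)) +
      ∑ i ∈ Finset.range n, (a i * (∫ ω, H i ω * Y (i + 1) ω ∂μ) -
        ∑ j ∈ Finset.range i, a i * a j * ∫ ω, q j ω * (Y (j + 1) ω * Y (i + 1) ω) ∂μ) +
      ∑ i ∈ Finset.range n, ∑ j ∈ Finset.range i, a i * a j *
        (∫ ω, q j ω * (Y (j + 1) ω * Y (i + 1) ω) ∂μ - autocov Y μ ((i - j : ℕ) : ℤ) * Q j) +
      ∑ i ∈ Finset.range n, a i ^ 2 / 2 *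
        (∫ ω, q i ω * (Y (i + 1) ω * Y (i + 1) ω) ∂μ - autocov Y μ ((i - i : ℕ) : ℤ) * Q i) +
      (∑ i ∈ Finset.range n, ∑ j ∈ Finset.range i,
          a i * a j * autocov Y μ ((i - j : ℕ) : ℤ) * Q j -
        (∑' k : ℕ, autocov Y μ (k + 1 : ℕ)) * ∑ i ∈ Finset.range n, a i ^ 2 * Q i) := by
    rw [htel, Finset.mul_sum]
    simp only [← Finset.sum_add_distrib, ← Finset.sum_sub_distrib]
    refine Finset.sum_congr rfl fun i _ => ?_
    have : ∀ j, a i * a j * (∫ ω, q j ω * (Y (j + 1) ω * Y (i + 1) ω) ∂μ -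
        autocov Y μ ((i - j : ℕ) : ℤ) * Q j) =
        a i * a j * ∫ ω, q j ω * (Y (j + 1) ω * Y (i + 1) ω) ∂μ -
        a i * a j * autocov Y μ ((i - j : ℕ) : ℤ) * Q j := fun j => by ring
    simp only [this, Finset.sum_sub_distrib, Nat.sub_self, Nat.cast_zero]
    rw [hs]; ring
  have b1 : |∑ i ∈ Finset.range n, (∫ ω, G (i + 1) ω ∂μ - ∫ ω, G i ω ∂μ -
        a i * ∫ ω, H i ω * Y (i + 1) ω ∂μ -
        a i ^ 2 / 2 * (∫ ω, q i ω * (Y (i + 1) ω * Y (i + 1) ω) ∂μ - s * Q i))| ≤ A * R := by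
    rw [hA, Finset.sum_mul]
    exact (Finset.abs_sum_le_sum_abs _ _).trans (Finset.sum_le_sum fun i _ => e1 i)
  have b2 : |∑ i ∈ Finset.range n, (a i * (∫ ω, H i ω * Y (i + 1) ω ∂μ) -
        ∑ j ∈ Finset.range i, a i * a j * ∫ ω, q j ω * (Y (j + 1) ω * Y (i + 1) ω) ∂μ)| ≤
      A * (E * (Lam p Y μ n + eta p Y μ n)) := by
    refine (Finset.abs_sum_le_sum_abs _ _).trans ((Finset.sum_le_sum fun i _ => e2 i).trans ?_)
    refine (sum_pairs_le D.K_mono hx₂0 n D.K_nonneg).trans ?_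
    rw [← hA]
    refine mul_le_mul_of_nonneg_left ?_ hA0
    simp only [hx₂]
    rw [← Finset.mul_sum, Finset.sum_add_distrib]
    exact mul_le_mul_of_nonneg_left (add_le_add (sum_lam_le_Lam p Y μ n)
      (sum_normL_le_condSum p Y μ n)) hE0
  have b3 : |∑ i ∈ Finset.range n, ∑ j ∈ Finset.range i, a i * a j *
        (∫ ω, q j ω * (Y (j + 1) ω * Y (i + 1) ω) ∂μ - autocov Y μ ((i - j : ℕ) : ℤ) * Q j)| ≤
      A * (2 * E * (2 * Lam p Y μ n)) := by
    have h1 : |∑ i ∈ Finset.range n, ∑ j ∈ Finset.range i, a i * a j *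
        (∫ ω, q j ω * (Y (j + 1) ω * Y (i + 1) ω) ∂μ - autocov Y μ ((i - j : ℕ) : ℤ) * Q j)| ≤
        ∑ i ∈ Finset.range n, ∑ j ∈ Finset.range i, |a i| * |a j| * K j * x₃ (i - j) := by
      refine (Finset.abs_sum_le_sum_abs _ _).trans (Finset.sum_le_sum fun i hi => ?_)
      refine (Finset.abs_sum_le_sum_abs _ _).trans (Finset.sum_le_sum fun j hj => ?_)
      have hi' := Finset.mem_range.1 hi
      have hj' := Finset.mem_range.1 hj
      rw [abs_mul, abs_mul, mul_assoc (|a i| * |a j|)]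
      exact mul_le_mul_of_nonneg_left (e3 i j hj'.le (by omega)) (by positivity)
    refine h1.trans ((sum_pairs_le D.K_mono hx₃0 n D.K_nonneg).trans ?_)
    rw [← hA]
    refine mul_le_mul_of_nonneg_left ?_ hA0
    simp only [hx₃]
    rw [← Finset.mul_sum]
    exact mul_le_mul_of_nonneg_left (sum_sum_max_le hlam n) (by linarith)
  have b4 : |∑ i ∈ Finset.range n, a i ^ 2 / 2 *
        (∫ ω, q i ω * (Y (i + 1) ω * Y (i + 1) ω) ∂μ - autocov Y μ ((i - i : ℕ) : ℤ) * Q i)| ≤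
      A * (E * Lam p Y μ n) := by
    rw [hA, Finset.sum_mul]
    refine (Finset.abs_sum_le_sum_abs _ _).trans (Finset.sum_le_sum fun i hi => ?_)
    have h1 := e3 i i le_rfl (Finset.mem_range.1 hi).le
    have h2 : x₃ (i - i) ≤ 2 * E * Lam p Y μ n := by
      rw [hx₃]
      refine mul_le_mul_of_nonneg_left ?_ (by linarith)
      simpa using sum_lam_le_Lam p Y μ n
    rw [abs_mul, abs_of_nonneg (by positivity : 0 ≤ a i ^ 2 / 2)]
    calc _ ≤ a i ^ 2 / 2 * (K i * (2 * E * Lam p Y μ n)) :=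
          mul_le_mul_of_nonneg_left (h1.trans (mul_le_mul_of_nonneg_left h2 (D.K_nonneg i)))
            (by positivity)
      _ = _ := by ring
  -- The coefficient `6` of `Lam` is `1 + 4 + 1`, from `b2`, `b3` and `b4`.
  rw [hdec]
  refine (abs_add_le _ _).trans (add_le_add ((abs_add_le _ _).trans ((add_le_add ((abs_add_le _ _).trans
    (add_le_add ((abs_add_le _ _).trans (add_le_add b1 b2)) b3)) b4).trans_eq ?_)) hmain)
  rw [← hA, ← hR, ← hE]
  ring

end LindebergScheme

end LinStat

namespace LinStat

/-! ### Bounds for the sums of weights -/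

lemma sum_mul_le_of_step {a φ K : ℕ → ℝ} {c : ℝ} (n : ℕ)
    (h : ∀ i, i < n → a i ^ 2 * K i ≤ c * (φ i - φ (i + 1))) :
    ∑ i ∈ Finset.range n, a i ^ 2 * K i ≤ c * (φ 0 - φ n) := by
  rw [← Finset.sum_range_sub' φ n, Finset.mul_sum]
  exact Finset.sum_le_sum fun i hi => h i (Finset.mem_range.1 hi)

/-- The variance left after step `i`, including that of the initial smoothing. -/
noncomputable def restVar (s t : ℝ) (a : ℕ → ℝ) (n i : ℕ) : ℝ :=
  t ^ 2 + s * ∑ l ∈ Finset.Ico i n, a l ^ 2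

lemma restVar_eq_add {s t : ℝ} {a : ℕ → ℝ} {n : ℕ} (haz : ∀ l, n ≤ l → a l = 0) (i : ℕ) :
    restVar s t a n i = restVar s t a n (i + 1) + s * a i ^ 2 := by
  unfold restVar
  rcases lt_or_ge i n with h | h
  · rw [Finset.sum_eq_sum_Ico_succ_bot h]; ring
  · rw [haz i h, Finset.Ico_eq_empty_of_le h, Finset.Ico_eq_empty_of_le (by omega)]; simp

lemma sq_le_restVar {s : ℝ} (hs : 0 ≤ s) (t : ℝ) (a : ℕ → ℝ) (n i : ℕ) :
    t ^ 2 ≤ restVar s t a n i := by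
  unfold restVar
  have : 0 ≤ ∑ l ∈ Finset.Ico i n, a l ^ 2 := Finset.sum_nonneg fun _ _ => sq_nonneg _
  nlinarith

lemma restVar_self (s t : ℝ) (a : ℕ → ℝ) (n : ℕ) : restVar s t a n n = t ^ 2 := by
  simp [restVar]

lemma restVar_zero (s t : ℝ) (a : ℕ → ℝ) (n : ℕ) :
    restVar s t a n 0 = t ^ 2 + s * ∑ l ∈ Finset.range n, a l ^ 2 := by
  rw [restVar, Finset.range_eq_Ico]

/-- Concavity of `x ↦ x^{1-e}` bounds its increment below by the slope at `u + d`; since `d ≤ s u`,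
passing from `u + d` back to `u` costs only `(1 + s)^e`. -/
lemma rpow_neg_mul_le {u d s e : ℝ} (hu : 0 < u) (hd : 0 ≤ d) (hds : d ≤ s * u) (hs : 0 ≤ s)
    (he : 0 ≤ e) (he1 : e < 1) :
    d * u ^ (-e) ≤ (1 + s) ^ e / (1 - e) * ((u + d) ^ (1 - e) - u ^ (1 - e)) := by
  have hud : 0 < u + d := by linarith
  have hk : 0 < 1 - e := by linarith
  have h1 : (u / (u + d)) ^ (1 - e) ≤ 1 + (1 - e) * (u / (u + d) - 1) := by
    have := rpow_one_add_le_one_add_mul_self (s := u / (u + d) - 1) (p := 1 - e)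
      (by have : 0 < u / (u + d) := by positivity
          linarith) hk.le (by linarith)
    simpa using this
  have h2 : u ^ (1 - e) = (u / (u + d)) ^ (1 - e) * (u + d) ^ (1 - e) := by
    rw [← Real.mul_rpow (by positivity) hud.le, div_mul_cancel₀ _ hud.ne']
  have h3 : (u + d) ^ (1 - e) = (u + d) * (u + d) ^ (-e) := by
    rw [sub_eq_add_neg, Real.rpow_add hud, Real.rpow_one]
  have hp : 0 ≤ (u + d) ^ (1 - e) := by positivity
  have h4 : (1 - e) * (d * (u + d) ^ (-e)) ≤ (u + d) ^ (1 - e) - u ^ (1 - e) := by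
    have := mul_le_mul_of_nonneg_right h1 hp
    rw [← h2] at this
    have e1 : (1 + (1 - e) * (u / (u + d) - 1)) * (u + d) ^ (1 - e) =
        (u + d) ^ (1 - e) - (1 - e) * (d * (u + d) ^ (-e)) := by
      rw [h3]; field_simp; ring
    linarith
  have h5 : u ^ (-e) ≤ (1 + s) ^ e * (u + d) ^ (-e) := by
    have h6 : ((1 + s) * u) ^ (-e) ≤ (u + d) ^ (-e) :=
      Real.rpow_le_rpow_of_nonpos hud (by linarith) (by linarith)
    have h7 : u ^ (-e) = (1 + s) ^ e * ((1 + s) * u) ^ (-e) := by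
      rw [Real.mul_rpow (by linarith) hu.le, ← mul_assoc, ← Real.rpow_add (by linarith)]
      simp
    rw [h7]
    exact mul_le_mul_of_nonneg_left h6 (by positivity)
  calc d * u ^ (-e) ≤ d * ((1 + s) ^ e * (u + d) ^ (-e)) := mul_le_mul_of_nonneg_left h5 hd
    _ = (1 + s) ^ e / (1 - e) * ((1 - e) * (d * (u + d) ^ (-e))) := by field_simp
    _ ≤ _ := mul_le_mul_of_nonneg_left h4 (by positivity)

/-- The case `e = 1` of the same comparison, the logarithm replacing the power. -/
lemma div_le_log_sub {u d s : ℝ} (hu : 0 < u) (hd : 0 ≤ d) (hds : d ≤ s * u) (hs : 0 ≤ s) :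
    d * u⁻¹ ≤ (1 + s) * (Real.log (u + d) - Real.log u) := by
  have hud : 0 < u + d := by linarith
  rw [← Real.log_div hud.ne' hu.ne']
  have h1 := Real.one_sub_inv_le_log_of_pos (div_pos hud hu)
  rw [inv_div] at h1
  have h2 : d * u⁻¹ ≤ (1 + s) * (1 - u / (u + d)) := by
    have e : 1 - u / (u + d) = d / (u + d) := by field_simp; ring
    rw [e, ← div_eq_mul_inv, ← mul_div_assoc, div_le_div_iff₀ hu hud]
    nlinarith
  exact h2.trans (mul_le_mul_of_nonneg_left h1 (by linarith))

/-- The sum is compared with the telescoping increments of `v^{(3-p)/2}`. The smoothing ensures `s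
a_i² ≤ s t² ≤ s v_{i+1}`, so no step is large compared with the variance left. -/
lemma sum_weights_le_rpow {p s : ℝ} (hp : 2 < p) (hp3 : p < 3) (hs : 0 < s) :
    ∃ c : ℝ, 0 < c ∧ ∀ (n : ℕ) (a : ℕ → ℝ) (t : ℝ), 0 < t → (∀ l, n ≤ l → a l = 0) →
      (∀ i, |a i| ≤ t) →
      ∑ i ∈ Finset.range n, a i ^ 2 * restVar s t a n (i + 1) ^ (-((p - 1) / 2)) ≤
        c * (∑ i ∈ Finset.range n, a i ^ 2) ^ ((3 - p) / 2) := by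
  have hk : (0 : ℝ) < 1 - (p - 1) / 2 := by linarith
  have hc0 : 0 < (1 + s) ^ ((p - 1) / 2) / (1 - (p - 1) / 2) := by positivity
  refine ⟨(1 + s) ^ ((p - 1) / 2) / (1 - (p - 1) / 2) / s * s ^ ((3 - p) / 2), by positivity,
    fun n a t ht haz hat => ?_⟩
  have hstep : ∀ i, i < n → a i ^ 2 * restVar s t a n (i + 1) ^ (-((p - 1) / 2)) ≤
      (1 + s) ^ ((p - 1) / 2) / (1 - (p - 1) / 2) / s *
        (restVar s t a n i ^ (1 - (p - 1) / 2) - restVar s t a n (i + 1) ^ (1 - (p - 1) / 2)) := by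
    intro i _
    have hv := sq_le_restVar hs.le t a n (i + 1)
    have ha2 : a i ^ 2 ≤ t ^ 2 := by
      rw [← sq_abs]; exact pow_le_pow_left₀ (abs_nonneg _) (hat i) 2
    have h1 := rpow_neg_mul_le (u := restVar s t a n (i + 1)) (d := s * a i ^ 2) (s := s)
      (e := (p - 1) / 2) ((pow_pos ht 2).trans_le hv) (by positivity)
      (mul_le_mul_of_nonneg_left (ha2.trans hv) hs.le) hs.le (by linarith) (by linarith)
    rw [← restVar_eq_add haz] at h1
    rw [div_mul_eq_mul_div, le_div_iff₀ hs]
    linarith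
  refine (sum_mul_le_of_step (φ := fun i => restVar s t a n i ^ (1 - (p - 1) / 2)) n
    hstep).trans ?_
  rw [mul_assoc]
  refine mul_le_mul_of_nonneg_left ?_ (by positivity)
  have hS : 0 ≤ ∑ l ∈ Finset.range n, a l ^ 2 := Finset.sum_nonneg fun _ _ => sq_nonneg _
  rw [restVar_self, restVar_zero, ← Real.mul_rpow hs.le hS, show (3 - p) / 2 = 1 - (p - 1) / 2 by ring]
  -- Subadditivity of the power removes `t` from the bound.
  have := Real.rpow_add_le_add_rpow (sq_nonneg t) (mul_nonneg hs.le hS) hk.le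
    (by linarith : 1 - (p - 1) / 2 ≤ 1)
  linarith

/-- The telescoped quantity is `log ((t² + s S) / t²)`, with `S` the sum of squares. The condition
`2 m² ≤ S` keeps `log (S / m²)` at least `log 2`, so that the additive constant `log (1 + s)` can be
absorbed. -/
lemma sum_weights_le_log {s : ℝ} (hs : 0 < s) :
    ∃ c : ℝ, 0 < c ∧ ∀ (n : ℕ) (a : ℕ → ℝ) (m t : ℝ), 0 < m → m ≤ t → (∀ l, n ≤ l → a l = 0) →
      (∀ i, |a i| ≤ m) → 2 * m ^ 2 ≤ ∑ i ∈ Finset.range n, a i ^ 2 →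
      ∑ i ∈ Finset.range n, a i ^ 2 * restVar s t a n (i + 1) ^ (-((3 - 1 : ℝ) / 2)) ≤
        c * Real.log (m⁻¹ * √(∑ i ∈ Finset.range n, a i ^ 2)) := by
  have hl2 : 0 < Real.log 2 := Real.log_pos (by norm_num)
  have hl1 : 0 ≤ Real.log (1 + s) := Real.log_nonneg (by linarith)
  refine ⟨(1 + s) / s * (2 * (Real.log (1 + s) / Real.log 2 + 1)), by positivity,
    fun n a m t hm hmt haz ham hS => ?_⟩
  have ht : 0 < t := hm.trans_le hmt
  have hpos : ∀ i, 0 < restVar s t a n i := fun i =>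
    (pow_pos ht 2).trans_le (sq_le_restVar hs.le t a n i)
  have hstep : ∀ i, i < n → a i ^ 2 * restVar s t a n (i + 1) ^ (-((3 - 1 : ℝ) / 2)) ≤
      (1 + s) / s * (Real.log (restVar s t a n i) - Real.log (restVar s t a n (i + 1))) := by
    intro i _
    have hv := sq_le_restVar hs.le t a n (i + 1)
    have ha2 : a i ^ 2 ≤ t ^ 2 := by
      rw [← sq_abs]; exact pow_le_pow_left₀ (abs_nonneg _) ((ham i).trans hmt) 2
    have h1 := div_le_log_sub (u := restVar s t a n (i + 1)) (d := s * a i ^ 2) (s := s)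
      (hpos _) (by positivity) (mul_le_mul_of_nonneg_left (ha2.trans hv) hs.le) hs.le
    rw [← restVar_eq_add haz] at h1
    rw [div_mul_eq_mul_div, le_div_iff₀ hs, show -((3 - 1 : ℝ) / 2) = -1 by norm_num,
      Real.rpow_neg_one]
    linarith
  refine (sum_mul_le_of_step (φ := fun i => Real.log (restVar s t a n i)) n hstep).trans ?_
  rw [mul_assoc]
  refine mul_le_mul_of_nonneg_left ?_ (by positivity)
  have hv0 := hpos 0
  rw [restVar_zero] at hv0
  rw [restVar_self, restVar_zero, ← Real.log_div hv0.ne' (pow_pos ht 2).ne']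
  obtain ⟨S, hSd⟩ : ∃ S, S = ∑ l ∈ Finset.range n, a l ^ 2 := ⟨_, rfl⟩
  rw [← hSd] at hS ⊢
  have hS0 : 0 < S := lt_of_lt_of_le (by positivity) hS
  have hm2 : 0 < m ^ 2 := by positivity
  have hx : 2 ≤ S / m ^ 2 := by rwa [le_div_iff₀ hm2]
  have h1 : (t ^ 2 + s * S) / t ^ 2 ≤ (1 + s) * (S / m ^ 2) := by
    have h2 : S / t ^ 2 ≤ S / m ^ 2 :=
      div_le_div_of_nonneg_left hS0.le hm2 (pow_le_pow_left₀ hm.le hmt 2)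
    have h3 : (t ^ 2 + s * S) / t ^ 2 = 1 + s * (S / t ^ 2) := by field_simp
    rw [h3]
    nlinarith
  have h4 : Real.log (m⁻¹ * √S) = Real.log (S / m ^ 2) / 2 := by
    rw [← Real.log_sqrt (by positivity), Real.sqrt_div hS0.le, Real.sqrt_sq hm.le]
    congr 1; field_simp
  rw [h4]
  have h5 : Real.log 2 ≤ Real.log (S / m ^ 2) := Real.log_le_log (by norm_num) hx
  calc Real.log ((t ^ 2 + s * S) / t ^ 2) ≤ Real.log ((1 + s) * (S / m ^ 2)) :=
        Real.log_le_log (div_pos (by positivity) (by positivity)) h1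
    _ = Real.log (1 + s) / Real.log 2 * Real.log 2 + Real.log (S / m ^ 2) := by
        rw [Real.log_mul (by positivity) (by positivity), div_mul_cancel₀ _ hl2.ne']
    _ ≤ Real.log (1 + s) / Real.log 2 * Real.log (S / m ^ 2) + Real.log (S / m ^ 2) :=
        add_le_add (mul_le_mul_of_nonneg_left h5 (by positivity)) le_rfl
    _ = _ := by ring

/-! ### Comparison of smoothings and of normal laws -/

lemma integral_abs_le_sqrt {Ω : Type*} [MeasurableSpace Ω] {μ : Measure Ω} [IsProbabilityMeasure μ]
    {X : Ω → ℝ} (hX : MemLp X 2 μ) : ∫ ω, |X ω| ∂μ ≤ √(∫ ω, X ω ^ 2 ∂μ) := by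
  have h2 : MemLp X (ENNReal.ofReal 2) μ := by simpa using hX
  have h := integral_abs_le_normL (by norm_num : (1 : ℝ) ≤ 2) h2
  rw [normL_eq_integral two_pos h2, ← Real.sqrt_eq_rpow] at h
  simpa using h

lemma integral_abs_gaussianReal_le (v : ℝ≥0) : ∫ z, |z| ∂gaussianReal 0 v ≤ √v := by
  have := integral_abs_le_sqrt (μ := gaussianReal 0 v) (X := fun z => z) (memLp_id_gaussianReal 2)
  rwa [integral_sq_gaussianReal] at this

lemma BddContraction.abs_gaussSmooth_sub_le {f : ℝ → ℝ} (hf : BddContraction f) (v : ℝ≥0) (x : ℝ) :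
    |gaussSmooth v f x - f x| ≤ √v := by
  have hi : Integrable (fun z => f (x + z)) (gaussianReal 0 v) := hf.integrable_comp _ (by fun_prop)
  have e : gaussSmooth v f x - f x = ∫ z, (f (x + z) - f x) ∂gaussianReal 0 v := by
    rw [integral_sub hi (integrable_const _)]; simp [gaussSmooth]
  rw [e]
  refine abs_integral_le_integral_abs.trans (le_trans ?_ (integral_abs_gaussianReal_le v))
  refine integral_mono_of_nonneg (Filter.Eventually.of_forall fun _ => abs_nonneg _)
    ((memLp_id_gaussianReal 1).integrable (by simp)).abs (Filter.Eventually.of_forall fun z => ?_)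
  simpa using hf.1 (x + z) x

lemma BddContraction.gaussSmooth {f : ℝ → ℝ} (hf : BddContraction f) (v : ℝ≥0) :
    BddContraction (gaussSmooth v f) := by
  have hi : ∀ x, Integrable (fun z => f (x + z)) (gaussianReal 0 v) := fun x =>
    hf.integrable_comp _ (by fun_prop)
  constructor
  · intro x y
    have e : LinStat.gaussSmooth v f x - LinStat.gaussSmooth v f y =
        ∫ z, (f (x + z) - f (y + z)) ∂gaussianReal 0 v := by
      rw [integral_sub (hi x) (hi y)]; rfl
    rw [e]
    have := norm_integral_le_of_norm_le_const (μ := gaussianReal 0 v)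
      (f := fun z => f (x + z) - f (y + z)) (C := |x - y|)
      (Filter.Eventually.of_forall fun z => by simpa using hf.1 (x + z) (y + z))
    simpa using this
  · obtain ⟨M, hM⟩ := hf.2
    exact ⟨M, abs_gaussSmooth_le hM v⟩

/-- The normal law of larger variance is the other one convolved with a normal law carrying the
difference of the variances. -/
lemma BddContraction.abs_integral_gaussianReal_sub_le {f : ℝ → ℝ} (hf : BddContraction f)
    (v w : ℝ≥0) :
    |∫ z, f z ∂gaussianReal 0 v - ∫ z, f z ∂gaussianReal 0 w| ≤ √|(v : ℝ) - w| := by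
  wlog h : v ≤ w generalizing v w
  · rw [abs_sub_comm, abs_sub_comm (v : ℝ)]; exact this w v (le_of_not_ge h)
  obtain ⟨d, rfl⟩ := exists_add_of_le h
  have e : ∀ u, ∫ z, f z ∂gaussianReal 0 u = LinStat.gaussSmooth u f 0 := fun u => by
    simp [LinStat.gaussSmooth]
  rw [e, e, gaussSmooth_add hf, abs_sub_comm]
  have := (hf.gaussSmooth v).abs_gaussSmooth_sub_le d 0
  simpa using this

end LinStat

namespace LinStat

variable {Ω : Type*}

/-! ### The Lindeberg scheme of a linear statistic -/

/-- `∑_{l < i} a_l Y_{l+1}`. -/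
def partialSum (a : ℕ → ℝ) (Y : ℤ → Ω → ℝ) (i : ℕ) (ω : Ω) : ℝ :=
  ∑ l ∈ Finset.range i, a l * Y (l + 1) ω

lemma partialSum_succ (a : ℕ → ℝ) (Y : ℤ → Ω → ℝ) (i : ℕ) (ω : Ω) :
    partialSum a Y (i + 1) ω = partialSum a Y i ω + a i * Y (i + 1) ω :=
  Finset.sum_range_succ _ _

lemma measurable_partialSum_past (a : ℕ → ℝ) (Y : ℤ → Ω → ℝ) (i : ℕ) :
    Measurable[past Y i] (partialSum a Y i) := by
  let _ : MeasurableSpace Ω := past Y i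
  refine Finset.measurable_fun_sum _ fun l hl => Measurable.const_mul ?_ _
  exact measurable_past Y (by have := Finset.mem_range.1 hl; omega)

/-- Step `i` lowers the smoothing variance by `s a_i²`, the variance given to its Gaussian
substitute. The weight `K_i` involves `restVar` at `i + 1`, the variance still available after the
step. -/
theorem exists_lindebergScheme {p s : ℝ} (hp : 2 < p) (hp3 : p ≤ 3) (hs : 0 ≤ s) :
    ∃ C : ℝ, 0 < C ∧ ∀ {Ω : Type*} [MeasurableSpace Ω] (Y : ℤ → Ω → ℝ) (_ : ∀ i, Measurable (Y i))
      (f : ℝ → ℝ) (_ : BddContraction f) (n : ℕ) (a : ℕ → ℝ) (m t : ℝ), 0 < t →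
      (∀ l, n ≤ l → a l = 0) → (∀ i, |a i| ≤ m) →
      ∃ B, LindebergScheme p s C m (C / t) B Y a
        (fun i => restVar s t a n (i + 1) ^ (-((p - 1) / 2)))
        (fun i ω => gaussSmooth (restVar s t a n i).toNNReal f (partialSum a Y i ω))
        (fun i ω => gaussSmoothD1 (restVar s t a n i).toNNReal f (partialSum a Y i ω))
        (fun i ω => gaussSmoothD2 (restVar s t a n i).toNNReal f (partialSum a Y i ω)) := by
  obtain ⟨C, hC, hstep⟩ := exists_lindeberg_step (r := p - 2) (σ := √s) (by linarith) (by linarith)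
    (Real.sqrt_nonneg _)
  refine ⟨C, hC, fun {Ω} _ Y hmeas f hf n a m t ht haz ham => ?_⟩
  obtain ⟨M, hM⟩ := hf.2
  have hpos : ∀ i, 0 < restVar s t a n i := fun i =>
    (pow_pos ht 2).trans_le (sq_le_restVar hs t a n i)
  have hvpos : ∀ i, 0 < (restVar s t a n i).toNNReal := fun i => Real.toNNReal_pos.2 (hpos i)
  have hvc : ∀ i, ((restVar s t a n i).toNNReal : ℝ) = restVar s t a n i := fun i =>
    Real.coe_toNNReal _ (hpos i).le
  have hanti : ∀ i, restVar s t a n (i + 1) ≤ restVar s t a n i := fun i => by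
    rw [restVar_eq_add haz i]
    have := mul_nonneg hs (sq_nonneg (a i))
    linarith
  have hSm : ∀ i, Measurable (partialSum a Y i) := fun i =>
    (measurable_partialSum_past a Y i).mono (past_le hmeas i) le_rfl
  have key : ∀ i ω, _ := fun (i : ℕ) (ω : Ω) =>
    (hstep f hf (restVar s t a n (i + 1)).toNNReal (hvpos _)).2.2 (s * a i ^ 2).toNNReal (a i)
      (Y (i + 1) ω) (partialSum a Y i ω) (by
        rw [Real.coe_toNNReal _ (mul_nonneg hs (sq_nonneg _)), Real.sq_sqrt hs])
  have hadd : ∀ i, (restVar s t a n (i + 1)).toNNReal + (s * a i ^ 2).toNNReal =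
      (restVar s t a n i).toNNReal := fun i => by
    rw [restVar_eq_add haz i, Real.toNNReal_add (hpos _).le (mul_nonneg hs (sq_nonneg _))]
  simp only [hadd, hvc, ← partialSum_succ, show 1 + (p - 2) = p - 1 by ring,
    neg_div, show 2 + (p - 2) = p by ring, Real.sq_sqrt hs] at key
  refine ⟨max M C, ?_⟩
  constructor
  · exact hC.le
  · exact ham
  · refine monotone_nat_of_le_succ fun i => ?_
    exact Real.rpow_le_rpow_of_nonpos (hpos _) (hanti (i + 1)) (by linarith)
  · exact fun i => Real.rpow_nonneg (hpos _).le _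
  · exact fun i => ((hf.gaussSmooth _).continuous.measurable).comp (hSm i)
  · exact fun i ω => (abs_gaussSmooth_le hM _ _).trans (le_max_left _ _)
  · exact fun i => (measurable_deriv _).comp (measurable_partialSum_past a Y i)
  · exact fun i ω => ((hstep f hf _ (hvpos i)).1 _).trans (le_max_right _ _)
  · exact fun i => (measurable_deriv _).comp (measurable_partialSum_past a Y i)
  · intro i ω
    -- The initial smoothing keeps every variance at least `t²`, whence `b = C / t`.
    refine ((hstep f hf _ (hvpos i)).2.1 _).trans ?_
    refine div_le_div_of_nonneg_left hC.le ht (Real.le_sqrt_of_sq_le ?_)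
    rw [hvc]; exact sq_le_restVar hs t a n i
  · exact ⟨gaussSmoothD1 (restVar s t a n 0).toNNReal f 0, fun ω => by simp [partialSum]⟩
  · exact ⟨gaussSmoothD2 (restVar s t a n 0).toNNReal f 0, fun ω => by simp [partialSum]⟩
  · exact fun i ω => (key i ω).1
  · exact fun i ω => (key i ω).2.1
  · exact fun i ω => (key i ω).2.2

/-! ### The variance of a linear statistic -/

lemma eta_nonneg [MeasurableSpace Ω] (p : ℝ) (Y : ℤ → Ω → ℝ) (μ : Measure Ω) (n : ℕ) :
    0 ≤ eta p Y μ n :=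
  Finset.sum_nonneg (s := Finset.range (n + 1))
    (f := fun i : ℕ => normL p (μ[Y i | past Y 0]) μ) fun _ _ => normL_nonneg _ _ _

namespace IsAdmissible

variable [mΩ : MeasurableSpace Ω] {p : ℝ} {Y : ℤ → Ω → ℝ} {μ : Measure Ω} [IsProbabilityMeasure μ]

lemma memLp_two (h : IsAdmissible p Y μ) (i : ℤ) : MemLp (Y i) 2 μ := by
  refine (h.memLp i).mono_exponent ?_
  have := ENNReal.ofReal_le_ofReal h.two_lt.le
  simpa using this

lemma memLp_partialSum (h : IsAdmissible p Y μ) (a : ℕ → ℝ) (n : ℕ) :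
    MemLp (partialSum a Y n) 2 μ :=
  memLp_finsetSum _ fun l _ => (h.memLp_two (l + 1)).const_mul (a l)

lemma integral_partialSum (h : IsAdmissible p Y μ) (a : ℕ → ℝ) (n : ℕ) :
    ∫ ω, partialSum a Y n ω ∂μ = 0 := by
  unfold partialSum
  rw [integral_finsetSum _ fun l _ => (h.integrable _).const_mul _]
  refine Finset.sum_eq_zero fun l _ => ?_
  rw [integral_const_mul, h.centered, mul_zero]

lemma integral_sq_partialSum (h : IsAdmissible p Y μ) (a : ℕ → ℝ) (n : ℕ) :
    ∫ ω, partialSum a Y n ω ^ 2 ∂μ = autocov Y μ 0 * ∑ i ∈ Finset.range n, a i ^ 2 +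
      2 * ∑ i ∈ Finset.range n, ∑ j ∈ Finset.range i,
        a i * a j * autocov Y μ ((i - j : ℕ) : ℤ) := by
  induction n with
  | zero => simp [partialSum]
  | succ n ih =>
    have i1 := (h.memLp_partialSum a n).integrable_sq
    have i2 := ((h.integrable_mul (n + 1) (n + 1)).const_mul (a n ^ 2))
    have i3 : Integrable (fun ω => ∑ j ∈ Finset.range n, 2 * (a n * a j) *
        (Y (j + 1) ω * Y (n + 1) ω)) μ :=
      integrable_finsetSum _ fun j _ => (h.integrable_mul _ _).const_mul _
    have e : ∀ ω, partialSum a Y (n + 1) ω ^ 2 = partialSum a Y n ω ^ 2 +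
        a n ^ 2 * (Y (n + 1) ω * Y (n + 1) ω) +
        ∑ j ∈ Finset.range n, 2 * (a n * a j) * (Y (j + 1) ω * Y (n + 1) ω) := by
      intro ω
      have : ∑ j ∈ Finset.range n, 2 * (a n * a j) * (Y (j + 1) ω * Y (n + 1) ω) =
          2 * a n * Y (n + 1) ω * partialSum a Y n ω := by
        rw [partialSum, Finset.mul_sum]
        exact Finset.sum_congr rfl fun j _ => by ring
      rw [this, partialSum_succ]; ring
    have i12 : Integrable (fun ω => partialSum a Y n ω ^ 2 +
        a n ^ 2 * (Y (n + 1) ω * Y (n + 1) ω)) μ := i1.add i2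
    simp only [e]
    rw [integral_add i12 i3, integral_add i1 i2, ih, integral_const_mul,
      integral_finsetSum _ fun j _ => (h.integrable_mul _ _).const_mul _,
      Finset.sum_range_succ, Finset.sum_range_succ]
    have h0 : ∫ ω, Y (n + 1) ω * Y (n + 1) ω ∂μ = autocov Y μ 0 := by
      rw [← h.autocov_shift (n + 1) 0, add_zero]
    have h1 : ∑ j ∈ Finset.range n, ∫ ω, 2 * (a n * a j) * (Y (j + 1) ω * Y (n + 1) ω) ∂μ =
        2 * ∑ j ∈ Finset.range n, a n * a j * autocov Y μ ((n - j : ℕ) : ℤ) := by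
      rw [Finset.mul_sum]
      refine Finset.sum_congr rfl fun j hj => ?_
      have hj' := Finset.mem_range.1 hj
      rw [integral_const_mul, ← h.autocov_shift (j + 1)]
      have : (j : ℤ) + 1 + ((n - j : ℕ) : ℤ) = n + 1 := by omega
      rw [this]; ring
    rw [h0, h1]; ring

lemma variance_partialSum (h : IsAdmissible p Y μ) (a : ℕ → ℝ) (n : ℕ) :
    variance (partialSum a Y n) μ = ∫ ω, partialSum a Y n ω ^ 2 ∂μ := by
  rw [variance_of_integral_eq_zero (h.memLp_partialSum a n).1.aemeasurable
    (h.integral_partialSum a n)]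

/-- The diagonal approximation with `Q = 1`: no variation of `Q`, hence zero weights `K`. -/
lemma abs_variance_sub_le (h : IsAdmissible p Y μ) {s : ℝ}
    (hγ : Summable fun k : ℕ => (k : ℝ) ^ 2 * |autocov Y μ k|)
    (hs : s = autocov Y μ 0 + 2 * ∑' k : ℕ, autocov Y μ (k + 1 : ℕ)) {n : ℕ} {a : ℕ → ℝ} {m : ℝ}
    (haz : ∀ l, n ≤ l → a l = 0) (ham : ∀ i, |a i| ≤ m) :
    |variance (partialSum a Y n) μ - s * ∑ i ∈ Finset.range n, a i ^ 2| ≤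
      2 * (∑' k : ℕ, (k : ℝ) ^ 2 * |autocov Y μ k|) *
        (m ^ 2 + ∑ j ∈ Finset.range n, (a (j + 1) - a j) ^ 2) := by
  have h1 := abs_quadratic_sub_le (K := fun _ => 0) (Q := fun _ => 1) (b := 1) (w := 0)
    (γ := fun k => autocov Y μ k) haz ham monotone_const (fun _ => le_rfl) (by simp) zero_le_one
    le_rfl (by simp) hγ
  rw [h.variance_partialSum, h.integral_sq_partialSum, hs]
  simp only [mul_one, zero_mul, zero_add, one_mul] at h1
  have e : ∀ x y g S : ℝ, g * S + 2 * x - (g + 2 * y) * S = 2 * (x - y * S) := by intros; ring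
  rw [e, abs_mul, abs_two, mul_assoc]
  exact mul_le_mul_of_nonneg_left h1 zero_le_two

lemma variance_le (h : IsAdmissible p Y μ)
    (hγ : Summable fun k : ℕ => (k : ℝ) ^ 2 * |autocov Y μ k|) (n : ℕ) (a : ℕ → ℝ) :
    variance (partialSum a Y n) μ ≤
      (|autocov Y μ 0| + 2 * ∑' k : ℕ, (k : ℝ) ^ 2 * |autocov Y μ k|) *
        ∑ i ∈ Finset.range n, a i ^ 2 := by
  have h1 := sum_pairs_le (a := a) (K := fun _ => 1) (x := fun k => |autocov Y μ k|) monotone_const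
    (fun _ => abs_nonneg _) n (fun _ => zero_le_one)
  have h2 : ∑ k ∈ Finset.Icc 1 n, |autocov Y μ k| ≤ ∑' k : ℕ, (k : ℝ) ^ 2 * |autocov Y μ k| := by
    refine le_trans (Finset.sum_le_sum fun k hk => ?_)
      (hγ.sum_le_tsum (Finset.Icc 1 n) fun k _ => by positivity)
    have : (1 : ℝ) ≤ k := by exact_mod_cast (Finset.mem_Icc.1 hk).1
    have : (1 : ℝ) ≤ (k : ℝ) ^ 2 := by nlinarith
    nlinarith [abs_nonneg (autocov Y μ k)]
  have hS : 0 ≤ ∑ i ∈ Finset.range n, a i ^ 2 := Finset.sum_nonneg fun _ _ => sq_nonneg _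
  have h3 : ∑ i ∈ Finset.range n, ∑ j ∈ Finset.range i, a i * a j * autocov Y μ ((i - j : ℕ) : ℤ) ≤
      ∑ i ∈ Finset.range n, ∑ j ∈ Finset.range i,
        |a i| * |a j| * 1 * |autocov Y μ ((i - j : ℕ) : ℤ)| := by
    refine Finset.sum_le_sum fun i _ => Finset.sum_le_sum fun j _ => ?_
    rw [mul_one, ← abs_mul, ← abs_mul]
    exact le_abs_self _
  simp only [mul_one] at h1 h3
  rw [h.variance_partialSum, h.integral_sq_partialSum]
  have h4 := mul_le_mul_of_nonneg_left h2 hS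
  have h5 := mul_le_mul_of_nonneg_right (le_abs_self (autocov Y μ 0)) hS
  linarith

/-! ### Bounds for the Wasserstein distance -/

lemma isProbabilityMeasure_map_partialSum (h : IsAdmissible p Y μ) (a : ℕ → ℝ) (n : ℕ) :
    IsProbabilityMeasure (μ.map (partialSum a Y n)) :=
  Measure.isProbabilityMeasure_map (h.memLp_partialSum a n).1.aemeasurable

/-- Both laws are compared with the Dirac mass at `0`. This crude bound serves when all coefficients
vanish, and for `p = 3` when the logarithm may be too small. -/
theorem wasserstein_le_sqrt (h : IsAdmissible p Y μ)
    (hγ : Summable fun k : ℕ => (k : ℝ) ^ 2 * |autocov Y μ k|) (n : ℕ) (a : ℕ → ℝ) :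
    wasserstein 1 (μ.map (partialSum a Y n))
        (gaussianReal 0 (variance (partialSum a Y n) μ).toNNReal) ≤
      ENNReal.ofReal (2 * √(|autocov Y μ 0| + 2 * ∑' k : ℕ, (k : ℝ) ^ 2 * |autocov Y μ k|) *
        √(∑ i ∈ Finset.range n, a i ^ 2)) := by
  have := h.isProbabilityMeasure_map_partialSum a n
  have hV := h.variance_le hγ n a
  have hSm := (h.memLp_partialSum a n).1.aemeasurable
  refine wasserstein_one_le_of_forall_lipschitz _ _ _ fun f hf1 hf2 => ?_
  have hf : BddContraction f := ⟨hf1, hf2⟩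
  have h0 : 0 ≤ |autocov Y μ 0| + 2 * ∑' k : ℕ, (k : ℝ) ^ 2 * |autocov Y μ k| := by
    have : 0 ≤ ∑' k : ℕ, (k : ℝ) ^ 2 * |autocov Y μ k| := tsum_nonneg fun k => by positivity
    positivity
  rw [mul_assoc, ← Real.sqrt_mul h0]
  have hle := Real.sqrt_le_sqrt hV
  rw [integral_map hSm hf.continuous.measurable.aestronglyMeasurable]
  have b1 : ∫ ω, f (partialSum a Y n ω) ∂μ - f 0 ≤ √(variance (partialSum a Y n) μ) := by
    have e : ∫ ω, f (partialSum a Y n ω) ∂μ - f 0 = ∫ ω, (f (partialSum a Y n ω) - f 0) ∂μ := by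
      rw [integral_sub (hf.integrable_comp μ hSm) (integrable_const _)]; simp
    rw [e, h.variance_partialSum]
    refine le_trans ?_ (integral_abs_le_sqrt (h.memLp_partialSum a n))
    refine integral_mono ((hf.integrable_comp μ hSm).sub (integrable_const _))
      ((h.memLp_partialSum a n).integrable (by norm_num)).abs fun ω => ?_
    have := hf1 (partialSum a Y n ω) 0
    rw [sub_zero] at this
    exact (le_abs_self _).trans this
  have b2 : f 0 - ∫ z, f z ∂gaussianReal 0 (variance (partialSum a Y n) μ).toNNReal ≤
      √(variance (partialSum a Y n) μ) := by
    have := hf.abs_gaussSmooth_sub_le (variance (partialSum a Y n) μ).toNNReal 0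
    rw [Real.coe_toNNReal _ (variance_nonneg _ _), abs_sub_comm] at this
    simpa [gaussSmooth] using (le_abs_self _).trans this
  linarith

/-- The smoothing scale `t = m + δ` balances the errors: it dominates all coefficients, and with
second derivatives of size `1 / t` the boundary and increment errors `(m² + ∑ (a_{j+1} - a_j)²) / t`
are again of order `t`. -/
theorem exists_wasserstein_le (h : IsAdmissible p Y μ) (hp3 : p ≤ 3)
    (hγ : Summable fun k : ℕ => (k : ℝ) ^ 2 * |autocov Y μ k|) {s : ℝ} (hs0 : 0 < s)
    (hs : s = autocov Y μ 0 + 2 * ∑' k : ℕ, autocov Y μ (k + 1 : ℕ)) :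
    ∃ c : ℝ, 0 < c ∧ ∀ (n : ℕ) (a : ℕ → ℝ) (m δ : ℝ), 0 < m → 0 ≤ δ → (∀ l, n ≤ l → a l = 0) →
      (∀ i, |a i| ≤ m) → ∑ j ∈ Finset.range n, (a (j + 1) - a j) ^ 2 ≤ δ ^ 2 + m ^ 2 →
      wasserstein 1 (μ.map (partialSum a Y n))
        (gaussianReal 0 (variance (partialSum a Y n) μ).toNNReal) ≤
      ENNReal.ofReal (c * (m + δ +
        (∑ i ∈ Finset.range n, a i ^ 2 * restVar s (m + δ) a n (i + 1) ^ (-((p - 1) / 2))) *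
          (m ^ (p - 2) * (1 + Lam p Y μ n + eta p Y μ n)))) := by
  obtain ⟨C, hC, hscheme⟩ := exists_lindebergScheme h.two_lt hp3 hs0.le
  obtain ⟨g, hg⟩ : ∃ g, g = ∑' k : ℕ, (k : ℝ) ^ 2 * |autocov Y μ k| := ⟨_, rfl⟩
  obtain ⟨M, hM⟩ : ∃ M, M = ∫ ω, |Y 0 ω| ^ p ∂μ := ⟨_, rfl⟩
  obtain ⟨D₀, hD₀⟩ : ∃ D₀, D₀ = momentConst p Y μ := ⟨_, rfl⟩
  have hg0 : 0 ≤ g := by rw [hg]; exact tsum_nonneg fun k => by positivity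
  have hM0 : 0 ≤ M := by rw [hM]; exact integral_nonneg fun ω => by positivity
  have hD0 : 0 ≤ D₀ := by rw [hD₀]; exact zero_le_one.trans one_le_momentConst
  -- In order: removal of the smoothing, comparison of the variances, boundary and increment errors
  -- (`b3`), then the three contributions to the weighted sum.
  refine ⟨1 + √(1 + 6 * g) + 3 * (g * C) + C * (1 + M) + 6 * (C * D₀) + g * (C * (2 + M)),
    by positivity, fun n a m δ hm hδ haz ham hΔ => ?_⟩
  have ht : 0 < m + δ := by linarith
  obtain ⟨t, htd⟩ : ∃ t, t = m + δ := ⟨_, rfl⟩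
  rw [← htd] at ht ⊢
  have hmt2 : m ^ 2 ≤ t ^ 2 := pow_le_pow_left₀ hm.le (by linarith) 2
  have hΔ2 : ∑ j ∈ Finset.range n, (a (j + 1) - a j) ^ 2 ≤ t ^ 2 := by
    refine hΔ.trans ?_
    rw [htd]; nlinarith [mul_nonneg hm.le hδ]
  have := h.isProbabilityMeasure_map_partialSum a n
  have hSm := (h.memLp_partialSum a n).1.aemeasurable
  refine wasserstein_one_le_of_forall_lipschitz _ _ _ fun f hf1 hf2 => ?_
  have hf : BddContraction f := ⟨hf1, hf2⟩
  rw [integral_map hSm hf.continuous.measurable.aestronglyMeasurable]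
  obtain ⟨B, D⟩ := hscheme Y h.measurable f hf n a m t ht haz ham
  have hmain := D.abs_integral_G_sub_le h n haz (by positivity) hγ hs
  obtain ⟨A, hA⟩ : ∃ A, A = ∑ i ∈ Finset.range n, a i ^ 2 *
    restVar s t a n (i + 1) ^ (-((p - 1) / 2)) := ⟨_, rfl⟩
  have hA0 : 0 ≤ A := by
    rw [hA]; exact Finset.sum_nonneg fun i _ => mul_nonneg (sq_nonneg _) (D.K_nonneg i)
  rw [← hA, ← hg, ← hM, ← hD₀] at hmain
  rw [← hA]
  -- removing the initial smoothing
  have hvn : ((restVar s t a n n).toNNReal : ℝ) = t ^ 2 := by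
    rw [restVar_self, Real.coe_toNNReal _ (sq_nonneg _)]
  have b1 : ∫ ω, f (partialSum a Y n ω) ∂μ -
      ∫ ω, gaussSmooth (restVar s t a n n).toNNReal f (partialSum a Y n ω) ∂μ ≤ t := by
    rw [← integral_sub (hf.integrable_comp μ hSm) ((hf.gaussSmooth _).integrable_comp μ hSm)]
    have h1 := norm_integral_le_of_norm_le_const (μ := μ) (f := fun ω => f (partialSum a Y n ω) -
      gaussSmooth (restVar s t a n n).toNNReal f (partialSum a Y n ω)) (C := t)
      (Filter.Eventually.of_forall fun ω => by
        have h2 := hf.abs_gaussSmooth_sub_le (restVar s t a n n).toNNReal (partialSum a Y n ω)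
        rw [hvn, Real.sqrt_sq ht.le, abs_sub_comm] at h2
        exact h2)
    refine (le_abs_self _).trans ?_
    simpa using h1
  -- comparison of the variances
  have hv0 : ((restVar s t a n 0).toNNReal : ℝ) = t ^ 2 + s * ∑ l ∈ Finset.range n, a l ^ 2 := by
    rw [Real.coe_toNNReal _ ((sq_nonneg t).trans (sq_le_restVar hs0.le t a n 0)), restVar_zero]
  have b2 : ∫ ω, gaussSmooth (restVar s t a n 0).toNNReal f (partialSum a Y 0 ω) ∂μ -
      ∫ z, f z ∂gaussianReal 0 (variance (partialSum a Y n) μ).toNNReal ≤ √(1 + 6 * g) * t := by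
    have e : ∫ ω, gaussSmooth (restVar s t a n 0).toNNReal f (partialSum a Y 0 ω) ∂μ =
        ∫ z, f z ∂gaussianReal 0 (restVar s t a n 0).toNNReal := by
      simp [partialSum, gaussSmooth]
    rw [e]
    refine (le_abs_self _).trans ((hf.abs_integral_gaussianReal_sub_le _ _).trans ?_)
    rw [hv0, Real.coe_toNNReal _ (variance_nonneg _ _)]
    have h1 := h.abs_variance_sub_le hγ hs haz ham
    rw [← hg] at h1
    have h2 : |t ^ 2 + s * ∑ l ∈ Finset.range n, a l ^ 2 - variance (partialSum a Y n) μ| ≤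
        (1 + 6 * g) * t ^ 2 := by
      have e2 : t ^ 2 + s * ∑ l ∈ Finset.range n, a l ^ 2 - variance (partialSum a Y n) μ =
          t ^ 2 - (variance (partialSum a Y n) μ - s * ∑ l ∈ Finset.range n, a l ^ 2) := by ring
      rw [e2]
      refine (abs_sub _ _).trans ?_
      rw [abs_of_nonneg (sq_nonneg t)]
      have h3 : 2 * g * (m ^ 2 + ∑ j ∈ Finset.range n, (a (j + 1) - a j) ^ 2) ≤
          2 * g * (t ^ 2 + t ^ 2) := mul_le_mul_of_nonneg_left (add_le_add hmt2 hΔ2) (by linarith)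
      nlinarith [mul_nonneg hg0 (sq_nonneg t)]
    refine (Real.sqrt_le_sqrt h2).trans_eq ?_
    rw [Real.sqrt_mul (by linarith), Real.sqrt_sq ht.le]
  have b3 : C / t * m ^ 2 + C / t * ∑ j ∈ Finset.range n, (a (j + 1) - a j) ^ 2 ≤ 3 * C * t := by
    calc _ ≤ C / t * t ^ 2 + C / t * t ^ 2 := by gcongr
      _ = 2 * (C * t) := by field_simp; ring
      _ ≤ 3 * C * t := by nlinarith [mul_pos hC ht]
  have b4 := (le_abs_self _).trans hmain
  have hL := Lam_nonneg p Y μ n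
  have hη := eta_nonneg p Y μ n
  have hmp : 0 ≤ m ^ (p - 2) := Real.rpow_nonneg hm.le _
  obtain ⟨P, hP⟩ : ∃ P, P = A * m ^ (p - 2) := ⟨_, rfl⟩
  have hP0 : 0 ≤ P := by rw [hP]; exact mul_nonneg hA0 hmp
  have b5 : A * (C * m ^ (p - 2) * (1 + M) +
      C * m ^ (p - 2) * D₀ * (6 * Lam p Y μ n + eta p Y μ n)) +
      g * (C * m ^ (p - 2) * (2 + M) * A + C / t * m ^ 2 +
        C / t * ∑ j ∈ Finset.range n, (a (j + 1) - a j) ^ 2) ≤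
      3 * (g * C) * t + (C * (1 + M) + 6 * (C * D₀) + g * (C * (2 + M))) *
        (P * (1 + Lam p Y μ n + eta p Y μ n)) := by
    have h1 := mul_le_mul_of_nonneg_left b3 hg0
    have h2 : A * (C * m ^ (p - 2) * (1 + M) +
        C * m ^ (p - 2) * D₀ * (6 * Lam p Y μ n + eta p Y μ n)) + g * (C * m ^ (p - 2) * (2 + M) * A)
        ≤ (C * (1 + M) + 6 * (C * D₀) + g * (C * (2 + M))) *
        (P * (1 + Lam p Y μ n + eta p Y μ n)) := by
      have e : A * (C * m ^ (p - 2) * (1 + M) +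
        C * m ^ (p - 2) * D₀ * (6 * Lam p Y μ n + eta p Y μ n)) + g * (C * m ^ (p - 2) * (2 + M) * A)
        = P * (C * (1 + M) * 1 + C * D₀ * (6 * Lam p Y μ n + eta p Y μ n) +
          g * (C * (2 + M)) * 1) := by rw [hP]; ring
      have e2 : (C * (1 + M) + 6 * (C * D₀) + g * (C * (2 + M))) *
        (P * (1 + Lam p Y μ n + eta p Y μ n)) = P * (C * (1 + M) * (1 + Lam p Y μ n + eta p Y μ n) +
          C * D₀ * (6 * (1 + Lam p Y μ n + eta p Y μ n)) +
          g * (C * (2 + M)) * (1 + Lam p Y μ n + eta p Y μ n)) := by ring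
      rw [e, e2]
      gcongr
      · linarith
      · linarith
      · linarith
    linarith
  have hR0 : 0 ≤ P * (1 + Lam p Y μ n + eta p Y μ n) := mul_nonneg hP0 (by linarith)
  have hc1 : 0 ≤ C * (1 + M) + 6 * (C * D₀) + g * (C * (2 + M)) := by positivity
  have hc2 : 0 ≤ 1 + √(1 + 6 * g) + 3 * (g * C) := by positivity
  rw [← mul_assoc A, ← hP]
  have h6 := mul_nonneg hc1 ht.le
  have h7 := mul_nonneg hc2 hR0
  have hfin := b4.trans b5
  linarith

end IsAdmissible

end LinStat

namespace LinStat

variable {Ω : Type*}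

/-! ### The spectral density at the origin and the size of the error terms -/

namespace IsAdmissible

variable [mΩ : MeasurableSpace Ω] {p : ℝ} {Y : ℤ → Ω → ℝ} {μ : Measure Ω}

lemma spectralDensity_zero (h : IsAdmissible p Y μ)
    (hγ : Summable fun k : ℕ => (k : ℝ) ^ 2 * |autocov Y μ k|) :
    spectralDensity Y μ 0 =
      1 / (2 * Real.pi) * (autocov Y μ 0 + 2 * ∑' k : ℕ, autocov Y μ (k + 1 : ℕ)) := by
  have h1 : Summable fun k : ℕ => autocov Y μ (k + 1 : ℕ) := by
    refine Summable.of_norm_bounded ((summable_nat_add_iff 1).2 hγ) fun k => ?_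
    rw [Real.norm_eq_abs]
    have : (1 : ℝ) ≤ ((k + 1 : ℕ) : ℝ) ^ 2 := 
      one_le_pow₀ (by push_cast; linarith [k.cast_nonneg (α := ℝ)])
    nlinarith [abs_nonneg (autocov Y μ (k + 1 : ℕ))]
  have h0 : Summable fun k : ℕ => autocov Y μ k := (summable_nat_add_iff 1).1 h1
  have e : ∀ k : ℕ, autocov Y μ (-((k : ℤ) + 1)) = autocov Y μ (k + 1 : ℕ) := fun k => by
    rw [h.autocov_neg]; push_cast; rfl
  have h2 : Summable fun k : ℕ => autocov Y μ (-((k : ℤ) + 1)) := by simpa only [e] using h1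
  have h3 := tsum_of_nat_of_neg_add_one h0 h2
  simp only [e] at h3
  rw [h0.tsum_eq_zero_add, Nat.cast_zero] at h3
  have h4 : (∑' k : ℤ, (autocov Y μ k : ℂ) * Complex.exp (Complex.I * (k : ℂ) * ((0 : ℝ) : ℂ))) =
      ((∑' k : ℤ, autocov Y μ k : ℝ) : ℂ) := by
    simp [Complex.ofReal_tsum]
  rw [spectralDensity, h4, Complex.ofReal_re, h3]
  ring

variable [IsProbabilityMeasure μ]

/-- If `Y_0` vanished almost surely, so would all covariances. This yields the lower bound `κ` on
`eta` and `condSum`. -/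
lemma normL_pos (h : IsAdmissible p Y μ) {q : ℝ} (hq : 0 < q) (hqp : q ≤ p)
    (hs : autocov Y μ 0 + 2 * ∑' k : ℕ, autocov Y μ (k + 1 : ℕ) ≠ 0) : 0 < normL q (Y 0) μ := by
  refine ENNReal.toReal_pos (fun h0 => hs ?_)
    ((h.memLp 0).mono_exponent (ENNReal.ofReal_le_ofReal hqp)).2.ne
  rw [eLpNorm_eq_zero_iff (h.memLp 0).1 (ENNReal.ofReal_pos.2 hq).ne'] at h0
  have h1 : ∀ k, autocov Y μ k = 0 := fun k => by
    refine integral_eq_zero_of_ae ?_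
    filter_upwards [h0] with ω hω
    simp [hω, h.centered]
  simp [h1]

lemma normL_le_condSum (h : IsAdmissible p Y μ) (q : ℝ) (n : ℕ) :
    normL q (Y 0) μ ≤ condSum q Y μ n := by
  have e : μ[Y (0 : ℕ) | past Y 0] = Y 0 :=
    condExp_of_stronglyMeasurable (past_le h.measurable 0)
      (measurable_past Y le_rfl).stronglyMeasurable (h.integrable 0)
  calc normL q (Y 0) μ = normL q (μ[Y (0 : ℕ) | past Y 0]) μ := by rw [e]
    _ ≤ _ := Finset.single_le_sum (f := fun i : ℕ => normL q (μ[Y i | past Y 0]) μ)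
      (fun i _ => normL_nonneg _ _ _) (Finset.mem_range.2 n.succ_pos)

end IsAdmissible

/-! ### From arrays to finitely supported sequences -/

/-- The `n`-th row of the array `α`, shifted by one and extended by zero. -/
def coefSeq (α : ℕ → ℕ → ℝ) (n l : ℕ) : ℝ := if l < n then α (l + 1) n else 0

lemma sum_Icc_one_eq_sum_range (f : ℕ → ℝ) (n : ℕ) :
    ∑ i ∈ Finset.Icc 1 n, f i = ∑ i ∈ Finset.range n, f (i + 1) := by
  rw [Finset.range_eq_Ico, Finset.sum_Ico_add' f 0 n 1]
  rfl

variable (α : ℕ → ℕ → ℝ) (n : ℕ)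

lemma coefSeq_of_le {l : ℕ} (h : n ≤ l) : coefSeq α n l = 0 := if_neg h.not_gt

lemma coefSeq_of_lt {l : ℕ} (h : l < n) : coefSeq α n l = α (l + 1) n := if_pos h

lemma maxCoef_nonneg : 0 ≤ maxCoef α n := NNReal.coe_nonneg _

lemma abs_coefSeq_le (l : ℕ) : |coefSeq α n l| ≤ maxCoef α n := by
  by_cases h : l < n
  · rw [coefSeq_of_lt α n h, ← Real.norm_eq_abs, ← coe_nnnorm, maxCoef, NNReal.coe_le_coe]
    exact Finset.le_sup (f := fun l => ‖α l n‖₊) (Finset.mem_Icc.2 ⟨by omega, by omega⟩)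
  · rw [coefSeq_of_le α n (not_lt.1 h), abs_zero]
    exact maxCoef_nonneg α n

lemma sumSq_eq : sumSq α n = ∑ i ∈ Finset.range n, coefSeq α n i ^ 2 := by
  rw [sumSq, sum_Icc_one_eq_sum_range]
  exact Finset.sum_congr rfl fun i hi => by rw [coefSeq_of_lt α n (Finset.mem_range.1 hi)]

lemma sumSq_nonneg : 0 ≤ sumSq α n := Finset.sum_nonneg fun _ _ => sq_nonneg _

lemma sq_maxCoef_le_sumSq : maxCoef α n ^ 2 ≤ sumSq α n := by
  rcases (Finset.Icc 1 n).eq_empty_or_nonempty with h | h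
  · simp [maxCoef, sumSq, h]
  · obtain ⟨l, hl, hl'⟩ := Finset.exists_mem_eq_sup _ h fun l => ‖α l n‖₊
    rw [maxCoef, hl', coe_nnnorm, Real.norm_eq_abs, sq_abs]
    exact Finset.single_le_sum (f := fun l => α l n ^ 2) (fun _ _ => sq_nonneg _) hl

lemma linStat_eq_partialSum (Y : ℤ → Ω → ℝ) :
    linStat α Y n = partialSum (coefSeq α n) Y n := by
  funext ω
  rw [linStat, partialSum, sum_Icc_one_eq_sum_range]
  refine Finset.sum_congr rfl fun i hi => ?_
  rw [coefSeq_of_lt α n (Finset.mem_range.1 hi)]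
  push_cast; rfl

/-- Extension by zero creates a jump of size at most `maxCoef` at the right end, where `α_{n+1,n}`
is arbitrary. The two terms with boundary values are dropped, being nonnegative. -/
lemma sum_sq_coefSeq_sub_le :
    ∑ j ∈ Finset.range n, (coefSeq α n (j + 1) - coefSeq α n j) ^ 2 ≤
      ∑ k ∈ Finset.Icc 1 (n + 1), (α k n - α (k - 1) n) ^ 2 + maxCoef α n ^ 2 := by
  rw [sum_Icc_one_eq_sum_range]
  cases n with
  | zero => simpa using add_nonneg (sq_nonneg (α 1 0 - α 0 0)) (sq_nonneg _)
  | succ n =>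
    rw [Finset.sum_range_succ]
    refine add_le_add ?_ ?_
    · rw [Finset.sum_range_succ', Finset.sum_range_succ]
      have : ∑ j ∈ Finset.range n, (coefSeq α (n + 1) (j + 1) - coefSeq α (n + 1) j) ^ 2 =
          ∑ k ∈ Finset.range n, (α (k + 1 + 1) (n + 1) - α (k + 1 + 1 - 1) (n + 1)) ^ 2 := by
        refine Finset.sum_congr rfl fun j hj => ?_
        have := Finset.mem_range.1 hj
        rw [coefSeq_of_lt _ _ (by omega), coefSeq_of_lt _ _ (by omega), Nat.add_sub_cancel]
      rw [this]
      nlinarith [sq_nonneg (α (n + 1 + 1) (n + 1) - α (n + 1 + 1 - 1) (n + 1)),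
        sq_nonneg (α (0 + 1) (n + 1) - α (0 + 1 - 1) (n + 1))]
    · rw [coefSeq_of_le _ _ le_rfl, zero_sub, neg_sq]
      exact sq_le_sq' (neg_le_of_abs_le (abs_coefSeq_le α _ n)) (le_of_abs_le (abs_coefSeq_le α _ n))

variable {α n}

lemma B_nonneg [MeasurableSpace Ω] (α : ℕ → ℕ → ℝ) (p : ℝ) (Y : ℤ → Ω → ℝ) (μ : Measure Ω) (n : ℕ) :
    0 ≤ B α p Y μ n := by
  have hm := maxCoef_nonneg α n
  have hη := eta_nonneg p Y μ n
  have hL := Lam_nonneg p Y μ n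
  have hS := sumSq_nonneg α n
  rw [B]
  split_ifs with hp
  · rcases hm.eq_or_lt with h0 | hpos
    · simp [← h0]
    · have : 1 ≤ (maxCoef α n)⁻¹ * √(sumSq α n) := by
        rw [← div_eq_inv_mul, one_le_div hpos]
        exact Real.le_sqrt_of_sq_le (sq_maxCoef_le_sumSq α n)
      have := Real.log_nonneg this
      positivity
  · positivity

/-! ### The rate of convergence -/

section Rate

variable [MeasurableSpace Ω] {p : ℝ} {Y : ℤ → Ω → ℝ} {μ : Measure Ω}

/-- The three error terms in the rate of convergence. -/
noncomputable def rate (α : ℕ → ℕ → ℝ) (p : ℝ) (Y : ℤ → Ω → ℝ) (μ : Measure Ω) (n : ℕ) : ℝ :=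
  maxCoef α n * condSum 2 Y μ n + B α p Y μ n +
    √(∑ k ∈ Finset.Icc 1 (n + 1), (α k n - α (k - 1) n) ^ 2)

/-- As `η_n ≥ κ`, both `1` and `η_n` are at most constant multiples of `η_n²`. -/
lemma one_add_Lam_add_eta_le {κ : ℝ} (hκ : 0 < κ) {n : ℕ} (hη : κ ≤ eta p Y μ n) :
    1 + Lam p Y μ n + eta p Y μ n ≤
      (1 + κ⁻¹ ^ 2 + κ⁻¹) * (Lam p Y μ n + eta p Y μ n ^ 2) := by
  have hL := Lam_nonneg p Y μ n
  have h1 : 1 ≤ κ⁻¹ * eta p Y μ n := by rwa [← div_eq_inv_mul, one_le_div hκ]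
  have hη0 := hκ.trans_le hη
  have hk : 0 < κ⁻¹ := inv_pos.2 hκ
  have h2 : 1 ≤ (κ⁻¹ * eta p Y μ n) ^ 2 := one_le_pow₀ h1
  have h3 : eta p Y μ n * 1 ≤ eta p Y μ n * (κ⁻¹ * eta p Y μ n) :=
    mul_le_mul_of_nonneg_left h1 hη0.le
  nlinarith [mul_nonneg (sq_nonneg κ⁻¹) hL, mul_nonneg hk.le hL, sq_nonneg (eta p Y μ n)]

/-- The Lindeberg bound is dominated by `rate`, given a bound for the weighted sum of squares. -/
lemma lindeberg_bound_le_rate {κ : ℝ} (hκ : 0 < κ) {c A R : ℝ} (hc : 0 < c) {n : ℕ} (hp : 2 < p)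
    (hη : κ ≤ eta p Y μ n) (hη2 : κ ≤ condSum 2 Y μ n) {m δ : ℝ} (hm : 0 < m)
    (hδ : 0 ≤ δ) (hR : 0 ≤ R) (hA : A ≤ c * R) :
    m + δ + A * (m ^ (p - 2) * (1 + Lam p Y μ n + eta p Y μ n)) ≤
      (1 + κ⁻¹ + c * (κ ^ (p - 2))⁻¹ * (1 + κ⁻¹ ^ 2 + κ⁻¹)) *
        (m * condSum 2 Y μ n +
          m ^ (p - 2) * eta p Y μ n ^ (p - 2) * (Lam p Y μ n + eta p Y μ n ^ 2) * R + δ) := by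
  have hL := Lam_nonneg p Y μ n
  have hη0 := hκ.trans_le hη
  have hk : 0 < κ⁻¹ := inv_pos.2 hκ
  have h1 : 1 ≤ (κ ^ (p - 2))⁻¹ * eta p Y μ n ^ (p - 2) := by
    rw [← div_eq_inv_mul, one_le_div (by positivity)]
    exact Real.rpow_le_rpow hκ.le hη (by linarith)
  have h2 : 1 ≤ κ⁻¹ * condSum 2 Y μ n := by rwa [← div_eq_inv_mul, one_le_div hκ]
  have h3 : m ≤ κ⁻¹ * (m * condSum 2 Y μ n) := by nlinarith
  have h4 := one_add_Lam_add_eta_le hκ hη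
  set T := m ^ (p - 2) * eta p Y μ n ^ (p - 2) * (Lam p Y μ n + eta p Y μ n ^ 2) * R with hT
  have hT0 : 0 ≤ T := by positivity
  have h5 : A * (m ^ (p - 2) * (1 + Lam p Y μ n + eta p Y μ n)) ≤
      c * (κ ^ (p - 2))⁻¹ * (1 + κ⁻¹ ^ 2 + κ⁻¹) * T := by
    calc A * (m ^ (p - 2) * (1 + Lam p Y μ n + eta p Y μ n))
        ≤ (c * R) * (m ^ (p - 2) *
          ((1 + κ⁻¹ ^ 2 + κ⁻¹) * (Lam p Y μ n + eta p Y μ n ^ 2))) := by gcongr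
      _ = (c * R) * (m ^ (p - 2) *
          ((1 + κ⁻¹ ^ 2 + κ⁻¹) * (Lam p Y μ n + eta p Y μ n ^ 2))) * 1 := (mul_one _).symm
      _ ≤ (c * R) * (m ^ (p - 2) * ((1 + κ⁻¹ ^ 2 + κ⁻¹) * (Lam p Y μ n + eta p Y μ n ^ 2))) *
          ((κ ^ (p - 2))⁻¹ * eta p Y μ n ^ (p - 2)) := by gcongr
      _ = _ := by rw [hT]; ring
  have h6 : 0 ≤ c * (κ ^ (p - 2))⁻¹ * (1 + κ⁻¹ ^ 2 + κ⁻¹) := by positivity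
  have h7 : 0 ≤ m * condSum 2 Y μ n := mul_nonneg hm.le (hκ.le.trans hη2)
  nlinarith [mul_nonneg h6 h7, mul_nonneg h6 hδ, mul_nonneg hk.le hT0, mul_nonneg hk.le hδ]

theorem IsAdmissible.exists_wasserstein_le_rate [IsProbabilityMeasure μ] (h : IsAdmissible p Y μ) (hp3 : p ≤ 3)
    (hγ : Summable fun k : ℕ => (k : ℝ) ^ 2 * |autocov Y μ k|)
    (hf : 0 < spectralDensity Y μ 0) (α : ℕ → ℕ → ℝ) :
    ∃ C : ℝ, 0 < C ∧ ∀ n, wasserstein 1 (μ.map (linStat α Y n)) (gaussianReal 0 (linVar α Y μ n)) ≤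
      ENNReal.ofReal (C * rate α p Y μ n) := by
  obtain ⟨s, hs⟩ : ∃ s, s = autocov Y μ 0 + 2 * ∑' k : ℕ, autocov Y μ (k + 1 : ℕ) := ⟨_, rfl⟩
  have hs0 : 0 < s := by
    rw [h.spectralDensity_zero hγ, ← hs] at hf
    exact (pos_iff_pos_of_mul_pos hf).1 (by positivity)
  have hp := h.two_lt
  obtain ⟨κ, hκ, hκ2, hκp⟩ : ∃ κ, 0 < κ ∧ κ ≤ normL 2 (Y 0) μ ∧ κ ≤ normL p (Y 0) μ :=
    ⟨_, lt_min (h.normL_pos two_pos hp.le (hs ▸ hs0.ne'))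
      (h.normL_pos (by linarith) le_rfl (hs ▸ hs0.ne')), min_le_left _ _, min_le_right _ _⟩
  have hη2 : ∀ n, κ ≤ condSum 2 Y μ n := fun n => hκ2.trans (h.normL_le_condSum 2 n)
  have hη : ∀ n, κ ≤ eta p Y μ n := fun n => hκp.trans (h.normL_le_condSum p n)
  obtain ⟨c, hc, hmain⟩ := h.exists_wasserstein_le hp3 hγ hs0 hs
  obtain ⟨c₀, hc₀⟩ : ∃ c₀, c₀ = 2 * √(|autocov Y μ 0| +
    2 * ∑' k : ℕ, (k : ℝ) ^ 2 * |autocov Y μ k|) := ⟨_, rfl⟩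
  have hc₀0 : 0 ≤ c₀ := by rw [hc₀]; positivity
  have hcrude : ∀ n, wasserstein 1 (μ.map (linStat α Y n)) (gaussianReal 0 (linVar α Y μ n)) ≤
      ENNReal.ofReal (c₀ * √(sumSq α n)) := fun n => by
    rw [linVar, linStat_eq_partialSum, sumSq_eq, hc₀]
    exact h.wasserstein_le_sqrt hγ n _
  obtain ⟨δ, hδ⟩ : ∃ δ : ℕ → ℝ, δ = fun n =>
    √(∑ k ∈ Finset.Icc 1 (n + 1), (α k n - α (k - 1) n) ^ 2) := ⟨_, rfl⟩
  have hδ0 : ∀ n, 0 ≤ δ n := fun n => by rw [hδ]; positivity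
  have hmain' : ∀ n, 0 < maxCoef α n → wasserstein 1 (μ.map (linStat α Y n))
      (gaussianReal 0 (linVar α Y μ n)) ≤ ENNReal.ofReal (c * (maxCoef α n + δ n +
        (∑ i ∈ Finset.range n, coefSeq α n i ^ 2 *
          restVar s (maxCoef α n + δ n) (coefSeq α n) n (i + 1) ^ (-((p - 1) / 2))) *
          (maxCoef α n ^ (p - 2) * (1 + Lam p Y μ n + eta p Y μ n)))) := fun n hm => by
    rw [linVar, linStat_eq_partialSum]
    refine hmain n _ _ _ hm (hδ0 n) (fun l => coefSeq_of_le α n) (abs_coefSeq_le α n) ?_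
    rw [hδ, Real.sq_sqrt (Finset.sum_nonneg fun _ _ => sq_nonneg _)]
    exact sum_sq_coefSeq_sub_le α n
  have hrate0 : ∀ n, 0 ≤ rate α p Y μ n := fun n => by
    have h1 := B_nonneg α p Y μ n
    have h2 := maxCoef_nonneg α n
    have h3 := hκ.le.trans (hη2 n)
    rw [rate]; positivity
  -- the constants of the three regimes
  suffices hsuff : ∃ C₁ : ℝ, 0 < C₁ ∧ ∀ n, 0 < maxCoef α n →
      c₀ * √(sumSq α n) ≤ C₁ * rate α p Y μ n ∨
      maxCoef α n + δ n + (∑ i ∈ Finset.range n, coefSeq α n i ^ 2 *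
          restVar s (maxCoef α n + δ n) (coefSeq α n) n (i + 1) ^ (-((p - 1) / 2))) *
          (maxCoef α n ^ (p - 2) * (1 + Lam p Y μ n + eta p Y μ n)) ≤ C₁ * rate α p Y μ n by
    obtain ⟨C₁, hC₁, hbound⟩ := hsuff
    refine ⟨(1 + c) * C₁, by positivity, fun n => ?_⟩
    rcases (maxCoef_nonneg α n).eq_or_lt with h0 | hm
    · have : sumSq α n = 0 := by
        rw [sumSq_eq]
        refine Finset.sum_eq_zero fun i _ => ?_
        have := abs_coefSeq_le α n i
        rw [← h0, abs_nonpos_iff] at this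
        rw [this]; ring
      refine (hcrude n).trans (ENNReal.ofReal_le_ofReal ?_)
      rw [this, Real.sqrt_zero, mul_zero]
      exact mul_nonneg (by positivity) (hrate0 n)
    · have hr := mul_nonneg hC₁.le (hrate0 n)
      rcases hbound n hm with hb | hb
      · refine (hcrude n).trans (ENNReal.ofReal_le_ofReal ?_)
        nlinarith [mul_nonneg hc.le hr]
      · refine (hmain' n hm).trans (ENNReal.ofReal_le_ofReal ?_)
        nlinarith [mul_le_mul_of_nonneg_left hb hc.le]
  rcases hp3.eq_or_lt with rfl | hlt
  · obtain ⟨c₁, hc₁, hw⟩ := sum_weights_le_log hs0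
    refine ⟨c₀ * √2 * κ⁻¹ + (1 + κ⁻¹ + c₁ * (κ ^ ((3 : ℝ) - 2))⁻¹ * (1 + κ⁻¹ ^ 2 + κ⁻¹)),
      by positivity, fun n hm => ?_⟩
    have hB := B_nonneg α 3 Y μ n
    have hmS := mul_nonneg hm.le (hκ.le.trans (hη2 n))
    -- When few coefficients dominate, the logarithm in `B` can be close to zero; the crude bound is
    -- then of order `maxCoef`, hence within the first term of the rate.
    rcases lt_or_ge (sumSq α n) (2 * maxCoef α n ^ 2) with hlt | hge
    · left
      have h1 : √(sumSq α n) ≤ √2 * maxCoef α n := by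
        rw [← Real.sqrt_sq hm.le, ← Real.sqrt_mul zero_le_two]
        exact Real.sqrt_le_sqrt hlt.le
      have h2 : maxCoef α n ≤ κ⁻¹ * rate α 3 Y μ n := by
        rw [← div_eq_inv_mul, le_div_iff₀ hκ, rate]
        have := mul_le_mul_of_nonneg_left (hη2 n) hm.le
        have := Real.sqrt_nonneg (∑ k ∈ Finset.Icc 1 (n + 1), (α k n - α (k - 1) n) ^ 2)
        linarith
      calc c₀ * √(sumSq α n) ≤ c₀ * (√2 * (κ⁻¹ * rate α 3 Y μ n)) :=
            mul_le_mul_of_nonneg_left (h1.trans (by gcongr)) hc₀0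
        _ = c₀ * √2 * κ⁻¹ * rate α 3 Y μ n := by ring
        _ ≤ _ := by
          refine mul_le_mul_of_nonneg_right (le_add_of_nonneg_right ?_) (hrate0 n)
          positivity
    · right
      have h1 := hw n (coefSeq α n) (maxCoef α n) (maxCoef α n + δ n) hm
        (le_add_of_nonneg_right (hδ0 n)) (fun l => coefSeq_of_le α n) (abs_coefSeq_le α n)
        (by rwa [← sumSq_eq])
      rw [← sumSq_eq] at h1
      have hlog : 0 ≤ Real.log ((maxCoef α n)⁻¹ * √(sumSq α n)) := by
        refine Real.log_nonneg ?_
        rw [← div_eq_inv_mul, one_le_div hm]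
        exact Real.le_sqrt_of_sq_le (sq_maxCoef_le_sumSq α n)
      have h2 := lindeberg_bound_le_rate hκ hc₁ hp (hη n) (hη2 n) hm (hδ0 n) hlog h1
      refine h2.trans ?_
      have e : maxCoef α n * condSum 2 Y μ n + maxCoef α n ^ ((3 : ℝ) - 2) *
          eta 3 Y μ n ^ ((3 : ℝ) - 2) * (Lam 3 Y μ n + eta 3 Y μ n ^ 2) *
          Real.log ((maxCoef α n)⁻¹ * √(sumSq α n)) + δ n = rate α 3 Y μ n := by
        rw [rate, B, if_pos rfl, hδ, show (3 : ℝ) - 2 = 1 by norm_num, Real.rpow_one, Real.rpow_one]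
      rw [e]
      exact mul_le_mul_of_nonneg_right (le_add_of_nonneg_left (by positivity)) (hrate0 n)
  · obtain ⟨c₁, hc₁, hw⟩ := sum_weights_le_rpow hp hlt hs0
    refine ⟨1 + κ⁻¹ + c₁ * (κ ^ (p - 2))⁻¹ * (1 + κ⁻¹ ^ 2 + κ⁻¹), by positivity,
      fun n hm => Or.inr ?_⟩
    have h1 := hw n (coefSeq α n) (maxCoef α n + δ n) (add_pos_of_pos_of_nonneg hm (hδ0 n))
      (fun l => coefSeq_of_le α n)
      (fun i => (abs_coefSeq_le α n i).trans (le_add_of_nonneg_right (hδ0 n)))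
    rw [← sumSq_eq] at h1
    have h2 := lindeberg_bound_le_rate hκ hc₁ hp (hη n) (hη2 n) hm (hδ0 n)
      (Real.rpow_nonneg (sumSq_nonneg α n) _) h1
    rwa [show maxCoef α n * condSum 2 Y μ n + maxCoef α n ^ (p - 2) * eta p Y μ n ^ (p - 2) *
        (Lam p Y μ n + eta p Y μ n ^ 2) * sumSq α n ^ ((3 - p) / 2) + δ n = rate α p Y μ n by
      rw [rate, B, if_neg hlt.ne, hδ]] at h2

end Rate

end LinStat

theorem corollary4p2 {Ω : Type*} [MeasurableSpace Ω] (μ : Measure Ω) [IsProbabilityMeasure μ]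
    (p : ℝ) (hp : 2 < p) (hp' : p ≤ 3)
    (Y : ℤ → Ω → ℝ) (hmeas : ∀ i, Measurable (Y i))
    (hstat : LinStat.StrictlyStationary Y μ)
    (hLp : ∀ i, MemLp (Y i) (ENNReal.ofReal p) μ)
    (hcent : ∀ i, ∫ ω, Y i ω ∂μ = 0)
    (hγ : Summable fun k : ℕ => (k : ℝ) ^ 2 * |LinStat.autocov Y μ k|)
    (hf : 0 < LinStat.spectralDensity Y μ 0)
    (α : ℕ → ℕ → ℝ) :
    ∃ C : ℝ, 0 < C ∧ ∀ n : ℕ, 1 ≤ n →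
      LinStat.wasserstein 1 (μ.map (LinStat.linStat α Y n)) (gaussianReal 0 (LinStat.linVar α Y μ n))
        ≤ ENNReal.ofReal (C * (LinStat.maxCoef α n * LinStat.condSum 2 Y μ n
            + LinStat.B α p Y μ n
            + Real.sqrt (∑ k ∈ Finset.Icc 1 (n + 1), (α k n - α (k - 1) n) ^ 2))) := by
  have h : LinStat.IsAdmissible p Y μ := ⟨hp, hmeas, hstat, hLp, hcent⟩
  obtain ⟨C, hC, hle⟩ := h.exists_wasserstein_le_rate hp' hγ hf α
  exact ⟨C, hC, fun n _ => hle n⟩
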